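/- **Conventions on pre-Lie algebras.** A (left) pre-Lie algebra $(L,\triangleright)$ over $\mathbb R$ satisfies $(a\triangleright b)\triangleright c-a\triangleright(b\triangleright c)=(b\triangleright a)\triangleright c-b\triangleright(a\triangleright c)$. Let $U(L,\triangleright)$ be the universal enveloping algebra of the Lie algebra $L$ with bracket $[a,b]=a\triangleright b-b\triangleright a$. Let $\odot:U(L,\triangleright)\times L\to U(L,\triangleright)$ be the bilinear map determined by $1\odot a=a$ and $(bu)\odot a=b(u\odot a)-u\odot(b\triangleright a)$ for $a,b\in L$, $u\in U(L,\triangleright)$. Given a basis $(a_i)_{i\in\mathcal I}$ of $L$, the elements $A_I=\frac1{I!}\,a_{i_1}\odot\cdots\odot a_{i_n}$, for $I=e_{i_1}+\dots+e_{i_n}$ a finitely supported multi-index over $\mathcal I$, form a basis of $U(L,\triangleright)$, the Guin–Oudom basis. Let $\mathbb R[\mathcal I]$ be the free commutative algebra over $\mathcal I$, with monomials $a^I$. The transpose $\Delta_\triangleright$ of the concatenation product is $\Delta_\triangleright a^I=\sum_{I',I''}(\Delta_\triangleright)^I_{I',I''}\,a^{I'}\otimes a^{I''}$, where $A_{I'}A_{I''}=\sum_I(\Delta_\triangleright)^I_{I',I''}A_I$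 (when this sum is finite). **Multi-indices.** For a finitely supported $\beta:\mathbb N_0\to\mathbb N_0$ put $[\beta]=\sum_k(1-k)\beta(k)$, $|\beta|=\sum_k\beta(k)$, $z^\beta=\prod_k z_k^{\beta(k)}$ and $\sigma(\beta)=\prod_k(k!)^{\beta(k)}$. Let $\mathcal T_{\ge2}=\{\beta:[\beta]=1,\ |\beta|\ge2\}$ and let $T_{\ge2}$ be the span of $\{z^\beta\}_{\beta\in\mathcal T_{\ge2}}$ in $\mathbb R[z_0,z_1,\dots]$. With $D=\sum_{k\ge0}(k+1)z_{k+1}\partial_{z_k}$, the space $T_{\ge2}$ is a pre-Lie algebra under $$p\triangleright q=\sum_{k\ge0}\tfrac1{k!}(D^kp)\,\partial_{z_k}q .$$ Let $\Delta_\triangleright$ be the resulting coproduct on $\mathbb R[\mathcal T_{\ge2}]$ with respect to the basis $(z^\beta)$. **Trees.** Let $\mathcal H_{\ge2}$ be the set of (undecorated, non-planar) rooted trees with at least one edge and $\mathcal B_{\ge2}$ its linear span. It is a pre-Lie algebra under the insertion product $\tau'\triangleright_{\rm ins}\tau$, the sum over all vertices $v$ of $\tau$ of the trees obtained by replacing $v$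 by $\tau'$: the edge entering $v$ is attached to the root of $\tau'$, and the branches of $\tau$ at $v$ are grafted on the vertices of $\tau'$ in all possible ways. If $\tau$ has the branches $\tau_1,\dots,\tau_k$ at its root, its symmetry factor is defined recursively by $\sigma(\tau)=m!\prod_j\sigma(\tau_j)$, where $m!$ is the product of the factorials of the multiplicities of the distinct trees among $\tau_1,\dots,\tau_k$. For a tree $\tau$ let $\beta_\tau(k)$ be the number of vertices of $\tau$ with exactly $k$ children, and let $$\Psi:\mathcal B_{\ge2}\to T_{\ge2},\qquad \Psi[\tau]=\sigma(\beta_\tau)\,z^{\beta_\tau}.$$ The rooted tree Hopf algebra of Calaque–Ebrahimi-Fard–Manchon is the free commutative algebra $\mathbb R[\mathcal H_{\ge2}]$ with the extraction–contraction coproduct, the algebra morphism given on trees by $\Delta\tau=\sum_{s\subseteq\tau}s\otimes\tau/s$. Here $s$ runs over the spanning subforests of $\tau$, $\tau/s$ is obtained by contracting each component of $s$ to a vertex, $s$ stands for the product of its components, and the one-vertex tree is identified with $1$. **Statement.** 1. $\Psi$ is a pre-Lie morphism, $\Psi[\tau'\triangleright_{\rm ins}\tau]=\Psi[\tau']\triangleright\Psi[\tau]$;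 in particular it extends to an algebra morphism $\Psi:U(\mathcal B_{\ge2},\triangleright_{\rm ins})\to U(T_{\ge2},\triangleright)$. 2. $(\mathbb R[\mathcal T_{\ge2}],\Delta_\triangleright)$ and $(\mathbb R[\mathcal H_{\ge2}],\Delta)$, with the counits that send every generator to $0$, are Hopf algebras. 3. Pair $U(\mathcal B_{\ge2},\triangleright_{\rm ins})$ with $\mathbb R[\mathcal H_{\ge2}]$ by $\langle A_I,\tau^J\rangle_\sigma=\delta_I^J\prod_{\tau}\sigma(\tau)^{I(\tau)}$, where $(A_I)$ is the Guin–Oudom basis over the basis of trees and $\tau^J=\prod_\tau\tau^{J(\tau)}$, and pair $U(T_{\ge2},\triangleright)$ with $\mathbb R[\mathcal T_{\ge2}]$ canonically, that is, $\langle A_I,a^J\rangle=\delta_I^J$ for the Guin–Oudom basis and the monomials over $(z^\beta)$. Then $\Psi$ has a transpose $\Psi^\dagger:\mathbb R[\mathcal T_{\ge2}]\to\mathbb R[\mathcal H_{\ge2}]$, $$\langle u,\Psi^\dagger p\rangle_\sigma=\langle\Psi u,p\rangle\qquad(u\in U(\mathcal B_{\ge2},\triangleright_{\rm ins}),\ p\in\mathbb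 R[\mathcal T_{\ge2}]),$$ and $\Psi^\dagger$ is a Hopf algebra morphism from $(\mathbb R[\mathcal T_{\ge2}],\Delta_\triangleright)$ to the rooted tree Hopf algebra $(\mathbb R[\mathcal H_{\ge2}],\Delta)$: it is an algebra morphism and is compatible with coproducts, counits and antipodes. -/

import Mathlib

open scoped TensorProduct

noncomputable section

namespace GuinOudom

attribute [local instance] LieRing.ofAssociativeRing

variable {L : Type*} [LeftPreLieRing L] [LeftPreLieAlgebra ℝ L]

/-- The universal enveloping algebra of the Lie algebra `(L, [a, b] = a ▷ b - b ▷ a)` of a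
(left) pre-Lie algebra `L`; the pre-Lie product `a ▷ b` is written `a * b`. -/
abbrev U (L : Type*) [LeftPreLieRing L] [LeftPreLieAlgebra ℝ L] : Type _ :=
  UniversalEnvelopingAlgebra ℝ L

/-- The canonical map `L → U(L)`. -/
def inj (a : L) : U L := UniversalEnvelopingAlgebra.ι ℝ a

@[simp] lemma inj_add (a b : L) : inj (a + b) = inj a + inj b := by simp [inj]
@[simp] lemma inj_sub (a b : L) : inj (a - b) = inj a - inj b := by simp [inj]
@[simp] lemma inj_smul (r : ℝ) (a : L) : inj (r • a) = r • inj a := by simp [inj]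

lemma inj_comm (a b : L) : inj a * inj b - inj b * inj a = inj (a * b) - inj (b * a) := by
  rw [← inj_sub, inj, inj, inj]
  have := (UniversalEnvelopingAlgebra.ι ℝ (L := L)).map_lie a b
  rw [LieRing.of_associative_ring_bracket] at this
  rw [← this]; rfl

/-- Induction on the universal enveloping algebra by left concatenation of elements of `L`. -/
lemma U_induction {P : U L → Prop} (u : U L) (h1 : P 1)
    (hadd : ∀ u v, P u → P v → P (u + v)) (hsmul : ∀ (r : ℝ) u, P u → P (r • u))
    (hmul : ∀ (a : L) u, P u → P (inj a * u)) : P u := by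
  have key : ∀ x : TensorAlgebra ℝ L, ∀ u, P u →
      P (UniversalEnvelopingAlgebra.mkAlgHom ℝ L x * u) := by
    intro x
    induction x using TensorAlgebra.induction with
    | algebraMap r =>
      intro u hu
      rw [AlgHom.commutes, ← Algebra.smul_def]; exact hsmul r u hu
    | ι a => intro u hu; exact hmul a u hu
    | mul a b ha hb => intro u hu; rw [map_mul, mul_assoc]; exact ha _ (hb _ hu)
    | add a b ha hb => intro u hu; rw [map_add, add_mul]; exact hadd _ _ (ha _ hu) (hb _ hu)
  obtain ⟨x, rfl⟩ := (RingCon.mkₐ_surjective (α := ℝ) _ u)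
  have h := key x 1 h1
  rw [mul_one] at h
  exact h

/-- The action of `L` on linear maps `F : L → U(L)`, `(b · F)(a) = b F(a) - F(b ▷ a)`. -/
def actHom : L →ₗ⁅ℝ⁆ Module.End ℝ (L →ₗ[ℝ] U L) where
  toFun b :=
    { toFun := fun F =>
        { toFun := fun a => inj b * F a - F (b * a)
          map_add' := fun x y => by simp only [map_add, mul_add]; abel
          map_smul' := fun r x => by simp [smul_sub, mul_smul_comm] }
      map_add' := fun F G => by ext a; simp only [LinearMap.add_apply, LinearMap.coe_mk,
        AddHom.coe_mk, mul_add]; abel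
      map_smul' := fun r F => by ext a; simp [smul_sub] }
  map_add' := fun b c => by
    ext F a; simp only [inj_add, add_mul, map_add, LinearMap.add_apply, LinearMap.coe_mk,
        AddHom.coe_mk]; abel
  map_smul' := fun r b => by ext F a; simp [smul_sub, smul_mul_assoc]
  map_lie' := fun {b c} => by
    ext F a
    have h1 := inj_comm b c
    have h2 := LeftPreLieRing.assoc_symm b c a
    simp only [associator_apply] at h2
    have h3 : (b * c - c * b) * a = b * (c * a) - c * (b * a) := by
      rw [sub_mul]
      have h4 := sub_eq_zero.2 h2
      rw [← sub_eq_zero, ← h4]; abel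
    simp only [LieRing.of_associative_ring_bracket, LinearMap.coe_mk, AddHom.coe_mk,
      LinearMap.sub_apply, Module.End.mul_apply, Ring.lie_def, h3, inj_sub, ← h1, map_sub]
    noncomm_ring

/-- The right action `U ⊙ a` of `L` on `U(L)`, characterised by `1 ⊙ a = a` and
`(b U) ⊙ a = b (U ⊙ a) - U ⊙ (b ▷ a)`. -/
def odot (u : U L) : L →ₗ[ℝ] U L :=
  UniversalEnvelopingAlgebra.lift ℝ actHom u
    (UniversalEnvelopingAlgebra.ι ℝ (L := L) : L →ₗ[ℝ] U L)

@[simp] lemma odot_one (a : L) : odot (1 : U L) a = inj a := by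
  simp [odot, inj]

lemma odot_inj_mul (b : L) (u : U L) (a : L) :
    odot (inj b * u) a = inj b * odot u a - odot u (b * a) := by
  simp only [odot, map_mul, inj, UniversalEnvelopingAlgebra.lift_ι_apply, Module.End.mul_apply]
  rfl

lemma odot_add (u v : U L) (a : L) : odot (u + v) a = odot u a + odot v a := by simp [odot]
lemma odot_smul (r : ℝ) (u : U L) (a : L) : odot (r • u) a = r • odot u a := by simp [odot]
lemma odot_sub (u v : U L) (a : L) : odot (u - v) a = odot u a - odot v a := by simp [odot]

lemma odot_right_comm (u : U L) (a b : L) : odot (odot u a) b = odot (odot u b) a := by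
  induction u using U_induction generalizing a b with
  | h1 =>
    have h := inj_comm a b
    have e1 := odot_inj_mul a 1 b
    have e2 := odot_inj_mul b 1 a
    simp only [mul_one, odot_one] at e1 e2 ⊢
    rw [e1, e2]
    have h4 := sub_eq_zero.2 h
    rw [← sub_eq_zero, ← h4]; abel
  | hadd u v hu hv => simp only [odot_add, hu a b, hv a b]
  | hsmul r u hu => simp only [odot_smul, hu a b]
  | hmul c u hu =>
    simp only [odot_inj_mul, odot_sub, hu a b, hu a (c * b), hu (c * a) b]
    abel

/-- `a₁ ⊙ ⋯ ⊙ aₙ = (⋯ (1 ⊙ a₁) ⋯) ⊙ aₙ`, which does not depend on the order. -/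
def odotProd (m : Multiset L) : U L :=
  haveI : RightCommutative (fun (u : U L) (a : L) => odot u a) := ⟨odot_right_comm⟩
  m.foldl (fun u a => odot u a) 1

variable {ι : Type*}

/-- The elements `A_I = (1 / I!) a_{i₁} ⊙ ⋯ ⊙ a_{iₙ}` of the Guin–Oudom basis of `U(L)`, for a
basis `a` of `L` and a multi-index `I = e_{i₁} + ⋯ + e_{iₙ}`. -/
def goElem (a : Module.Basis ι ℝ L) (I : ι →₀ ℕ) : U L :=
  ((I.prod fun _ n => (n.factorial : ℝ))⁻¹) • odotProd (I.toMultiset.map a)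

/-- The action of `b ∈ L` on the polynomial algebra: multiplication by `b` plus the derivation
extending `b ▷ ·`. -/
def lin (a : Module.Basis ι ℝ L) : L →ₗ[ℝ] MvPolynomial ι ℝ :=
  a.constr ℝ (fun i => MvPolynomial.X i)

@[simp] lemma lin_basis (a : Module.Basis ι ℝ L) (i : ι) : lin a (a i) = MvPolynomial.X i := by
  simp [lin]

def der (a : Module.Basis ι ℝ L) (b : L) :
    Derivation ℝ (MvPolynomial ι ℝ) (MvPolynomial ι ℝ) :=
  MvPolynomial.mkDerivation ℝ (fun i => lin a (b * a i))

lemma der_lin (a : Module.Basis ι ℝ L) (b c : L) : der a b (lin a c) = lin a (b * c) := by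
  have : (der a b).toLinearMap ∘ₗ lin a = lin a ∘ₗ LinearMap.mulLeft ℝ b := by
    refine a.ext fun i => ?_
    simp [der, MvPolynomial.mkDerivation_X]
  exact LinearMap.congr_fun this c

lemma der_lie (a : Module.Basis ι ℝ L) (b c : L) (p : MvPolynomial ι ℝ) :
    der a (b * c - c * b) p = der a b (der a c p) - der a c (der a b p) := by
  have : der a (b * c - c * b) = ⁅der a b, der a c⁆ := by
    refine MvPolynomial.derivation_ext fun i => ?_
    have h2 := LeftPreLieRing.assoc_symm b c (a i)
    simp only [associator_apply] at h2
    rw [Derivation.commutator_apply, ← lin_basis a i]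
    simp only [der_lin]
    rw [← map_sub]
    congr 1
    rw [sub_mul]
    have h4 := sub_eq_zero.2 h2
    rw [← sub_eq_zero, ← h4]; abel
  rw [this, Derivation.commutator_apply]

def polyAct (a : Module.Basis ι ℝ L) : L →ₗ⁅ℝ⁆ Module.End ℝ (MvPolynomial ι ℝ) where
  toFun b := LinearMap.mulLeft ℝ (lin a b) + (der a b).toLinearMap
  map_add' b c := by
    have : der a (b + c) = der a b + der a c := by
      refine MvPolynomial.derivation_ext fun i => ?_
      simp [der, MvPolynomial.mkDerivation_X, add_mul]
    ext1 x; ext1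
    simp [this, add_mul]; abel
  map_smul' r b := by
    have : der a (r • b) = r • der a b := by
      refine MvPolynomial.derivation_ext fun i => ?_
      simp [der, MvPolynomial.mkDerivation_X, smul_mul_assoc]
    ext1 x; ext1
    simp [this]
  map_lie' {b c} := by
    refine LinearMap.ext fun p => ?_
    have h := der_lie a b c p
    simp only [LieRing.of_associative_ring_bracket, LinearMap.add_apply, LinearMap.sub_apply,
      Module.End.mul_apply, LinearMap.mulLeft_apply, Derivation.coeFn_coe, Ring.lie_def, h,
      map_add, Derivation.leibniz, der_lin, map_sub, smul_eq_mul]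
    ring

/-- The comparison map `U(L) → ℝ[ι]`, `u ↦ u · 1`. -/
def toPoly (a : Module.Basis ι ℝ L) : U L →ₗ[ℝ] MvPolynomial ι ℝ :=
  (LinearMap.applyₗ (1 : MvPolynomial ι ℝ)) ∘ₗ
    (UniversalEnvelopingAlgebra.lift ℝ (polyAct a)).toLinearMap

lemma toPoly_one (a : Module.Basis ι ℝ L) : toPoly a 1 = 1 := by simp [toPoly]

lemma toPoly_inj_mul (a : Module.Basis ι ℝ L) (b : L) (u : U L) :
    toPoly a (inj b * u) = lin a b * toPoly a u + der a b (toPoly a u) := by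
  simp only [toPoly, LinearMap.comp_apply, AlgHom.toLinearMap_apply, map_mul, inj,
    UniversalEnvelopingAlgebra.lift_ι_apply]
  rfl

lemma toPoly_odot (a : Module.Basis ι ℝ L) (u : U L) (c : L) :
    toPoly a (odot u c) = toPoly a u * lin a c := by
  induction u using U_induction generalizing c with
  | h1 =>
    have := toPoly_inj_mul a c 1
    simpa [toPoly_one] using this
  | hadd u v hu hv => simp only [odot_add, map_add, hu, hv, add_mul]
  | hsmul r u hu => simp only [odot_smul, map_smul, hu, smul_mul_assoc]
  | hmul b u hu =>
    simp only [odot_inj_mul, map_sub, toPoly_inj_mul, hu, Derivation.leibniz, der_lin, smul_eq_mul]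
    ring

lemma odotProd_cons (c : L) (m : Multiset L) : odotProd (c ::ₘ m) = odot (odotProd m) c := by
  have : RightCommutative (fun (u : U L) (a : L) => odot u a) := ⟨odot_right_comm⟩
  rw [← Multiset.singleton_add, add_comm, odotProd, Multiset.foldl_add]
  rfl

/-- The inverse map, sending `X^I` to `a_{i₁} ⊙ ⋯ ⊙ a_{iₙ}`. -/
def ofPoly (a : Module.Basis ι ℝ L) : MvPolynomial ι ℝ →ₗ[ℝ] U L :=
  (MvPolynomial.basisMonomials ι ℝ).constr ℝ (fun I => odotProd (I.toMultiset.map a))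

lemma ofPoly_monomial (a : Module.Basis ι ℝ L) (I : ι →₀ ℕ) :
    ofPoly a (MvPolynomial.monomial I 1) = odotProd (I.toMultiset.map a) := by
  have h : MvPolynomial.monomial I (1 : ℝ) = MvPolynomial.basisMonomials ι ℝ I := by
    rw [MvPolynomial.coe_basisMonomials]
  rw [h, ofPoly, Module.Basis.constr_basis]

lemma ofPoly_mul_lin (a : Module.Basis ι ℝ L) (p : MvPolynomial ι ℝ) (c : L) :
    ofPoly a (p * lin a c) = odot (ofPoly a p) c := by
  have key : ∀ i, ofPoly a (p * MvPolynomial.X i) = odot (ofPoly a p) (a i) := by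
    intro i
    induction p using MvPolynomial.induction_on' with
    | add p q hp hq => simp only [add_mul, map_add, hp, hq, odot_add]
    | monomial I r =>
      have hr : MvPolynomial.monomial I r = r • MvPolynomial.monomial I (1 : ℝ) := by
        simp [MvPolynomial.smul_monomial]
      rw [hr, smul_mul_assoc, map_smul, map_smul, odot_smul, MvPolynomial.X,
        MvPolynomial.monomial_mul, mul_one, ofPoly_monomial, ofPoly_monomial]
      congr 1
      rw [map_add, Finsupp.toMultiset_single, one_smul, add_comm, Multiset.singleton_add,
        Multiset.map_cons, odotProd_cons]
  have : ofPoly a ∘ₗ LinearMap.mulLeft ℝ p ∘ₗ lin a = odot (ofPoly a p) := by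
    refine a.ext fun i => ?_
    simp [key]
  exact LinearMap.congr_fun this c

lemma ofPoly_one (a : Module.Basis ι ℝ L) : ofPoly a 1 = 1 := by
  have := ofPoly_monomial a 0
  simpa [odotProd] using this

lemma ofPoly_act (a : Module.Basis ι ℝ L) (b : L) (p : MvPolynomial ι ℝ) :
    ofPoly a (lin a b * p + der a b p) = inj b * ofPoly a p := by
  induction p using MvPolynomial.induction_on with
  | C r =>
    have : (MvPolynomial.C r : MvPolynomial ι ℝ) = r • 1 := by
      simp [MvPolynomial.smul_eq_C_mul]
    have h := ofPoly_mul_lin a 1 b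
    rw [one_mul, ofPoly_one, odot_one] at h
    simp [this, ofPoly_one, h]
  | add p q hp hq =>
    rw [map_add (ofPoly a) p q, mul_add (inj b), ← hp, ← hq, ← map_add]
    congr 1; rw [map_add, mul_add]; abel
  | mul_X p i hp =>
    rw [← lin_basis a i, Derivation.leibniz, der_lin, ofPoly_mul_lin, smul_eq_mul, smul_eq_mul]
    have : lin a b * (p * lin a (a i)) + (p * lin a (b * a i) + lin a (a i) * der a b p) =
        (lin a b * p + der a b p) * lin a (a i) + p * lin a (b * a i) := by ring
    rw [this, map_add, ofPoly_mul_lin, ofPoly_mul_lin, hp, odot_inj_mul]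
    abel

lemma toPoly_ofPoly (a : Module.Basis ι ℝ L) (p : MvPolynomial ι ℝ) :
    toPoly a (ofPoly a p) = p := by
  induction p using MvPolynomial.induction_on with
  | C r =>
    have : (MvPolynomial.C r : MvPolynomial ι ℝ) = r • 1 := by
      simp [MvPolynomial.smul_eq_C_mul]
    simp [this, ofPoly_one, toPoly_one]
  | add p q hp hq => rw [map_add, map_add, hp, hq]
  | mul_X p i hp => rw [← lin_basis a i, ofPoly_mul_lin, toPoly_odot, hp]

lemma ofPoly_toPoly (a : Module.Basis ι ℝ L) (u : U L) : ofPoly a (toPoly a u) = u := by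
  induction u using U_induction with
  | h1 => rw [toPoly_one, ofPoly_one]
  | hadd u v hu hv => rw [map_add, map_add, hu, hv]
  | hsmul r u hu => rw [map_smul, map_smul, hu]
  | hmul b u hu => rw [toPoly_inj_mul, ofPoly_act, hu]

/-- `U(L)` is isomorphic to the polynomial algebra as a vector space. -/
def polyEquiv (a : Module.Basis ι ℝ L) : MvPolynomial ι ℝ ≃ₗ[ℝ] U L :=
  LinearEquiv.ofLinearMap (ofPoly a) (toPoly a)
    (LinearMap.ext (ofPoly_toPoly a)) (LinearMap.ext (toPoly_ofPoly a))

lemma factorial_ne_zero (I : ι →₀ ℕ) : (I.prod fun _ n => (n.factorial : ℝ))⁻¹ ≠ 0 :=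
  inv_ne_zero (Finset.prod_ne_zero_iff.2 fun _ _ => Nat.cast_ne_zero.2 (Nat.factorial_ne_zero _))

/-- The Guin–Oudom basis `(A_I)_I` of `U(L)`. -/
def goBasis (a : Module.Basis ι ℝ L) : Module.Basis (ι →₀ ℕ) ℝ (U L) :=
  ((MvPolynomial.basisMonomials ι ℝ).map (polyEquiv a)).unitsSMul
    (fun I => Units.mk0 _ (factorial_ne_zero I))

lemma goBasis_apply (a : Module.Basis ι ℝ L) (I : ι →₀ ℕ) : goBasis a I = goElem a I := by
  rw [goBasis, Module.Basis.unitsSMul_apply, Module.Basis.map_apply,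
    MvPolynomial.coe_basisMonomials, goElem, ← ofPoly_monomial]
  rfl

open Classical in
/-- The pairing of `U(L)` with the free commutative algebra `ℝ[ι]` given on the Guin–Oudom basis
and on monomials by `⟨A_I, X^J⟩ = δ_{IJ} ∏ᵢ w(i)^{I(i)}`. The weight `w = 1` gives the canonical
pairing. -/
def pairing (a : Module.Basis ι ℝ L) (w : ι → ℝ) : U L →ₗ[ℝ] MvPolynomial ι ℝ →ₗ[ℝ] ℝ :=
  (goBasis a).constr ℝ fun I =>
    (MvPolynomial.basisMonomials ι ℝ).constr ℝ fun J =>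
      if I = J then I.prod fun i n => w i ^ n else 0

/-- The transpose `Δ : ℝ[ι] → ℝ[ι] ⊗ ℝ[ι]` of the concatenation product of `U(L)` with respect to
the Guin–Oudom basis: `Δ X^I = ∑_{I', I''} c^I_{I', I''} X^{I'} ⊗ X^{I''}`, where
`A_{I'} A_{I''} = ∑_I c^I_{I', I''} A_I`. -/
def coprod (a : Module.Basis ι ℝ L) :
    MvPolynomial ι ℝ →ₗ[ℝ] MvPolynomial ι ℝ ⊗[ℝ] MvPolynomial ι ℝ :=
  (MvPolynomial.basisMonomials ι ℝ).constr ℝ fun I =>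
    ∑ᶠ J : (ι →₀ ℕ) × (ι →₀ ℕ),
      (goBasis a).repr (goBasis a J.1 * goBasis a J.2) I •
        (MvPolynomial.monomial J.1 (1 : ℝ) ⊗ₜ[ℝ] MvPolynomial.monomial J.2 (1 : ℝ))

end GuinOudom

namespace MultiIndex

/-- `[β] = ∑_k (1 - k) β(k)`. -/
def bracket (β : ℕ →₀ ℕ) : ℤ := β.sum fun k n => (1 - (k : ℤ)) * n

/-- The length `|β| = ∑_k β(k)`. -/
def length (β : ℕ →₀ ℕ) : ℕ := β.sum fun _ n => n

/-- The populated multi-indices of length at least two. -/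
def populatedTwo : Set (ℕ →₀ ℕ) := {β | bracket β = 1 ∧ 2 ≤ length β}

/-- The index set `𝒯_{≥2}` as a type. -/
abbrev PopTwo : Type := populatedTwo

/-- `T_{≥2}`: the span of the monomials `z^β`, `β ∈ 𝒯_{≥2}`, in `ℝ[z_0, z_1, …]`. -/
def TTwo : Submodule ℝ (MvPolynomial ℕ ℝ) := MvPolynomial.restrictSupport ℝ populatedTwo

/-- The basis `(z^β)_β` of `T_{≥2}`. -/
def zBasis : Module.Basis PopTwo ℝ TTwo := MvPolynomial.basisRestrictSupport ℝ populatedTwo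

lemma zBasis_apply (β : PopTwo) :
    (zBasis β : MvPolynomial ℕ ℝ) = MvPolynomial.monomial β.1 1 := by
  classical
  have : zBasis.repr ⟨MvPolynomial.monomial β.1 1,
      (MvPolynomial.monomial_mem_restrictSupport ℝ).2 (Or.inl β.2)⟩ = Finsupp.single β 1 := by
    ext γ
    have h : zBasis.repr ⟨MvPolynomial.monomial β.1 1,
      (MvPolynomial.monomial_mem_restrictSupport ℝ).2 (Or.inl β.2)⟩ γ =
      MvPolynomial.coeff γ.1 (MvPolynomial.monomial β.1 (1 : ℝ)) := rfl
    rw [h, MvPolynomial.coeff_monomial, Finsupp.single_apply]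
    simp [Subtype.ext_iff]
  rw [← zBasis.repr_symm_single_one, ← this, LinearEquiv.symm_apply_apply]

/-- The derivation `D = ∑_k (k + 1) z_{k+1} ∂_{z_k}`. -/
def D : Derivation ℝ (MvPolynomial ℕ ℝ) (MvPolynomial ℕ ℝ) :=
  MvPolynomial.mkDerivation ℝ fun k => ((k : ℝ) + 1) • MvPolynomial.X (k + 1)

/-- `p ▷ q = ∑_k (1/k!) (D^k p) ∂_{z_k} q` on `ℝ[z_0, z_1, …]`: for fixed `p` this is the
derivation with `p ▷ z_k = (1/k!) D^k p`; see `shift_eq` for the sum. -/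
def shift : MvPolynomial ℕ ℝ →ₗ[ℝ]
    Derivation ℝ (MvPolynomial ℕ ℝ) (MvPolynomial ℕ ℝ) where
  toFun p := MvPolynomial.mkDerivation ℝ fun k =>
    ((k.factorial : ℝ)⁻¹) • ((D.toLinearMap ^ k : Module.End ℝ (MvPolynomial ℕ ℝ)) p)
  map_add' p q := MvPolynomial.derivation_ext fun k => by
    simp [MvPolynomial.mkDerivation_X]
  map_smul' r p := MvPolynomial.derivation_ext fun k => by
    simp [MvPolynomial.mkDerivation_X, smul_comm r]

lemma shift_X (p : MvPolynomial ℕ ℝ) (k : ℕ) : shift p (MvPolynomial.X k) =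
    ((k.factorial : ℝ)⁻¹) • ((D.toLinearMap ^ k : Module.End ℝ (MvPolynomial ℕ ℝ)) p) := by
  simp [shift, MvPolynomial.mkDerivation_X]

lemma shift_eq (p q : MvPolynomial ℕ ℝ) :
    shift p q = ∑ k ∈ q.vars, ((k.factorial : ℝ)⁻¹) •
      (((D.toLinearMap ^ k : Module.End ℝ (MvPolynomial ℕ ℝ)) p) * MvPolynomial.pderiv k q) := by
  have : shift p q = (∑ k ∈ q.vars, (((k.factorial : ℝ)⁻¹) •
      ((D.toLinearMap ^ k : Module.End ℝ (MvPolynomial ℕ ℝ)) p)) • MvPolynomial.pderiv k :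
      Derivation ℝ (MvPolynomial ℕ ℝ) (MvPolynomial ℕ ℝ)) q := by
    refine MvPolynomial.derivation_eq_of_forall_mem_vars fun i hi => ?_
    rw [shift_X, ← Derivation.coeFnAddMonoidHom_apply, map_sum, Finset.sum_apply,
      Finset.sum_eq_single i]
    · simp
    · intro j _ hj
      simp [MvPolynomial.pderiv_X_of_ne hj.symm]
    · exact fun h => absurd hi h
  rw [this, ← Derivation.coeFnAddMonoidHom_apply, map_sum, Finset.sum_apply]
  simp

lemma shift_D (p q : MvPolynomial ℕ ℝ) : shift p (D q) = D (shift p q) := by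
  have : ⁅shift p, D⁆ = 0 := by
    refine MvPolynomial.derivation_ext fun k => ?_
    rw [Derivation.commutator_apply, shift_X, Derivation.map_smul, D,
      MvPolynomial.mkDerivation_X, Derivation.map_smul, shift_X, ← D, pow_succ',
      Module.End.mul_apply, smul_smul, Nat.factorial_succ]
    have h1 : ((k : ℝ) + 1) ≠ 0 := by positivity
    have h2 : (k.factorial : ℝ) ≠ 0 := by positivity
    have : ((k : ℝ) + 1) * (((k + 1) * k.factorial : ℕ) : ℝ)⁻¹ = (k.factorial : ℝ)⁻¹ := by
      push_cast; field_simp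
    rw [this]
    simp
  have h := congrArg (fun E : Derivation ℝ (MvPolynomial ℕ ℝ) (MvPolynomial ℕ ℝ) => E q) this
  simp only [Derivation.commutator_apply, Derivation.coe_zero, Pi.zero_apply] at h
  exact sub_eq_zero.1 h

lemma shift_D_pow (p q : MvPolynomial ℕ ℝ) (k : ℕ) :
    shift p ((D.toLinearMap ^ k : Module.End ℝ (MvPolynomial ℕ ℝ)) q) =
      (D.toLinearMap ^ k : Module.End ℝ (MvPolynomial ℕ ℝ)) (shift p q) := by
  induction k with
  | zero => simp
  | succ k ih =>
    rw [pow_succ', Module.End.mul_apply, Module.End.mul_apply, ← ih]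
    exact shift_D _ _

lemma shift_shift (p q r : MvPolynomial ℕ ℝ) :
    shift (shift p q) r - shift p (shift q r) = shift (shift q p) r - shift q (shift p r) := by
  have : ⁅shift p, shift q⁆ = shift (shift p q - shift q p) := by
    refine MvPolynomial.derivation_ext fun k => ?_
    rw [Derivation.commutator_apply]
    rw [map_sub, Derivation.sub_apply]
    simp only [shift_X, Derivation.map_smul, shift_D_pow]
  have h := congrArg (fun E : Derivation ℝ (MvPolynomial ℕ ℝ) (MvPolynomial ℕ ℝ) => E r) this
  simp only [Derivation.commutator_apply, map_sub, Derivation.coe_sub, Pi.sub_apply] at h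
  linear_combination -h

/-- The weight of the variables whose first component is `[·]` and whose second is the length. -/
def wt (k : ℕ) : ℤ × ℤ := (1 - (k : ℤ), 1)

lemma weight_wt (β : ℕ →₀ ℕ) : Finsupp.weight wt β = (bracket β, (length β : ℤ)) := by
  rw [Finsupp.weight_apply, bracket, length, Finsupp.sum, Finsupp.sum, Finsupp.sum]
  refine Prod.ext ?_ ?_
  · rw [Prod.fst_sum]; exact Finset.sum_congr rfl fun k _ => by simp [wt, mul_comm]
  · rw [Prod.snd_sum]; push_cast; exact Finset.sum_congr rfl fun k _ => by simp [wt]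

lemma derivation_homogeneous (E : Derivation ℝ (MvPolynomial ℕ ℝ) (MvPolynomial ℕ ℝ))
    (c n : ℤ × ℤ) (hE : ∀ k, (E (MvPolynomial.X k)).IsWeightedHomogeneous wt (wt k + c))
    {p : MvPolynomial ℕ ℝ} (hp : p.IsWeightedHomogeneous wt n) :
    (E p).IsWeightedHomogeneous wt (n + c) := by
  have hmon : ∀ (β : ℕ →₀ ℕ) (r : ℝ), (E (MvPolynomial.monomial β r)).IsWeightedHomogeneous wt
      (Finsupp.weight wt β + c) := by
    intro β r
    induction β using Finsupp.induction_linear generalizing r with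
    | zero =>
      have : E (MvPolynomial.monomial 0 r) = 0 := by
        rw [MvPolynomial.monomial_zero', MvPolynomial.derivation_C]
      rw [this]; exact MvPolynomial.isWeightedHomogeneous_zero _ _ _
    | add β γ hβ hγ =>
      have : MvPolynomial.monomial (β + γ) r =
          MvPolynomial.monomial β r * MvPolynomial.monomial γ (1 : ℝ) := by
        simp [MvPolynomial.monomial_mul]
      rw [this, Derivation.leibniz, map_add, smul_eq_mul, smul_eq_mul]
      refine MvPolynomial.IsWeightedHomogeneous.add ?_ ?_
      · rw [add_assoc]
        exact (MvPolynomial.isWeightedHomogeneous_monomial _ _ _ rfl).mul (hγ 1)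
      · rw [add_comm (Finsupp.weight wt β), add_assoc]
        exact (MvPolynomial.isWeightedHomogeneous_monomial _ _ _ rfl).mul (hβ r)
    | single k m =>
      have : MvPolynomial.monomial (Finsupp.single k m) r =
          r • (MvPolynomial.X k : MvPolynomial ℕ ℝ) ^ m := by
        rw [MvPolynomial.X_pow_eq_monomial, MvPolynomial.smul_monomial, smul_eq_mul, mul_one]
      rw [this, Derivation.map_smul, Derivation.leibniz_pow]
      cases m with
      | zero => simp [MvPolynomial.isWeightedHomogeneous_zero]
      | succ m =>
        have h := ((MvPolynomial.isWeightedHomogeneous_X ℝ wt k).pow m).mul (hE k)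
        have e : Finsupp.weight wt (Finsupp.single k (m + 1)) + c = m • wt k + (wt k + c) := by
          rw [Finsupp.weight_apply, Finsupp.sum_single_index (by simp), succ_nsmul, add_assoc]
        rw [e, ← MvPolynomial.mem_weightedHomogeneousSubmodule]
        refine Submodule.smul_mem _ _ (nsmul_mem ?_ _)
        exact h
  rw [p.as_sum, map_sum]
  refine MvPolynomial.IsWeightedHomogeneous.sum _ _ _ fun β hβ => ?_
  rw [← hp (MvPolynomial.mem_support_iff.1 hβ)]
  exact hmon _ _

lemma D_pow_homogeneous {p : MvPolynomial ℕ ℝ} {a b : ℤ}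
    (hp : p.IsWeightedHomogeneous wt (a, b)) (k : ℕ) :
    ((D.toLinearMap ^ k : Module.End ℝ (MvPolynomial ℕ ℝ)) p).IsWeightedHomogeneous wt
      (a - k, b) := by
  induction k with
  | zero => simpa using hp
  | succ k ih =>
    rw [pow_succ', Module.End.mul_apply]
    have := derivation_homogeneous D (-1, 0) (a - k, b) (fun j => by
      rw [D, MvPolynomial.mkDerivation_X, ← MvPolynomial.mem_weightedHomogeneousSubmodule]
      refine Submodule.smul_mem _ _ ?_
      have e : wt j + (-1, 0) = wt (j + 1) := by
        simp [wt]; ring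
      rw [e]
      exact MvPolynomial.isWeightedHomogeneous_X ℝ wt (j + 1)) ih
    have e : (a - ((k + 1 : ℕ) : ℤ), b) = (a - k, b) + (-1, 0) := by
      simp; ring
    rw [e]
    exact this

lemma shift_homogeneous {p q : MvPolynomial ℕ ℝ} {b c : ℤ}
    (hp : p.IsWeightedHomogeneous wt (1, b)) (hq : q.IsWeightedHomogeneous wt (1, c)) :
    (shift p q).IsWeightedHomogeneous wt (1, b + c - 1) := by
  have := derivation_homogeneous (shift p) (0, b - 1) (1, c) (fun k => by
    rw [shift_X, ← MvPolynomial.mem_weightedHomogeneousSubmodule]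
    refine Submodule.smul_mem _ _ ?_
    have e : wt k + (0, b - 1) = (1 - (k : ℤ), b) := by simp [wt]
    rw [e]
    exact D_pow_homogeneous hp k) hq
  have e : ((1 : ℤ), b + c - 1) = (1, c) + (0, b - 1) := by
    simp; ring
  rw [e]
  exact this

lemma shift_mem {p q : MvPolynomial ℕ ℝ} (hp : p ∈ TTwo) (hq : q ∈ TTwo) :
    shift p q ∈ TTwo := by
  have hmon : ∀ β ∈ populatedTwo, (MvPolynomial.monomial β (1 : ℝ)).IsWeightedHomogeneous wt
      (1, (length β : ℤ)) := fun β hβ =>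
    MvPolynomial.isWeightedHomogeneous_monomial _ _ _ (by rw [weight_wt, hβ.1])
  rw [TTwo, MvPolynomial.restrictSupport_eq_span] at hp hq
  induction hp, hq using Submodule.span_induction₂ with
  | mem_mem p q hp hq =>
    obtain ⟨β, hβ, rfl⟩ := hp
    obtain ⟨γ, hγ, rfl⟩ := hq
    have h := shift_homogeneous (hmon β hβ) (hmon γ hγ)
    rw [TTwo, MvPolynomial.mem_restrictSupport_iff]
    intro δ hδ
    have := h (MvPolynomial.mem_support_iff.1 hδ)
    rw [weight_wt, Prod.mk.injEq] at this
    refine ⟨this.1, ?_⟩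
    have h1 := hβ.2
    have h2 := hγ.2
    have h3 := this.2
    omega
  | zero_left => simp
  | zero_right => simp
  | add_left p p' q _ _ _ h h' => simpa using Submodule.add_mem _ h h'
  | add_right p q q' _ _ _ h h' => simpa using Submodule.add_mem _ h h'
  | smul_left r p q _ _ h => simpa using Submodule.smul_mem _ r h
  | smul_right r p q _ _ h => simpa using Submodule.smul_mem _ r h

/-- The pre-Lie product `▷` of `T_{≥2}`, written `p * q`. -/
instance : LeftPreLieRing TTwo where
  mul p q := ⟨shift p.1 q.1, shift_mem p.2 q.2⟩
  left_distrib p q r := Subtype.ext (map_add _ _ _)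
  right_distrib p q r := Subtype.ext (by
    change shift (p.1 + q.1) r.1 = _
    rw [map_add]; rfl)
  zero_mul p := Subtype.ext (by
    change shift 0 p.1 = _
    rw [map_zero]; rfl)
  mul_zero p := Subtype.ext (map_zero _)
  assoc_symm' p q r := Subtype.ext (shift_shift p.1 q.1 r.1)

instance : LeftPreLieAlgebra ℝ TTwo where
  smul_assoc r p q := Subtype.ext (by
    change shift (r • p.1) q.1 = r • shift p.1 q.1
    rw [map_smul]; rfl)
  smul_comm r p q := Subtype.ext (((shift p.1).map_smul r q.1).symm)

end MultiIndex

/-- Planar rooted trees: `leaf` is the one-vertex tree, and `graft t s` is obtained from `s` by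
adding a new (leftmost) edge from the root of `s` to the root of `t`. -/
inductive PlanarTree : Type
  | leaf : PlanarTree
  | graft : PlanarTree → PlanarTree → PlanarTree

/-- Planar trees are equivalent if they differ by permutations of the branches at the vertices. -/
inductive PlanarTree.Equiv : PlanarTree → PlanarTree → Prop
  | refl (t) : PlanarTree.Equiv t t
  | symm {t s} : PlanarTree.Equiv t s → PlanarTree.Equiv s t
  | trans {t s r} : PlanarTree.Equiv t s → PlanarTree.Equiv s r → PlanarTree.Equiv t r
  | congr {t t' s s'} : PlanarTree.Equiv t t' → PlanarTree.Equiv s s' →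
      PlanarTree.Equiv (.graft t s) (.graft t' s')
  | swap (t t' s) : PlanarTree.Equiv (.graft t (.graft t' s)) (.graft t' (.graft t s))

instance PlanarTree.setoid : Setoid PlanarTree :=
  ⟨PlanarTree.Equiv, .refl, .symm, .trans⟩

/-- (Non-planar, undecorated) rooted trees. -/
def RTree : Type := Quotient PlanarTree.setoid

namespace RTree

/-- The tree with a single vertex. -/
def leaf : RTree := ⟦.leaf⟧

/-- `graft t s` adds to `s` a new edge from the root of `s` to the root of `t`. A tree whose root
has the branches `t₁, …, tₖ` is `graft t₁ (⋯ (graft tₖ leaf))`. -/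
def graft : RTree → RTree → RTree :=
  Quotient.map₂ .graft fun _ _ h _ _ h' => .congr h h'

lemma graft_swap (t t' s : RTree) : graft t (graft t' s) = graft t' (graft t s) := by
  induction t using Quotient.ind
  induction t' using Quotient.ind
  induction s using Quotient.ind
  exact Quotient.sound (.swap _ _ _)

lemma ind {P : RTree → Prop} (t : RTree) (hl : P leaf)
    (hg : ∀ t s, P t → P s → P (graft t s)) : P t := by
  induction t using Quotient.ind with
  | _ t =>
    induction t with
    | leaf => exact hl
    | graft t s ht hs => exact hg ⟦t⟧ ⟦s⟧ ht hs

/-- Definition of functions `f` on rooted trees by recursion: `f leaf = x` and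
`f (graft t s) = g t (f t) s (f s)`, for `g` symmetric in the branches. -/
def recur {X : Sort*} (x : X) (g : RTree → X → RTree → X → X)
    (hg : ∀ t x t' x' s y,
      g t x (graft t' s) (g t' x' s y) = g t' x' (graft t s) (g t x s y)) (t : RTree) : X :=
  Quotient.lift (fun p : PlanarTree =>
    PlanarTree.rec (motive := fun _ => X) x (fun t s ft fs => g ⟦t⟧ ft ⟦s⟧ fs) p)
    (fun p q (h : PlanarTree.Equiv p q) => by
      induction h with
      | refl => rfl
      | symm _ ih => exact ih.symm
      | trans _ _ ih ih' => exact ih.trans ih'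
      | congr h h' ih ih' =>
        have e := Quotient.sound (s := PlanarTree.setoid) h
        have e' := Quotient.sound (s := PlanarTree.setoid) h'
        simp only at ih ih' ⊢
        rw [ih, ih', e, e']
      | swap t t' s => exact hg ⟦t⟧ _ ⟦t'⟧ _ ⟦s⟧ _) t

section
variable {X : Sort*} (x : X) (g : RTree → X → RTree → X → X)
    (hg : ∀ t x t' x' s y,
      g t x (graft t' s) (g t' x' s y) = g t' x' (graft t s) (g t x s y))

@[simp] lemma recur_leaf : recur x g hg leaf = x := rfl

@[simp] lemma recur_graft (t s : RTree) :
    recur x g hg (graft t s) = g t (recur x g hg t) s (recur x g hg s) := by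
  induction t using Quotient.ind
  induction s using Quotient.ind
  rfl

end

/-- The multiset of the branches `t₁, …, tₖ` at the root. -/
def branches : RTree → Multiset RTree :=
  recur 0 (fun t _ _ m => t ::ₘ m) fun t _ t' _ _ m => Multiset.cons_swap t t' m

@[simp] lemma branches_leaf : branches leaf = 0 := rfl
@[simp] lemma branches_graft (t s : RTree) : branches (graft t s) = t ::ₘ branches s := by
  simp [branches]

lemma graft_ne_leaf (t s : RTree) : graft t s ≠ leaf := fun h => by
  have := congrArg branches h
  simp at this

open Classical in
/-- `I!` for a multi-index `I` over the set of trees, given as a multiset. -/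
def multisetFactorial (I : Multiset RTree) : ℕ := ∏ t ∈ I.toFinset, (I.count t).factorial

/-- The product of `σ` over the branches at the root, where `σ(τ) = I! ∏ⱼ σ(τⱼ)` for a tree `τ`
with multiset of branches `I = {τ₁, …, τₖ}`. -/
def symBranches : RTree → ℕ :=
  recur 1 (fun t n _ m => multisetFactorial (branches t) * n * m)
    fun _ _ _ _ _ _ => mul_left_comm _ _ _

/-- The symmetry factor `σ(τ) = I! ∏ⱼ σ(τⱼ)`. -/
def sym (t : RTree) : ℕ := multisetFactorial (branches t) * symBranches t

lemma sym_leaf : sym leaf = 1 := by simp [sym, symBranches, multisetFactorial]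

lemma sym_eq (t : RTree) :
    sym t = multisetFactorial (branches t) * ((branches t).map sym).prod := by
  rw [sym]; congr 1
  induction t using ind with
  | hl => simp [symBranches]
  | hg t s _ hs =>
    rw [branches_graft, Multiset.map_cons, Multiset.prod_cons, ← hs]
    simp [symBranches, sym]

/-- The number of branches at the root. -/
def arity (t : RTree) : ℕ := Multiset.card (branches t)

/-- The number of vertices of each fertility other than the root: `k` is mapped to the number of
non-root vertices with exactly `k` outgoing edges. -/
def fertilityNonRoot : RTree → (ℕ →₀ ℕ) :=
  recur 0 (fun t n _ m => Finsupp.single (arity t) 1 + n + m)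
    fun _ _ _ _ _ _ => add_left_comm _ _ _

/-- The multi-index `β` with `τ ∈ T_β`: `β(k)` is the number of vertices of `τ` with exactly `k`
outgoing edges. -/
def fertility (t : RTree) : ℕ →₀ ℕ := Finsupp.single (arity t) 1 + fertilityNonRoot t

lemma fertility_leaf : fertility leaf = Finsupp.single 0 1 := by
  simp [fertility, arity, fertilityNonRoot]

lemma fertility_eq (t : RTree) : fertility t =
    Finsupp.single (Multiset.card (branches t)) 1 + ((branches t).map fertility).sum := by
  rw [fertility]; congr 1
  induction t using ind with
  | hl => simp [fertilityNonRoot]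
  | hg t s _ hs =>
    rw [branches_graft, Multiset.map_cons, Multiset.sum_cons, ← hs]
    simp [fertilityNonRoot, fertility]

/-- The vector space `𝓑` spanned by rooted trees. -/
abbrev Span : Type := RTree →₀ ℝ

/-- The bilinear extension of `graft`. -/
def graftL : Span →ₗ[ℝ] Span →ₗ[ℝ] Span :=
  Finsupp.lift _ ℝ RTree fun t => Finsupp.lift _ ℝ RTree fun s => Finsupp.single (graft t s) 1

@[simp] lemma graftL_single (t s : RTree) : graftL (Finsupp.single t 1) (Finsupp.single s 1) =
    Finsupp.single (graft t s) 1 := by simp [graftL]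

lemma span_ext {M : Type*} [AddCommMonoid M] [Module ℝ M] {f g : Span →ₗ[ℝ] M}
    (h : ∀ t, f (Finsupp.single t 1) = g (Finsupp.single t 1)) : f = g :=
  Finsupp.lhom_ext' fun t => LinearMap.ext_ring (h t)

lemma graftL_swap (a b c : Span) : graftL a (graftL b c) = graftL b (graftL a c) := by
  have h : ∀ t t' : RTree, graftL (Finsupp.single t 1) ∘ₗ graftL (Finsupp.single t' 1) =
      graftL (Finsupp.single t' 1) ∘ₗ graftL (Finsupp.single t 1) := fun t t' =>
    span_ext fun s => by simp [graft_swap t t' s]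
  have h' : ∀ t : RTree, graftL (Finsupp.single t 1) ∘ₗ graftL b =
      graftL b ∘ₗ graftL (Finsupp.single t 1) := by
    intro t
    have : (LinearMap.llcomp ℝ Span Span Span (graftL (Finsupp.single t 1))) ∘ₗ graftL =
        (LinearMap.lcomp ℝ Span (graftL (Finsupp.single t 1))) ∘ₗ graftL :=
      span_ext fun t' => h t t'
    exact LinearMap.congr_fun this b
  have : graftL.flip (graftL b c) = graftL b ∘ₗ graftL.flip c :=
    span_ext fun t => LinearMap.congr_fun (h' t) c
  exact LinearMap.congr_fun this a

/-- The sum of `s' ⊗ s''` over all ways of distributing the branches at the root of `s` between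
two trees `s'` and `s''`. -/
def split : RTree → Span ⊗[ℝ] Span :=
  recur (Finsupp.single leaf 1 ⊗ₜ Finsupp.single leaf 1)
    (fun t _ _ z => (graftL (Finsupp.single t 1)).rTensor Span z +
      (graftL (Finsupp.single t 1)).lTensor Span z) fun t _ t' _ _ z => by
    have h : graftL (Finsupp.single t 1) ∘ₗ graftL (Finsupp.single t' 1) =
      graftL (Finsupp.single t' 1) ∘ₗ graftL (Finsupp.single t 1) :=
      LinearMap.ext fun c => graftL_swap _ _ c
    simp only [map_add, ← LinearMap.comp_apply, ← LinearMap.rTensor_comp, ← LinearMap.lTensor_comp,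
      LinearMap.rTensor_comp_lTensor, LinearMap.lTensor_comp_rTensor, h]
    abel

/-- For maps `φ, ψ`, the map sending `s` to the sum of `graft (φ s') (ψ s'')` over all ways of
distributing the branches at the root of `s` between `s'` and `s''`. -/
def conv (φ ψ : Span →ₗ[ℝ] Span) : Span →ₗ[ℝ] Span :=
  TensorProduct.lift graftL ∘ₗ TensorProduct.map φ ψ ∘ₗ Finsupp.lift _ ℝ RTree split

lemma conv_leaf (φ ψ : Span →ₗ[ℝ] Span) : conv φ ψ (Finsupp.single leaf 1) =
    graftL (φ (Finsupp.single leaf 1)) (ψ (Finsupp.single leaf 1)) := by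
  simp [conv, split]

lemma conv_comp_graftL (φ ψ : Span →ₗ[ℝ] Span) (a : Span) :
    conv φ ψ ∘ₗ graftL a = conv (φ ∘ₗ graftL a) ψ + conv φ (ψ ∘ₗ graftL a) := by
  induction a using Finsupp.induction_linear with
  | zero => simp [conv, LinearMap.comp_zero]
  | add a b ha hb =>
    rw [map_add, LinearMap.comp_add, ha, hb]
    simp only [conv, LinearMap.comp_add, TensorProduct.map_add_left, TensorProduct.map_add_right,
      LinearMap.add_comp]
    abel
  | single t r =>
    have hr : (Finsupp.single t r : Span) = r • Finsupp.single t 1 := by simp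
    have h1 : conv φ ψ ∘ₗ graftL (Finsupp.single t 1) =
        conv (φ ∘ₗ graftL (Finsupp.single t 1)) ψ + conv φ (ψ ∘ₗ graftL (Finsupp.single t 1)) := by
      refine span_ext fun s => ?_
      have e1 : ∀ z, TensorProduct.map φ ψ ((graftL (Finsupp.single t 1)).rTensor Span z) =
          TensorProduct.map (φ ∘ₗ graftL (Finsupp.single t 1)) ψ z := fun z => by
        rw [← LinearMap.comp_apply, LinearMap.map_comp_rTensor]
      have e2 : ∀ z, TensorProduct.map φ ψ ((graftL (Finsupp.single t 1)).lTensor Span z) =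
          TensorProduct.map φ (ψ ∘ₗ graftL (Finsupp.single t 1)) z := fun z => by
        rw [← LinearMap.comp_apply, LinearMap.map_comp_lTensor]
      simp [conv, split, e1, e2]
    rw [hr, map_smul, LinearMap.comp_smul, LinearMap.comp_smul, LinearMap.comp_smul, h1]
    simp only [conv, TensorProduct.map_smul_left, TensorProduct.map_smul_right,
      LinearMap.smul_comp, LinearMap.comp_smul, smul_add]

lemma conv_graftL (φ ψ : Span →ₗ[ℝ] Span) (a b : Span) :
    conv φ ψ (graftL a b) = conv (φ ∘ₗ graftL a) ψ b + conv φ (ψ ∘ₗ graftL a) b :=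
  LinearMap.congr_fun (conv_comp_graftL φ ψ a) b

lemma conv_add_left (φ φ' ψ : Span →ₗ[ℝ] Span) :
    conv (φ + φ') ψ = conv φ ψ + conv φ' ψ := by
  simp only [conv, TensorProduct.map_add_left, LinearMap.comp_add, LinearMap.add_comp]

lemma conv_add_right (φ ψ ψ' : Span →ₗ[ℝ] Span) :
    conv φ (ψ + ψ') = conv φ ψ + conv φ ψ' := by
  simp only [conv, TensorProduct.map_add_right, LinearMap.comp_add, LinearMap.add_comp]

lemma conv_left_comm (φ ψ χ : Span →ₗ[ℝ] Span) : conv φ (conv ψ χ) = conv ψ (conv φ χ) := by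
  refine span_ext fun s => ?_
  induction s using ind generalizing φ ψ χ with
  | hl => simp only [conv_leaf]; exact graftL_swap _ _ _
  | hg t s _ hs =>
    rw [← graftL_single, conv_graftL, conv_graftL, conv_comp_graftL, conv_comp_graftL,
      conv_add_right, conv_add_right, LinearMap.add_apply, LinearMap.add_apply, hs, hs φ, hs φ]
    abel

/-- `simGraft a s`: the sum over all ways of grafting the branches at the root of `s`
simultaneously on vertices of `a` (one vertex of `a` for each branch). -/
def simGraft : RTree → (Span →ₗ[ℝ] Span) :=
  recur LinearMap.id (fun _ φ _ ψ => conv φ ψ) fun _ _ _ _ _ _ => conv_left_comm _ _ _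

@[simp] lemma simGraft_leaf : simGraft leaf = LinearMap.id := by simp [simGraft]

@[simp] lemma simGraft_graft (t s : RTree) :
    simGraft (graft t s) = conv (simGraft t) (simGraft s) := by simp [simGraft]

/-- `nonRoot Φ t`: the sum, over all vertices `v` of `t` other than the root, of the result of
replacing the branch `t^v` of `t` that sits at `v` by `Φ (t^v)`. -/
def nonRoot (Φ : Span →ₗ[ℝ] Span) : Span →ₗ[ℝ] Span :=
  Finsupp.lift _ ℝ RTree <|
    recur 0 (fun t y s z => graftL (Φ (Finsupp.single t 1) + y) (Finsupp.single s 1) +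
      graftL (Finsupp.single t 1) z) fun t x t' x' s y => by
      rw [← graftL_single, ← graftL_single, map_add (graftL (Finsupp.single t 1)),
        map_add (graftL (Finsupp.single t' 1)), graftL_swap (Finsupp.single t 1) _ y,
        graftL_swap (Finsupp.single t 1) _ (Finsupp.single s 1),
        graftL_swap (Finsupp.single t' 1) _ (Finsupp.single s 1)]
      abel

/-- The sum over all vertices `v` of `t` (including the root) of the result of replacing the
branch `t^v` of `t` that sits at `v` by `Φ (t^v)`. -/
def atVertices (Φ : Span →ₗ[ℝ] Span) : Span →ₗ[ℝ] Span := Φ + nonRoot Φ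

@[simp] lemma nonRoot_leaf (Φ : Span →ₗ[ℝ] Span) : nonRoot Φ (Finsupp.single leaf 1) = 0 := by
  simp [nonRoot]

lemma nonRoot_comp_graftL (Φ : Span →ₗ[ℝ] Span) (a : Span) :
    nonRoot Φ ∘ₗ graftL a = graftL (atVertices Φ a) + graftL a ∘ₗ nonRoot Φ := by
  have h : ∀ t : RTree, nonRoot Φ ∘ₗ graftL (Finsupp.single t 1) =
      graftL (atVertices Φ (Finsupp.single t 1)) +
      graftL (Finsupp.single t 1) ∘ₗ nonRoot Φ := fun t => span_ext fun s => by
    simp [nonRoot, atVertices]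
  have : LinearMap.llcomp ℝ Span Span Span (nonRoot Φ) ∘ₗ graftL =
      graftL ∘ₗ atVertices Φ + LinearMap.lcomp ℝ Span (nonRoot Φ) ∘ₗ graftL := span_ext h
  exact LinearMap.congr_fun this a

lemma nonRoot_graftL (Φ : Span →ₗ[ℝ] Span) (a b : Span) :
    nonRoot Φ (graftL a b) = graftL (atVertices Φ a) b + graftL a (nonRoot Φ b) :=
  LinearMap.congr_fun (nonRoot_comp_graftL Φ a) b

lemma commutator_aux (Φ Ψ Θ : Span →ₗ[ℝ] Span)
    (h : ∀ y, Φ (Ψ y) + Φ (nonRoot Ψ y) + nonRoot Φ (Ψ y) -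
      (Ψ (Φ y) + Ψ (nonRoot Φ y) + nonRoot Ψ (Φ y)) = Θ y) (y : Span) :
    atVertices Φ (atVertices Ψ y) - atVertices Ψ (atVertices Φ y) = atVertices Θ y := by
  have h1 : ∀ y, nonRoot Φ (nonRoot Ψ y) - nonRoot Ψ (nonRoot Φ y) = nonRoot Θ y →
      atVertices Φ (atVertices Ψ y) - atVertices Ψ (atVertices Φ y) = atVertices Θ y := by
    intro y hy
    simp only [atVertices, LinearMap.add_apply, map_add, ← h y, ← hy]
    abel
  refine h1 y ?_
  have : nonRoot Φ ∘ₗ nonRoot Ψ - nonRoot Ψ ∘ₗ nonRoot Φ = nonRoot Θ := by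
    refine span_ext fun t => ?_
    induction t using ind with
    | hl => simp
    | hg t s ht hs =>
      simp only [LinearMap.sub_apply, LinearMap.comp_apply] at ht hs ⊢
      rw [← graftL_single]
      simp only [nonRoot_graftL, map_add, ← hs, ← h1 _ ht, map_sub, LinearMap.sub_apply]
      abel
  exact LinearMap.congr_fun this y

/-- The (bilinear) product `a ▷ b`, the sum over all ways of inserting `a` at a vertex `v` of `b`:
the vertex `v` is replaced by `a`, and the branches that were attached to `v` are grafted
on vertices of `a` in all possible ways. -/
def insert : Span →ₗ[ℝ] Span →ₗ[ℝ] Span :=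
  Finsupp.lift _ ℝ RTree fun a => atVertices (simGraft a)

lemma insert_single (a : RTree) : insert (Finsupp.single a 1) = atVertices (simGraft a) := by
  simp [insert]

lemma nonRoot_add (Φ Ψ : Span →ₗ[ℝ] Span) : nonRoot (Φ + Ψ) = nonRoot Φ + nonRoot Ψ := by
  refine span_ext fun t => ?_
  induction t using ind with
  | hl => simp
  | hg t s ht hs =>
    simp only [LinearMap.add_apply] at ht hs ⊢
    rw [← graftL_single]
    simp only [nonRoot_graftL, atVertices, LinearMap.add_apply, ht, hs, map_add]
    abel

lemma nonRoot_smul (r : ℝ) (Φ : Span →ₗ[ℝ] Span) : nonRoot (r • Φ) = r • nonRoot Φ := by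
  refine span_ext fun t => ?_
  induction t using ind with
  | hl => simp
  | hg t s ht hs =>
    simp only [LinearMap.smul_apply] at ht hs ⊢
    rw [← graftL_single]
    simp only [nonRoot_graftL, atVertices, LinearMap.add_apply, LinearMap.smul_apply, ht, hs,
      map_add, map_smul, smul_add]

/-- The linear extension of `simGraft`. -/
def simGraftL : Span →ₗ[ℝ] Span →ₗ[ℝ] Span := Finsupp.lift _ ℝ RTree simGraft

@[simp] lemma simGraftL_single (a : RTree) : simGraftL (Finsupp.single a 1) = simGraft a := by
  simp [simGraftL]

lemma insert_eq (a : Span) : insert a = atVertices (simGraftL a) := by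
  induction a using Finsupp.induction_linear with
  | zero =>
    have := nonRoot_smul 0 0
    rw [zero_smul, zero_smul] at this
    simp [atVertices, this]
  | add a b ha hb =>
    rw [map_add, map_add, ha, hb, atVertices, atVertices, atVertices, nonRoot_add]
    abel
  | single t r =>
    have hr : (Finsupp.single t r : Span) = r • Finsupp.single t 1 := by simp
    rw [hr, map_smul, map_smul, insert_single, simGraftL_single, atVertices, atVertices,
      nonRoot_smul, smul_add]

lemma conv_nonRoot (φ ψ Φ : Span →ₗ[ℝ] Span) :
    conv φ ψ ∘ₗ nonRoot Φ = conv (φ ∘ₗ nonRoot Φ) ψ + conv φ (ψ ∘ₗ nonRoot Φ) := by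
  refine span_ext fun s => ?_
  induction s using ind generalizing φ ψ with
  | hl => simp [conv_leaf]
  | hg t s _ hs =>
    simp only [LinearMap.comp_apply, LinearMap.add_apply] at hs ⊢
    rw [← graftL_single, nonRoot_graftL]
    simp only [map_add, conv_graftL, hs, LinearMap.comp_assoc, nonRoot_comp_graftL,
      LinearMap.comp_add, conv_add_left, conv_add_right, LinearMap.add_apply]
    abel

lemma atVertices_graftL_comp_graftL (x a b : Span) :
    atVertices (graftL x) (graftL a b) =
      graftL (atVertices (graftL x) a) b + graftL a (atVertices (graftL x) b) := by
  simp only [atVertices, LinearMap.add_apply, nonRoot_graftL, map_add, graftL_swap x a b]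
  abel

lemma atVertices_comp_conv (x : Span) (φ ψ : Span →ₗ[ℝ] Span) :
    atVertices (graftL x) ∘ₗ conv φ ψ =
      conv (atVertices (graftL x) ∘ₗ φ) ψ + conv φ (atVertices (graftL x) ∘ₗ ψ) := by
  refine span_ext fun s => ?_
  induction s using ind generalizing φ ψ with
  | hl => simp [conv_leaf, atVertices_graftL_comp_graftL]
  | hg t s _ hs =>
    simp only [LinearMap.comp_apply, LinearMap.add_apply] at hs ⊢
    rw [← graftL_single]
    simp only [map_add, conv_graftL, hs, LinearMap.comp_assoc]
    abel

/-- Simultaneous grafting commutes with grafting. -/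
lemma simGraft_comm (x : Span) (a : RTree) :
    atVertices (graftL x) ∘ₗ simGraft a = simGraft a ∘ₗ atVertices (graftL x) := by
  induction a using ind with
  | hl => simp
  | hg a b ha hb =>
    rw [simGraft_graft, atVertices_comp_conv, ha, hb, atVertices, LinearMap.comp_add,
      LinearMap.comp_add, LinearMap.comp_add, conv_add_left, conv_add_right, conv_nonRoot,
      conv_comp_graftL]
    abel

lemma simGraftL_comm (x a y : Span) :
    atVertices (graftL x) (simGraftL a y) = simGraftL a (atVertices (graftL x) y) := by
  have : simGraftL.compr₂ (atVertices (graftL x)) =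
      simGraftL.compl₂ (atVertices (graftL x)) := span_ext fun a => by
    have := simGraft_comm x a
    refine LinearMap.ext fun y => ?_
    simpa using LinearMap.congr_fun this y
  exact LinearMap.congr_fun (LinearMap.congr_fun this a) y

lemma nonRoot_comm_of (Φ Ψ Θ : Span →ₗ[ℝ] Span)
    (h : ∀ y, Φ (Ψ y) + Φ (nonRoot Ψ y) + nonRoot Φ (Ψ y) -
      (Ψ (Φ y) + Ψ (nonRoot Φ y) + nonRoot Ψ (Φ y)) = Θ y) (y : Span) :
    nonRoot Φ (nonRoot Ψ y) - nonRoot Ψ (nonRoot Φ y) = nonRoot Θ y := by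
  have h1 := commutator_aux Φ Ψ Θ h y
  simp only [atVertices, LinearMap.add_apply, map_add, ← h y] at h1
  have h' := sub_eq_zero.2 h1
  rw [← sub_eq_zero, ← h']
  abel

lemma insert_comm_graft_aux (a x y : Span) :
    simGraftL a (graftL x y) + simGraftL a (nonRoot (graftL x) y) +
        nonRoot (simGraftL a) (graftL x y) -
      (graftL x (simGraftL a y) + graftL x (nonRoot (simGraftL a) y) +
        nonRoot (graftL x) (simGraftL a y)) = graftL (atVertices (simGraftL a) x) y := by
  have h := simGraftL_comm x a y
  rw [nonRoot_graftL]
  simp only [atVertices, LinearMap.add_apply, map_add] at h ⊢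
  have h' := sub_eq_zero.2 h.symm
  rw [← sub_eq_zero, ← h']
  abel

lemma nonRoot_comm_graft (a x y : Span) :
    nonRoot (simGraftL a) (nonRoot (graftL x) y) - nonRoot (graftL x) (nonRoot (simGraftL a) y) =
      nonRoot (graftL (atVertices (simGraftL a) x)) y :=
  nonRoot_comm_of _ _ _ (insert_comm_graft_aux a x) y

/-- Insertion is a derivation of grafting. -/
lemma insert_comm_graft (a x y : Span) :
    atVertices (simGraftL a) (atVertices (graftL x) y) -
      atVertices (graftL x) (atVertices (simGraftL a) y) =
      atVertices (graftL (atVertices (simGraftL a) x)) y :=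
  commutator_aux _ _ _ (insert_comm_graft_aux a x) y

lemma simGraftL_leaf (a : Span) : simGraftL a (Finsupp.single leaf 1) = a := by
  have : simGraftL.flip (Finsupp.single leaf 1) = LinearMap.id := by
    refine span_ext fun a => ?_
    induction a using ind with
    | hl => simp
    | hg a b ha hb =>
      simp only [LinearMap.flip_apply, simGraftL_single, LinearMap.id_apply] at ha hb ⊢
      rw [simGraft_graft, conv_leaf, ha, hb, graftL_single]
  exact LinearMap.congr_fun this a

/-- The span of the trees whose root has `k` branches. -/
def aritySpan (k : ℕ) : Submodule ℝ Span := Finsupp.supported ℝ ℝ {t | arity t = k}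

lemma single_mem_aritySpan (t : RTree) : Finsupp.single t 1 ∈ aritySpan (arity t) :=
  Finsupp.single_mem_supported ℝ 1 rfl

lemma aritySpan_induction {k : ℕ} {M : Type*} [AddCommGroup M] [Module ℝ M]
    {f g : Span →ₗ[ℝ] M} (h : ∀ t, arity t = k → f (Finsupp.single t 1) = g (Finsupp.single t 1))
    {y : Span} (hy : y ∈ aritySpan k) : f y = g y := by
  rw [aritySpan, Finsupp.supported_eq_span_single] at hy
  refine LinearMap.eqOn_span ?_ hy
  rintro _ ⟨t, ht, rfl⟩
  exact h t ht

lemma graftL_mem_aritySpan (a : Span) {k : ℕ} {y : Span} (hy : y ∈ aritySpan k) :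
    graftL a y ∈ aritySpan (k + 1) := by
  rw [aritySpan, Finsupp.supported_eq_span_single] at hy
  induction hy using Submodule.span_induction with
  | mem y hy =>
    obtain ⟨t, ht, rfl⟩ := hy
    induction a using Finsupp.induction_linear with
    | zero => simp
    | add a b ha hb => rw [map_add]; exact Submodule.add_mem _ ha hb
    | single s r =>
      have hr : (Finsupp.single s r : Span) = r • Finsupp.single s 1 := by simp
      rw [hr, map_smul, LinearMap.smul_apply]
      refine Submodule.smul_mem _ _ ?_
      rw [graftL_single, ← show arity t = k from ht]
      have : arity t + 1 = arity (graft s t) := by simp [arity]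
      rw [this]
      exact single_mem_aritySpan _
  | zero => simp
  | add y z _ _ h h' => rw [map_add]; exact Submodule.add_mem _ h h'
  | smul r y _ h => rw [map_smul]; exact Submodule.smul_mem _ r h

lemma nonRoot_mem_aritySpan (Φ : Span →ₗ[ℝ] Span) (t : RTree) :
    nonRoot Φ (Finsupp.single t 1) ∈ aritySpan (arity t) := by
  induction t using ind with
  | hl => simp
  | hg t s _ hs =>
    have : arity (graft t s) = arity s + 1 := by simp [arity]
    rw [← graftL_single, nonRoot_graftL, this]
    exact Submodule.add_mem _ (graftL_mem_aritySpan _ (single_mem_aritySpan s))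
      (graftL_mem_aritySpan _ hs)

lemma exists_eq_graft (t : RTree) : t = leaf ∨ ∃ s r, t = graft s r := by
  induction t using ind with
  | hl => exact Or.inl rfl
  | hg t s _ _ => exact Or.inr ⟨t, s, rfl⟩

lemma insert_simGraft (a b : Span) (k : ℕ) {y : Span} (hy : y ∈ aritySpan k) :
    atVertices (simGraftL a) (simGraftL b y) =
      simGraftL (atVertices (simGraftL a) b) y + simGraftL b (nonRoot (simGraftL a) y) := by
  induction k generalizing y with
  | zero =>
    refine aritySpan_induction (k := 0) (f := atVertices (simGraftL a) ∘ₗ simGraftL b)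
      (g := simGraftL (atVertices (simGraftL a) b) + simGraftL b ∘ₗ nonRoot (simGraftL a))
      (fun t ht => ?_) hy
    obtain rfl | ⟨s, r, rfl⟩ := exists_eq_graft t
    · simp [simGraftL_leaf]
    · simp [arity] at ht
  | succ k ih =>
    refine aritySpan_induction (k := k + 1) (f := atVertices (simGraftL a) ∘ₗ simGraftL b)
      (g := simGraftL (atVertices (simGraftL a) b) + simGraftL b ∘ₗ nonRoot (simGraftL a))
      (fun t ht => ?_) hy
    obtain rfl | ⟨x, s, rfl⟩ := exists_eq_graft t
    · simp [arity] at ht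
    have hs : arity s = k := by simpa [arity] using ht
    simp only [LinearMap.comp_apply, LinearMap.add_apply]
    set X : Span := Finsupp.single x 1
    set S : Span := Finsupp.single s 1
    have i1 := ih (y := S) (hs ▸ single_mem_aritySpan s)
    have i2 := ih (y := nonRoot (graftL X) S) (hs ▸ nonRoot_mem_aritySpan _ s)
    rw [← graftL_single]
    change atVertices (simGraftL a) (simGraftL b (graftL X S)) =
      simGraftL (atVertices (simGraftL a) b) (graftL X S) +
        simGraftL b (nonRoot (simGraftL a) (graftL X S))
    have k0 : ∀ Z c y : Span, simGraftL c (graftL Z y) =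
        atVertices (graftL Z) (simGraftL c y) - simGraftL c (nonRoot (graftL Z) y) := by
      intro Z c y
      rw [simGraftL_comm]
      simp only [atVertices, LinearMap.add_apply, map_add, add_sub_cancel_right]
    have k1 := k0 X
    have k2 := k0 (atVertices (simGraftL a) X) b S
    have d1 := insert_comm_graft a X (simGraftL b S)
    have d2 := nonRoot_comm_graft a X S
    rw [nonRoot_graftL, map_add, k2, k1, k1, k1, map_sub, i2, ← d1, ← d2, map_sub,
      sub_eq_iff_eq_add.1 d1]
    simp only [i1, map_add]
    have d1' := sub_eq_iff_eq_add.1 d1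
    rw [i1, map_add] at d1'
    abel

lemma insert_simGraftL (a b y : Span) :
    atVertices (simGraftL a) (simGraftL b y) =
      simGraftL (atVertices (simGraftL a) b) y + simGraftL b (nonRoot (simGraftL a) y) := by
  have : atVertices (simGraftL a) ∘ₗ simGraftL b =
      simGraftL (atVertices (simGraftL a) b) + simGraftL b ∘ₗ nonRoot (simGraftL a) :=
    span_ext fun t => insert_simGraft a b _ (single_mem_aritySpan t)
  exact LinearMap.congr_fun this y

/-- The pre-Lie identity for insertion. -/
lemma insert_preLie (a b c : Span) :
    insert (insert a b) c - insert a (insert b c) =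
      insert (insert b a) c - insert b (insert a c) := by
  have h := commutator_aux (simGraftL a) (simGraftL b) (simGraftL (insert a b - insert b a))
    (fun y => by
      have h1 := insert_simGraftL a b y
      have h2 := insert_simGraftL b a y
      rw [insert_eq, insert_eq, map_sub, LinearMap.sub_apply]
      rw [← sub_eq_iff_eq_add] at h1 h2
      rw [← h1, ← h2]
      simp only [atVertices, LinearMap.add_apply]
      abel) c
  rw [← insert_eq, ← insert_eq, ← insert_eq, map_sub, LinearMap.sub_apply] at h
  have h' := sub_eq_zero.2 h.symm
  rw [← sub_eq_zero, ← h']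
  abel

/-- Rooted trees with at least one edge. -/
abbrev TreeTwo : Type := {t : RTree | t ≠ leaf}

/-- `𝓑_{≥2}`: the span of the rooted trees with at least one edge. -/
def BTwo : Submodule ℝ Span := Finsupp.supported ℝ ℝ {t | t ≠ leaf}

/-- The basis of `𝓑_{≥2}` consisting of trees. -/
def treeBasis : Module.Basis TreeTwo ℝ BTwo :=
  Module.Basis.ofRepr (Finsupp.supportedEquivFinsupp {t | t ≠ leaf})

lemma treeBasis_apply (t : TreeTwo) : (treeBasis t : Span) = Finsupp.single t.1 1 := by
  have h : treeBasis t = (Finsupp.supportedEquivFinsupp (M := ℝ) (R := ℝ)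
      {t : RTree | t ≠ leaf}).symm (Finsupp.single t 1) := rfl
  rw [h, Finsupp.supportedEquivFinsupp_symm_single]

lemma mem_BTwo (a : Span) : a ∈ BTwo ↔ a leaf = 0 := by
  rw [BTwo, Finsupp.mem_supported']
  simp

lemma graftL_apply_leaf (a b : Span) : graftL a b leaf = 0 := by
  induction a using Finsupp.induction_linear with
  | zero => simp
  | add a a' h h' => simp [h, h']
  | single t r =>
    induction b using Finsupp.induction_linear with
    | zero => simp
    | add b b' h h' => simp [h, h']
    | single s q => simp [graftL, graft_ne_leaf]

lemma nonRoot_apply_leaf (Φ : Span →ₗ[ℝ] Span) (a : Span) : nonRoot Φ a leaf = 0 := by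
  have : Finsupp.lapply leaf ∘ₗ nonRoot Φ = 0 := span_ext fun t => by
    obtain rfl | ⟨x, s, rfl⟩ := exists_eq_graft t
    · simp
    · rw [← graftL_single, LinearMap.comp_apply, nonRoot_graftL]
      simp [graftL_apply_leaf]
  exact LinearMap.congr_fun this a

lemma conv_apply_leaf (φ ψ : Span →ₗ[ℝ] Span) (a : Span) : conv φ ψ a leaf = 0 := by
  rw [conv, LinearMap.comp_apply, LinearMap.comp_apply]
  generalize TensorProduct.map φ ψ _ = z
  induction z using TensorProduct.induction_on with
  | zero => simp
  | tmul a b => simp [graftL_apply_leaf]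
  | add z w hz hw => simp [hz, hw]

lemma insert_mem {a b : Span} (ha : a ∈ BTwo) : insert a b ∈ BTwo := by
  rw [BTwo, Finsupp.supported_eq_span_single] at ha
  induction ha using Submodule.span_induction with
  | mem y hy =>
    obtain ⟨t, ht, rfl⟩ := hy
    rw [mem_BTwo, insert_single, atVertices]
    obtain rfl | ⟨x, s, rfl⟩ := exists_eq_graft t
    · exact absurd rfl ht
    · simp [conv_apply_leaf, nonRoot_apply_leaf]
  | zero => simp
  | add y z _ _ h h' => rw [map_add]; exact Submodule.add_mem _ h h'
  | smul r y _ h => rw [map_smul]; exact Submodule.smul_mem _ r h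

/-- The insertion pre-Lie product of `𝓑_{≥2}`, written `a * b`. -/
instance : LeftPreLieRing BTwo where
  mul a b := ⟨insert a.1 b.1, insert_mem a.2⟩
  left_distrib a b c := Subtype.ext (map_add _ _ _)
  right_distrib a b c := Subtype.ext (by
    change insert (a.1 + b.1) c.1 = _
    rw [map_add]; rfl)
  zero_mul a := Subtype.ext (by
    change insert 0 a.1 = _
    rw [map_zero]; rfl)
  mul_zero a := Subtype.ext (map_zero _)
  assoc_symm' a b c := Subtype.ext (insert_preLie a.1 b.1 c.1)

instance : LeftPreLieAlgebra ℝ BTwo where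
  smul_assoc r a b := Subtype.ext (by
    change insert (r • a.1) b.1 = r • insert a.1 b.1
    rw [map_smul]; rfl)
  smul_comm r a b := Subtype.ext (((insert a.1).map_smul r b.1).symm)

/-- `merge t s`: the tree obtained by identifying the roots of `t` and `s`. -/
def merge (t s : RTree) : RTree :=
  recur s (fun x _ _ r => graft x r) (fun x _ x' _ _ r => graft_swap x x' r) t

@[simp] lemma merge_leaf (s : RTree) : merge leaf s = s := rfl
@[simp] lemma merge_graft (x t s : RTree) : merge (graft x t) s = graft x (merge t s) := by
  simp [merge]

lemma merge_graft_right (t x s : RTree) : merge t (graft x s) = graft x (merge t s) := by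
  induction t using ind with
  | hl => simp
  | hg y t _ h => simp [h, graft_swap x y]

lemma merge_left_comm (t s r : RTree) : merge t (merge s r) = merge s (merge t r) := by
  induction t using ind with
  | hl => simp
  | hg y t _ h => simp [h, merge_graft_right]

/-- A spanning subforest `s` of a tree `t` (i.e. a partition of the set of vertices into subtrees,
or equivalently a subset of the set of edges), recorded by the component of `s` that contains the
root of `t`, the multiset of the other components, and the tree `t / s` obtained from `t` by
contracting each component to a vertex. -/
structure SubForest where
  root : RTree
  others : Multiset RTree
  quotient : RTree

/-- The subforest of `graft t s` given by subforests of `t` and `s` when the new edge is kept. -/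
def SubForest.keep (f g : SubForest) : SubForest :=
  ⟨graft f.root g.root, f.others + g.others, merge f.quotient g.quotient⟩

/-- The subforest of `graft t s` given by subforests of `t` and `s` when the new edge is cut. -/
def SubForest.cut (f g : SubForest) : SubForest :=
  ⟨g.root, f.root ::ₘ (f.others + g.others), graft f.quotient g.quotient⟩

/-- All spanning subforests of a tree, with multiplicity. -/
def subForests : RTree → Multiset SubForest :=
  recur {⟨leaf, 0, leaf⟩}
    (fun _ F _ G => F.bind fun f => G.bind fun g => {f.keep g, f.cut g})
    fun _ F _ F' _ G => by
      simp only [Multiset.bind_assoc]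
      rw [Multiset.bind_bind]
      refine Multiset.bind_congr fun f' _ => Multiset.bind_congr fun f _ =>
        Multiset.bind_congr fun g _ => ?_
      simp only [Multiset.insert_eq_cons, Multiset.cons_bind, Multiset.singleton_bind,
        SubForest.keep, SubForest.cut, Multiset.cons_add, Multiset.add_cons,
        graft_swap f.root f'.root, merge_left_comm f.quotient f'.quotient,
        graft_swap f.quotient f'.quotient, merge_graft_right, add_left_comm f.others f'.others,
        Multiset.cons_swap f.root f'.root, Multiset.singleton_add]
      simp only [← Multiset.singleton_add]
      abel

open Classical in
/-- The variable of a tree in `ℝ[𝓗_{≥2}]`, where the one-vertex tree is identified with `1`. -/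
def var (t : RTree) : MvPolynomial TreeTwo ℝ :=
  if h : t ≠ leaf then MvPolynomial.X ⟨t, h⟩ else 1

/-- The extraction-contraction coproduct `Δ t = ∑_s s ⊗ t / s` of the rooted tree Hopf algebra,
where the sum is over the spanning subforests `s` of `t`. -/
def coprodEC : MvPolynomial TreeTwo ℝ →ₐ[ℝ] MvPolynomial TreeTwo ℝ ⊗[ℝ] MvPolynomial TreeTwo ℝ :=
  MvPolynomial.aeval fun t => ((subForests t.1).map fun f =>
    (var f.root * (f.others.map var).prod) ⊗ₜ[ℝ] var f.quotient).sum

end RTree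

open GuinOudom MultiIndex

lemma MultiIndex.bracket_add (β γ : ℕ →₀ ℕ) : bracket (β + γ) = bracket β + bracket γ :=
  Finsupp.sum_add_index' (by simp) (by intros; push_cast; ring)

lemma MultiIndex.length_add (β γ : ℕ →₀ ℕ) : length (β + γ) = length β + length γ :=
  Finsupp.sum_add_index' (by simp) (by simp)

lemma MultiIndex.bracket_single (k : ℕ) : bracket (Finsupp.single k 1) = 1 - k := by
  simp [bracket]

lemma MultiIndex.length_single (k : ℕ) : length (Finsupp.single k 1) = 1 := by
  simp [length]

namespace RTree

lemma bracket_fertilityNonRoot (t : RTree) : bracket (fertilityNonRoot t) = arity t := by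
  induction t using ind with
  | hl => simp [fertilityNonRoot, bracket, arity]
  | hg t s ht hs =>
    have : fertilityNonRoot (graft t s) =
        Finsupp.single (arity t) 1 + fertilityNonRoot t + fertilityNonRoot s := by
      simp [fertilityNonRoot]
    rw [this, bracket_add, bracket_add, bracket_single, ht, hs]
    simp [arity]
    ring

lemma fertility_mem (t : TreeTwo) : fertility t.1 ∈ populatedTwo := by
  refine ⟨?_, ?_⟩
  · rw [fertility, bracket_add, bracket_single, bracket_fertilityNonRoot]; ring
  · obtain h | ⟨x, s, h⟩ := exists_eq_graft t.1
    · exact absurd h t.2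
    · have : fertilityNonRoot (graft x s) =
          Finsupp.single (arity x) 1 + fertilityNonRoot x + fertilityNonRoot s := by
        simp [fertilityNonRoot]
      rw [h, fertility, this, length_add, length_add, length_add, length_single, length_single]
      omega

/-- The map `Ψ : 𝓑_{≥2} → T_{≥2}`, `Ψ[τ] = σ(β) z^β` for the `β` with `τ ∈ T_β`, where
`σ(β) = ∏_k (k!)^{β(k)}`. -/
def psi : BTwo →ₗ[ℝ] TTwo :=
  treeBasis.constr ℝ fun t =>
    ((fertility t.1).prod fun k n => (k.factorial : ℝ) ^ n) • zBasis ⟨fertility t.1, fertility_mem t⟩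

end RTree

/-- The axioms saying that a comultiplication `Δ`, a counit `ε` and an antipode `S` make a
commutative algebra `A` a Hopf algebra. -/
structure IsHopf {A : Type*} [CommRing A] [Algebra ℝ A] (Δ : A →ₗ[ℝ] A ⊗[ℝ] A)
    (ε : A →ₗ[ℝ] ℝ) (S : A →ₗ[ℝ] A) : Prop where
  coassoc : TensorProduct.assoc ℝ A A A ∘ₗ Δ.rTensor A ∘ₗ Δ = Δ.lTensor A ∘ₗ Δ
  rTensor_counit : ε.rTensor A ∘ₗ Δ = TensorProduct.mk ℝ _ _ 1
  lTensor_counit : ε.lTensor A ∘ₗ Δ = (TensorProduct.mk ℝ _ _).flip 1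
  counit_one : ε 1 = 1
  counit_mul : ∀ a b, ε (a * b) = ε a * ε b
  comul_one : Δ 1 = 1
  comul_mul : ∀ a b, Δ (a * b) = Δ a * Δ b
  antipode_left : LinearMap.mul' ℝ A ∘ₗ S.rTensor A ∘ₗ Δ = Algebra.linearMap ℝ A ∘ₗ ε
  antipode_right : LinearMap.mul' ℝ A ∘ₗ S.lTensor A ∘ₗ Δ = Algebra.linearMap ℝ A ∘ₗ ε

/-- The Hopf algebra given by `Δ`, `ε` and `S`. -/
@[reducible] def IsHopf.hopfAlgebra {A : Type*} [CommRing A] [Algebra ℝ A]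
    {Δ : A →ₗ[ℝ] A ⊗[ℝ] A} {ε : A →ₗ[ℝ] ℝ} {S : A →ₗ[ℝ] A} (h : IsHopf Δ ε S) :
    HopfAlgebra ℝ A where
  comul := Δ
  counit := ε
  coassoc := h.coassoc
  rTensor_counit_comp_comul := h.rTensor_counit
  lTensor_counit_comp_comul := h.lTensor_counit
  counit_one := h.counit_one
  mul_compr₂_counit := by ext; exact h.counit_mul _ _
  comul_one := h.comul_one
  mul_compr₂_comul := by ext; exact h.comul_mul _ _
  antipode := S
  mul_antipode_rTensor_comul := h.antipode_left
  mul_antipode_lTensor_comul := h.antipode_right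

/-- An algebra morphism `F` is a morphism of Hopf algebras from `(A, Δ, ε, S)` to
`(A', Δ', ε', S')`. -/
structure IsHopfHom {A A' : Type*} [CommRing A] [Algebra ℝ A] [CommRing A'] [Algebra ℝ A']
    (Δ : A →ₗ[ℝ] A ⊗[ℝ] A) (ε : A →ₗ[ℝ] ℝ) (S : A →ₗ[ℝ] A)
    (Δ' : A' →ₗ[ℝ] A' ⊗[ℝ] A') (ε' : A' →ₗ[ℝ] ℝ) (S' : A' →ₗ[ℝ] A')
    (F : A →ₐ[ℝ] A') : Prop where
  map_comul : ∀ p, Δ' (F p) = TensorProduct.map F.toLinearMap F.toLinearMap (Δ p)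
  map_counit : ∀ p, ε' (F p) = ε p
  map_antipode : ∀ p, S' (F p) = F (S p)

/-- The counit of a free commutative algebra: the coefficient of the empty monomial. -/
def polyCounit (ι : Type) : MvPolynomial ι ℝ →ₗ[ℝ] ℝ :=
  (MvPolynomial.aeval fun _ : ι => (0 : ℝ)).toLinearMap

end

/-! The proof runs by duality on a general pre-Lie algebra L with a basis (a_k). The Guin–Oudom
basis identifies U(L) with polynomials, and u ↦ u ⊙ a_k is then adjoint to w_k ∂_k (`pairing_odot`).
The relation b(u ⊙ a) = (bu) ⊙ a + u ⊙ (b ▷ a) shows that left multiplication by b is adjoint to a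
derivation R as soon as R has the right constant terms and the right brackets with the ∂_k. This is
a condition on generators only (`IsLeftAdjoint.pairing_inj_mul`).

Let Δ be dual to the product of U(L). Coassociativity and the counit laws are transposes of
associativity and of the unit laws. Multiplicativity follows by induction on left factors, because
the adjoints R are derivations and (R ⊗ id) Δ = Δ R (`IsDual.comul_mul`). Conversely, an algebra
morphism Δ with the left counit law and (R ⊗ id) Δ = Δ R on generators is dual to the product
(`isDual_of_algHom`). A filtration whose lowest step consists of the scalars supplies the antipode
as a geometric series for convolution (`exists_antipode`).

On T_{≥2} the degree |β| - 1 is additive for ▷ and has finitely many basis elements below each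
bound, so the transposed coproduct is a finite sum and the general theory applies
(`exists_isHopf_coprod`). On trees, the adjoint of insertion for the pairing weighted by σ is the
extraction of a subtree (`form_insert`). The relation (R ⊗ id) Δ = Δ R becomes a bijection:
contracting a subtree and then choosing a spanning subforest amounts to choosing a spanning
subforest and a subtree of one of its components. Hence extraction–contraction is dual to the
product of U(B_{≥2}) (`isDual_coprodEC`).

The map Ψ respects ▷ because D(k! z_k) = (k+1)! z_{k+1}: the operator Ψ(x) D models the grafting of
x at an arbitrary vertex, so k branches grafted simultaneously on a contribute D^k Ψ(a), which is
the image of k! z_k under Ψ(a) ▷ (`psiSpan_insert`). The transpose sends the generator β to the sum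
of (σ(β)/σ(τ)) τ over the finitely many trees τ with β_τ = β. It intertwines partial derivatives,
hence is adjoint to Ψ (`pairing_psiDagger`). Compatibility with coproducts is then dual to
multiplicativity of Ψ on U, and a bialgebra morphism between Hopf algebras preserves antipodes. -/

noncomputable section

/-! ### Adjoints of the right action and of left multiplication. -/

namespace GuinOudom

variable {L : Type*} [LeftPreLieRing L] [LeftPreLieAlgebra ℝ L] {ι : Type*}

section Pairing

variable (a : Module.Basis ι ℝ L) (w : ι → ℝ)

lemma prod_add_single (h : ι → ℕ → ℝ) (h0 : ∀ i, h i 0 = 1) (I : ι →₀ ℕ) (k : ι) :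
    (I + Finsupp.single k 1).prod h * h k (I k) = I.prod h * h k (I k + 1) := by
  classical
  rw [← Finsupp.mul_prod_erase' (I + Finsupp.single k 1) k h h0,
    ← Finsupp.mul_prod_erase' I k h h0, Finsupp.erase_add, Finsupp.erase_single,
    add_zero]
  simp only [Finsupp.add_apply, Finsupp.single_eq_same]
  ring

lemma goElem_eq_ofPoly (I : ι →₀ ℕ) : goElem a I =
    (I.prod fun _ n => (n.factorial : ℝ))⁻¹ • ofPoly a (MvPolynomial.monomial I 1) := by
  rw [ofPoly_monomial, goElem]

lemma odot_goBasis (I : ι →₀ ℕ) (k : ι) : odot (goBasis a I) (a k) =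
    ((I k : ℝ) + 1) • goBasis a (I + Finsupp.single k 1) := by
  have h := prod_add_single (fun _ n => (n.factorial : ℝ)) (by simp) I k
  have h1 := factorial_ne_zero I
  have h2 := factorial_ne_zero (I + Finsupp.single k 1)
  have h3 : ((I k).factorial : ℝ) ≠ 0 := by positivity
  rw [Nat.factorial_succ] at h
  push_cast at h
  have h4 : (I + Finsupp.single k 1).prod (fun _ n => (n.factorial : ℝ)) =
      (I.prod fun _ n => (n.factorial : ℝ)) * (I k + 1) := by
    apply mul_right_cancel₀ h3
    rw [h]; ring
  have h5 : (I k : ℝ) + 1 ≠ 0 := by positivity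
  rw [goBasis_apply, goBasis_apply, goElem_eq_ofPoly, goElem_eq_ofPoly, odot_smul, ← ofPoly_mul_lin,
    lin_basis, MvPolynomial.X, MvPolynomial.monomial_mul, mul_one, smul_smul, h4, mul_inv_rev,
    ← mul_assoc, mul_inv_cancel₀ h5, one_mul]

open Classical in
lemma pairing_basis (I J : ι →₀ ℕ) :
    pairing a w (goBasis a I) (MvPolynomial.monomial J 1) =
      if I = J then I.prod fun i n => w i ^ n else 0 := by
  have h : MvPolynomial.monomial J (1 : ℝ) = MvPolynomial.basisMonomials ι ℝ J := by
    rw [MvPolynomial.coe_basisMonomials]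
  rw [pairing, Module.Basis.constr_basis, h, Module.Basis.constr_basis]

/-- Under the identification of U(L) with polynomials, ⊙ by a_k is multiplication by a variable. The
normalisation 1/I! turns its transpose into a derivative, and the weight enters once per factor. -/
lemma pairing_odot (u : U L) (k : ι) (q : MvPolynomial ι ℝ) :
    pairing a w (odot u (a k)) q = w k * pairing a w u (MvPolynomial.pderiv k q) := by
  classical
  have hlin : ∃ F : U L →ₗ[ℝ] U L, ∀ u, F u = odot u (a k) :=
    ⟨{ toFun := fun u => odot u (a k)
       map_add' := fun u v => odot_add u v _
       map_smul' := fun r u => odot_smul r u _ }, fun _ => rfl⟩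
  obtain ⟨F, hF⟩ := hlin
  have : pairing a w ∘ₗ F =
      w k • (LinearMap.lcomp ℝ ℝ (MvPolynomial.pderiv k).toLinearMap ∘ₗ pairing a w) := by
    refine (goBasis a).ext fun I => (MvPolynomial.basisMonomials ι ℝ).ext fun J => ?_
    simp only [LinearMap.comp_apply, LinearMap.smul_apply, hF, odot_goBasis,
      MvPolynomial.coe_basisMonomials, map_smul, pairing_basis, LinearMap.lcomp_apply,
      Derivation.coeFn_coe, MvPolynomial.pderiv_monomial, one_mul]
    have hm : MvPolynomial.monomial (J - Finsupp.single k 1) (J k : ℝ) =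
        (J k : ℝ) • MvPolynomial.monomial (J - Finsupp.single k 1) (1 : ℝ) := by
      simp [MvPolynomial.smul_monomial]
    rw [hm, map_smul, pairing_basis]
    simp only [smul_eq_mul]
    by_cases hJ : J k = 0
    · have : I + Finsupp.single k 1 ≠ J := fun h => by
        have := DFunLike.congr_fun h k
        simp [hJ] at this
      simp [hJ, this]
    · have hJ' : J - Finsupp.single k 1 + Finsupp.single k 1 = J :=
        tsub_add_cancel_of_le (Finsupp.single_le_iff.2 (Nat.one_le_iff_ne_zero.2 hJ))
      have hiff : I + Finsupp.single k 1 = J ↔ I = J - Finsupp.single k 1 := by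
        conv_lhs => rw [← hJ']
        exact add_left_inj _
      by_cases hI : I = J - Finsupp.single k 1
      · rw [if_pos (hiff.2 hI), if_pos hI]
        have hIJ : J k = I k + 1 := by rw [← hiff.2 hI]; simp
        have hp : (I + Finsupp.single k 1).prod (fun i n => w i ^ n) =
            (I.prod fun i n => w i ^ n) * w k := by
          rw [Finsupp.prod_add_index' (by simp) (fun i m n => pow_add _ _ _)]
          simp
        rw [hIJ, hp]; push_cast; ring
      · rw [if_neg hI, if_neg (fun h => hI (hiff.1 h))]; simp
  have h := LinearMap.congr_fun (LinearMap.congr_fun this u) q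
  simpa [hF] using h

lemma goBasis_zero : goBasis a 0 = 1 := by
  rw [goBasis_apply, goElem_eq_ofPoly]
  simp [ofPoly_one]

lemma pairing_one (q : MvPolynomial ι ℝ) : pairing a w 1 q = MvPolynomial.constantCoeff q := by
  classical
  have : pairing a w 1 = MvPolynomial.lcoeff ℝ 0 := by
    refine (MvPolynomial.basisMonomials ι ℝ).ext fun J => ?_
    rw [← goBasis_zero a, MvPolynomial.coe_basisMonomials, pairing_basis]
    simp [MvPolynomial.lcoeff_apply, MvPolynomial.coeff_monomial, eq_comm]
  rw [this]; rfl

/-- Induction on `U(L)` by the right action of basis elements. -/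
lemma odot_induction {P : U L → Prop} (u : U L) (h1 : P 1)
    (hadd : ∀ u v, P u → P v → P (u + v)) (hsmul : ∀ (r : ℝ) u, P u → P (r • u))
    (hodot : ∀ u k, P u → P (odot u (a k))) : P u := by
  rw [← ofPoly_toPoly a u]
  induction toPoly a u using MvPolynomial.induction_on with
  | C r =>
    have : (MvPolynomial.C r : MvPolynomial ι ℝ) = r • 1 := by
      simp [MvPolynomial.smul_eq_C_mul]
    rw [this, map_smul, ofPoly_one]
    exact hsmul _ _ h1
  | add p q hp hq => rw [map_add]; exact hadd _ _ hp hq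
  | mul_X p k hp =>
    rw [← lin_basis a k, ofPoly_mul_lin]
    exact hodot _ _ hp

lemma pairing_odot' (u : U L) (b : L) (q : MvPolynomial ι ℝ) :
    pairing a w (odot u b) q =
      (a.repr b).sum fun i r => r * (w i * pairing a w u (MvPolynomial.pderiv i q)) := by
  conv_lhs => rw [← a.linearCombination_repr b]
  rw [Finsupp.linearCombination_apply, Finsupp.sum, map_sum, map_sum, LinearMap.sum_apply]
  simp only [map_smul, LinearMap.smul_apply, pairing_odot, smul_eq_mul]
  rfl

/-- The derivation `R` of the polynomial algebra is adjoint to the left multiplication by `b`,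
expressed by a condition on generators. -/
structure IsLeftAdjoint (b : L)
    (R : Derivation ℝ (MvPolynomial ι ℝ) (MvPolynomial ι ℝ)) : Prop where
  const : ∀ i, MvPolynomial.constantCoeff (R (MvPolynomial.X i)) = a.repr b i * w i
  pderiv : ∀ i k, w k • MvPolynomial.pderiv k (R (MvPolynomial.X i)) =
    MvPolynomial.C (a.repr (b * a k) i * w i)

variable {a w}

/-- Induction on u through the right action: b(u ⊙ a_k) = (bu) ⊙ a_k + u ⊙ (b ▷ a_k), so the step
amounts to computing the bracket of ∂_k with R. -/
lemma IsLeftAdjoint.pairing_inj_mul {b : L}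
    {R : Derivation ℝ (MvPolynomial ι ℝ) (MvPolynomial ι ℝ)} (h : IsLeftAdjoint a w b R)
    (u : U L) (p : MvPolynomial ι ℝ) :
    pairing a w (inj b * u) p = pairing a w u (R p) := by
  classical
  induction u using odot_induction a generalizing p with
  | h1 =>
    rw [mul_one, pairing_one, ← odot_one, pairing_odot']
    simp only [pairing_one]
    -- Both sides are derivations of p at the origin, so they are determined by their values on the
    -- variables.
    induction p using MvPolynomial.induction_on with
    | C r => simp
    | add p q hp hq =>
      rw [map_add, map_add, ← hp, ← hq, ← Finsupp.sum_add]
      simp [mul_add]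
    | mul_X p i hp =>
      rw [Derivation.leibniz, map_add, smul_eq_mul, smul_eq_mul, map_mul, map_mul, h.const,
        MvPolynomial.constantCoeff_X, zero_mul, add_zero]
      simp only [Derivation.leibniz, smul_eq_mul, map_add, map_mul, MvPolynomial.constantCoeff_X,
        zero_mul, add_zero, MvPolynomial.pderiv_X]
      rw [Finsupp.sum, Finset.sum_eq_single i]
      · simp; ring
      · intro j _ hj
        simp [hj.symm]
      · intro hi
        simp [Finsupp.notMem_support_iff.1 hi]
  | hadd u v hu hv => simp only [mul_add, map_add, LinearMap.add_apply, hu, hv]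
  | hsmul r u hu => simp only [mul_smul_comm, map_smul, LinearMap.smul_apply, hu]
  | hodot u k hu =>
    have e := odot_inj_mul b u (a k)
    rw [eq_sub_iff_add_eq] at e
    rw [← e, map_add, LinearMap.add_apply, pairing_odot, hu, pairing_odot, pairing_odot']
    -- The bracket of ∂_k and R is a derivation. By `h.pderiv` its multiple by w_k is constant on
    -- each variable, so it is a combination of partial derivatives with the coordinates of b ▷ a_k,
    -- weighted, as coefficients.
    have key : w k • MvPolynomial.pderiv k (R p) = w k • R (MvPolynomial.pderiv k p) +
        (a.repr (b * a k)).sum fun i r => (r * w i) • MvPolynomial.pderiv i p := by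
      have : w k • ⁅(MvPolynomial.pderiv k :
            Derivation ℝ (MvPolynomial ι ℝ) (MvPolynomial ι ℝ)), R⁆ =
          ∑ i ∈ (a.repr (b * a k)).support,
            (a.repr (b * a k) i * w i) • (MvPolynomial.pderiv i :
              Derivation ℝ (MvPolynomial ι ℝ) (MvPolynomial ι ℝ)) := by
        refine MvPolynomial.derivation_ext fun i => ?_
        rw [Derivation.smul_apply, Derivation.commutator_apply, smul_sub, h.pderiv,
          ← Derivation.coeFnAddMonoidHom_apply (∑ i ∈ _, _), map_sum, Finset.sum_apply]
        have hR : R (MvPolynomial.pderiv (R := ℝ) k (MvPolynomial.X i)) = 0 := by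
          by_cases hik : i = k <;> simp [MvPolynomial.pderiv_X, hik]
        rw [hR, smul_zero, sub_zero, Finset.sum_eq_single i]
        · simp [MvPolynomial.smul_eq_C_mul]
        · intro j _ hj
          simp [MvPolynomial.pderiv_X, hj.symm]
        · intro hi
          simp [Finsupp.notMem_support_iff.1 hi]
      have h' := congrArg
        (fun E : Derivation ℝ (MvPolynomial ι ℝ) (MvPolynomial ι ℝ) => E p) this
      simp only [Derivation.smul_apply, Derivation.commutator_apply] at h'
      rw [← Derivation.coeFnAddMonoidHom_apply (∑ i ∈ _, _), map_sum, Finset.sum_apply] at h'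
      rw [← sub_eq_iff_eq_add', ← smul_sub, h']
      rfl
    rw [← smul_eq_mul (w k) (pairing a w u (MvPolynomial.pderiv k (R p))), ← map_smul, key, map_add,
      map_smul, smul_eq_mul, Finsupp.sum, Finsupp.sum, map_sum]
    congr 1
    refine Finset.sum_congr rfl fun i _ => ?_
    rw [map_smul, smul_eq_mul, mul_assoc]

end Pairing

end GuinOudom
end

/-! ### Coproducts dual to the product of an enveloping algebra. -/

noncomputable section

namespace GuinOudom

variable {L : Type*} [LeftPreLieRing L] [LeftPreLieAlgebra ℝ L] {ι : Type*}

/-- Application of a linear form to the left tensor factor. -/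
def slice {A : Type*} [AddCommGroup A] [Module ℝ A] (M : Type*) [AddCommGroup M] [Module ℝ M]
    (f : A →ₗ[ℝ] ℝ) : A ⊗[ℝ] M →ₗ[ℝ] M :=
  (TensorProduct.lid ℝ M).toLinearMap ∘ₗ f.rTensor M

section Slice

variable {A M N : Type*} [AddCommGroup A] [Module ℝ A] [AddCommGroup M] [Module ℝ M]
  [AddCommGroup N] [Module ℝ N]

@[simp] lemma slice_tmul (f : A →ₗ[ℝ] ℝ) (x : A) (m : M) : slice M f (x ⊗ₜ m) = f x • m := by
  simp [slice]

lemma slice_lTensor (f : A →ₗ[ℝ] ℝ) (g : M →ₗ[ℝ] N) (z : A ⊗[ℝ] M) :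
    slice N f (g.lTensor A z) = g (slice M f z) := by
  induction z using TensorProduct.induction_on with
  | zero => simp
  | tmul x m => simp
  | add x y hx hy => simp only [map_add, hx, hy]

lemma slice_rTensor {B : Type*} [AddCommGroup B] [Module ℝ B] (f : B →ₗ[ℝ] ℝ) (g : A →ₗ[ℝ] B)
    (z : A ⊗[ℝ] M) : slice M f (g.rTensor M z) = slice M (f ∘ₗ g) z := by
  induction z using TensorProduct.induction_on with
  | zero => simp
  | tmul x m => simp
  | add x y hx hy => simp only [map_add, hx, hy]

lemma slice_add (f g : A →ₗ[ℝ] ℝ) (z : A ⊗[ℝ] M) :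
    slice M (f + g) z = slice M f z + slice M g z := by
  simp [slice, LinearMap.rTensor_add]

lemma slice_smul (r : ℝ) (f : A →ₗ[ℝ] ℝ) (z : A ⊗[ℝ] M) :
    slice M (r • f) z = r • slice M f z := by
  simp [slice, LinearMap.rTensor_smul]

lemma slice_assoc (f g : A →ₗ[ℝ] ℝ) (z : (A ⊗[ℝ] A) ⊗[ℝ] M) :
    slice M g (slice (A ⊗[ℝ] M) f (TensorProduct.assoc ℝ A A M z)) =
      slice M (g ∘ₗ slice A f) z := by
  induction z using TensorProduct.induction_on with
  | zero => simp
  | tmul z m =>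
    induction z using TensorProduct.induction_on with
    | zero => simp
    | tmul x y => simp [mul_smul]
    | add x y hx hy => simp only [map_add, TensorProduct.add_tmul, hx, hy]
  | add x y hx hy => simp only [map_add, hx, hy]

end Slice

variable {a : Module.Basis ι ℝ L} {w : ι → ℝ}

lemma pairing_goBasis (I : ι →₀ ℕ) : pairing a w (goBasis a I) =
    (I.prod fun i n => w i ^ n) • (MvPolynomial.basisMonomials ι ℝ).coord I := by
  classical
  refine (MvPolynomial.basisMonomials ι ℝ).ext fun J => ?_
  have h : MvPolynomial.basisMonomials ι ℝ J = MvPolynomial.monomial J 1 := by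
    rw [MvPolynomial.coe_basisMonomials]
  rw [LinearMap.smul_apply, Module.Basis.coord_apply, Module.Basis.repr_self, h, pairing_basis]
  by_cases hIJ : I = J
  · simp [hIJ]
  · simp [hIJ, Finsupp.single_eq_of_ne hIJ]

lemma weight_prod_ne_zero (hw : ∀ i, w i ≠ 0) (I : ι →₀ ℕ) : (I.prod fun i n => w i ^ n) ≠ 0 :=
  Finset.prod_ne_zero_iff.2 fun _ _ => pow_ne_zero _ (hw _)

/-- With nonzero weights, the pairings with the Guin–Oudom basis are nonzero multiples of the
coordinate forms, so they separate the left tensor factor. All bialgebra axioms below are tested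
through such slices. -/
lemma slice_ext {M : Type*} [AddCommGroup M] [Module ℝ M] (hw : ∀ i, w i ≠ 0)
    {z z' : MvPolynomial ι ℝ ⊗[ℝ] M}
    (h : ∀ u, slice M (pairing a w u) z = slice M (pairing a w u) z') : z = z' := by
  classical
  refine (TensorProduct.equivFinsuppOfBasisLeft (MvPolynomial.basisMonomials ι ℝ)).injective
    (Finsupp.ext fun I => ?_)
  have := h (goBasis a I)
  rw [pairing_goBasis, slice_smul, slice_smul] at this
  rw [TensorProduct.equivFinsuppOfBasisLeft_apply, TensorProduct.equivFinsuppOfBasisLeft_apply]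
  exact smul_right_injective M (weight_prod_ne_zero hw I) this

lemma pairing_ext (hw : ∀ i, w i ≠ 0) {p q : MvPolynomial ι ℝ}
    (h : ∀ u, pairing a w u p = pairing a w u q) : p = q := by
  refine (MvPolynomial.basisMonomials ι ℝ).repr.injective (Finsupp.ext fun I => ?_)
  have := h (goBasis a I)
  rw [pairing_goBasis] at this
  exact mul_left_cancel₀ (weight_prod_ne_zero hw I) this

/-- The coproduct `Δ` is dual to the concatenation product of `U(L)`. -/
def IsDual (a : Module.Basis ι ℝ L) (w : ι → ℝ)
    (Δ : MvPolynomial ι ℝ →ₗ[ℝ] MvPolynomial ι ℝ ⊗[ℝ] MvPolynomial ι ℝ) : Prop :=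
  ∀ u v p, pairing a w v (slice _ (pairing a w u) (Δ p)) = pairing a w (u * v) p

/-- Pairing with 1 is the augmentation of U(L): every term of the form u ⊙ a is killed, since
derivatives of 1 vanish. -/
lemma pairing_one_right_inj_mul (b : L) (u : U L) : pairing a w (inj b * u) 1 = 0 := by
  induction u using odot_induction a with
  | h1 => rw [mul_one, ← odot_one, pairing_odot']; simp
  | hadd u v hu hv => simp only [mul_add, map_add, LinearMap.add_apply, hu, hv, add_zero]
  | hsmul r u hu => simp only [mul_smul_comm, map_smul, LinearMap.smul_apply, hu, smul_zero]
  | hodot u k hu =>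
    have e := odot_inj_mul b u (a k)
    rw [eq_sub_iff_add_eq] at e
    rw [← e, map_add, LinearMap.add_apply, pairing_odot, pairing_odot']
    simp

lemma pairing_mul_one_right (u v : U L) :
    pairing a w (u * v) 1 = pairing a w u 1 * pairing a w v 1 := by
  induction u using U_induction with
  | h1 => simp [pairing_one]
  | hadd u v hu hv => simp only [add_mul, map_add, LinearMap.add_apply, hu, hv]
  | hsmul r u hu => simp only [smul_mul_assoc, map_smul, LinearMap.smul_apply, hu, smul_eq_mul,
      mul_assoc]
  | hmul b u hu => rw [mul_assoc, pairing_one_right_inj_mul, pairing_one_right_inj_mul, zero_mul]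

/-- The operator R ⊗ id is again a derivation, written without bundling it as one. -/
lemma derivation_rTensor_mul {A : Type*} [CommRing A] [Algebra ℝ A] (R : Derivation ℝ A A)
    (y z : A ⊗[ℝ] A) : R.toLinearMap.rTensor A (y * z) =
      y * R.toLinearMap.rTensor A z + z * R.toLinearMap.rTensor A y := by
  induction y using TensorProduct.induction_on with
  | zero => simp
  | tmul x m =>
    induction z using TensorProduct.induction_on with
    | zero => simp
    | tmul x' m' => simp [TensorProduct.add_tmul, mul_comm m m']
    | add x y hx hy => simp only [map_add, mul_add, add_mul, hx, hy]; abel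
  | add x y hx hy => simp only [map_add, mul_add, add_mul, hx, hy]; abel

lemma polyCounit_eq {ι : Type} {a : Module.Basis ι ℝ L} {w : ι → ℝ} :
    polyCounit ι = pairing a w 1 := by
  refine LinearMap.ext fun p => ?_
  rw [pairing_one, polyCounit, AlgHom.toLinearMap_apply, MvPolynomial.constantCoeff_eq]
  simp [MvPolynomial.aeval_zero', MvPolynomial.constantCoeff_eq]

lemma pairing_one_mul (p q : MvPolynomial ι ℝ) :
    pairing a w 1 (p * q) = pairing a w 1 p * pairing a w 1 q := by
  simp only [pairing_one, map_mul]

lemma slice_one_mul (y z : MvPolynomial ι ℝ ⊗[ℝ] MvPolynomial ι ℝ) :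
    slice _ (pairing a w 1) (y * z) = slice _ (pairing a w 1) y * slice _ (pairing a w 1) z := by
  induction y using TensorProduct.induction_on with
  | zero => simp
  | tmul x m =>
    induction z using TensorProduct.induction_on with
    | zero => simp
    | tmul x' m' => simp [pairing_one_mul, mul_smul, smul_comm (pairing a w 1 x)]
    | add x y hx hy => simp only [map_add, mul_add, hx, hy]
  | add x y hx hy => simp only [map_add, add_mul, hx, hy]

namespace IsDual

variable {Δ : MvPolynomial ι ℝ →ₗ[ℝ] MvPolynomial ι ℝ ⊗[ℝ] MvPolynomial ι ℝ}

/-- Associativity of U(L), read through the nondegenerate pairing. -/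
lemma slice_slice (hw : ∀ i, w i ≠ 0) (h : IsDual a w Δ) (u v : U L) (p : MvPolynomial ι ℝ) :
    slice _ (pairing a w v) (Δ (slice _ (pairing a w u) (Δ p))) =
      slice _ (pairing a w (u * v)) (Δ p) :=
  pairing_ext (a := a) hw fun x => by rw [h, h, h, mul_assoc]

lemma slice_one (hw : ∀ i, w i ≠ 0) (h : IsDual a w Δ) (p : MvPolynomial ι ℝ) :
    slice _ (pairing a w 1) (Δ p) = p :=
  pairing_ext (a := a) hw fun x => by rw [h, one_mul]

lemma coassoc (hw : ∀ i, w i ≠ 0) (h : IsDual a w Δ) :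
    (TensorProduct.assoc ℝ _ _ _).toLinearMap ∘ₗ Δ.rTensor _ ∘ₗ Δ = Δ.lTensor _ ∘ₗ Δ := by
  refine LinearMap.ext fun p => slice_ext (a := a) hw fun u => slice_ext (a := a) hw fun v => ?_
  simp only [LinearMap.comp_apply, LinearEquiv.coe_coe]
  rw [slice_assoc, slice_rTensor, slice_lTensor, h.slice_slice hw]
  congr 2
  exact LinearMap.ext fun q => h u v q

lemma rTensor_counit (hw : ∀ i, w i ≠ 0) (h : IsDual a w Δ) :
    (pairing a w 1).rTensor _ ∘ₗ Δ = TensorProduct.mk ℝ _ _ 1 := by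
  refine LinearMap.ext fun p => (TensorProduct.lid ℝ _).injective ?_
  have := h.slice_one hw p
  simpa [slice] using this

lemma lTensor_counit (hw : ∀ i, w i ≠ 0) (h : IsDual a w Δ) :
    (pairing a w 1).lTensor _ ∘ₗ Δ = (TensorProduct.mk ℝ _ _).flip 1 := by
  refine LinearMap.ext fun p => slice_ext (a := a) hw fun u => ?_
  rw [LinearMap.comp_apply, slice_lTensor, h, mul_one]
  simp

lemma comul_one (hw : ∀ i, w i ≠ 0) (h : IsDual a w Δ) : Δ 1 = 1 := by
  refine slice_ext (a := a) hw fun u => pairing_ext (a := a) hw fun v => ?_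
  rw [h, pairing_mul_one_right, Algebra.TensorProduct.one_def, slice_tmul, map_smul, smul_eq_mul]

/-- Transpose of (bu)v = b(uv). -/
lemma rTensor_comp (hw : ∀ i, w i ≠ 0) (h : IsDual a w Δ) {b : L}
    {R : Derivation ℝ (MvPolynomial ι ℝ) (MvPolynomial ι ℝ)} (hR : IsLeftAdjoint a w b R)
    (p : MvPolynomial ι ℝ) : R.toLinearMap.rTensor _ (Δ p) = Δ (R p) := by
  refine slice_ext (a := a) hw fun u => pairing_ext (a := a) hw fun v => ?_
  have : pairing a w u ∘ₗ R.toLinearMap = pairing a w (inj b * u) :=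
    LinearMap.ext fun q => (hR.pairing_inj_mul u q).symm
  rw [slice_rTensor, this, h, h, mul_assoc, hR.pairing_inj_mul]

/-- Slicing by bu is slicing by u after R ⊗ id, and R ⊗ id obeys the Leibniz rule and commutes with
Δ. Hence the slices of Δ(pq) and of Δp Δq satisfy the same recursion on u. At u = 1, slicing is
multiplicative. -/
lemma comul_mul (hw : ∀ i, w i ≠ 0) (h : IsDual a w Δ)
    (hR : ∀ b, ∃ R, IsLeftAdjoint a w b R) (p q : MvPolynomial ι ℝ) :
    Δ (p * q) = Δ p * Δ q := by
  refine slice_ext (a := a) hw fun u => ?_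
  induction u using U_induction generalizing p q with
  | h1 => rw [slice_one_mul, h.slice_one hw, h.slice_one hw, h.slice_one hw]
  | hadd u v hu hv => simp only [map_add, slice_add, hu, hv]
  | hsmul r u hu => simp only [map_smul, slice_smul, hu]
  | hmul b u hu =>
    obtain ⟨R, hR⟩ := hR b
    have : pairing a w (inj b * u) = pairing a w u ∘ₗ R.toLinearMap :=
      LinearMap.ext fun q => hR.pairing_inj_mul u q
    rw [this, ← slice_rTensor, ← slice_rTensor, h.rTensor_comp hw hR,
      derivation_rTensor_mul, h.rTensor_comp hw hR, h.rTensor_comp hw hR, Derivation.leibniz,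
      map_add, map_add, map_add, smul_eq_mul, smul_eq_mul, hu, hu]

end IsDual

/-- A multiplicative coproduct that intertwines the adjoints of the left multiplications by
generators is dual to the concatenation product. -/
lemma isDual_of_algHom {Δ : MvPolynomial ι ℝ →ₐ[ℝ] MvPolynomial ι ℝ ⊗[ℝ] MvPolynomial ι ℝ}
    (h1 : ∀ i, slice _ (pairing a w 1) (Δ (MvPolynomial.X i)) = MvPolynomial.X i)
    (hR : ∀ b, ∃ R, IsLeftAdjoint a w b R ∧
      ∀ i, R.toLinearMap.rTensor _ (Δ (MvPolynomial.X i)) = Δ (R (MvPolynomial.X i))) :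
    IsDual a w Δ.toLinearMap := by
  intro u v p
  simp only [AlgHom.toLinearMap_apply]
  induction u using U_induction generalizing p with
  | h1 =>
    rw [one_mul]
    congr 1
    induction p using MvPolynomial.induction_on with
    | C r =>
      rw [← MvPolynomial.algebraMap_eq, AlgHom.commutes, Algebra.TensorProduct.algebraMap_apply,
        slice_tmul, MvPolynomial.algebraMap_eq, pairing_one]
      simp [MvPolynomial.smul_eq_C_mul]
    | add p q hp hq => simp only [map_add, hp, hq]
    | mul_X p i hp => rw [map_mul, slice_one_mul, hp, h1]
  | hadd u v hu hv =>
    simp only [map_add, slice_add, hu, hv, add_mul, LinearMap.add_apply]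
  | hsmul r u hu => simp only [map_smul, slice_smul, hu, smul_mul_assoc, LinearMap.smul_apply]
  | hmul b u hu =>
    obtain ⟨R, hR, hR'⟩ := hR b
    -- Both sides are derivations along the algebra morphism Δ, so agreement on generators is
    -- enough.
    have key : ∀ p, R.toLinearMap.rTensor _ (Δ p) = Δ (R p) := by
      intro p
      induction p using MvPolynomial.induction_on with
      | C r =>
        rw [← MvPolynomial.algebraMap_eq, AlgHom.commutes, Algebra.TensorProduct.algebraMap_apply]
        simp
      | add p q hp hq => simp only [map_add, hp, hq]
      | mul_X p i hp =>
        rw [map_mul, derivation_rTensor_mul, hp, hR', Derivation.leibniz, map_add, smul_eq_mul,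
          smul_eq_mul, map_mul, map_mul]
    have : pairing a w (inj b * u) = pairing a w u ∘ₗ R.toLinearMap :=
      LinearMap.ext fun q => hR.pairing_inj_mul u q
    rw [this, ← slice_rTensor, key, hu, mul_assoc, hR.pairing_inj_mul]

/-- The defining conditions of an adjoint are linear in (b, R). The predicate Q transports any
further linear condition on R, such as commutation with a coproduct. -/
lemma IsLeftAdjoint.exists_of_basis {Q : Derivation ℝ (MvPolynomial ι ℝ) (MvPolynomial ι ℝ) → Prop}
    (h0 : Q 0) (hadd : ∀ R R', Q R → Q R' → Q (R + R')) (hsmul : ∀ (r : ℝ) R, Q R → Q (r • R))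
    (h : ∀ j, ∃ R, IsLeftAdjoint a w (a j) R ∧ Q R) (b : L) :
    ∃ R, IsLeftAdjoint a w b R ∧ Q R := by
  induction a.mem_span b using Submodule.span_induction with
  | mem x hx => obtain ⟨j, rfl⟩ := hx; exact h j
  | zero => refine ⟨0, ⟨?_, ?_⟩, h0⟩ <;> simp
  | add x y _ _ hx hy =>
    obtain ⟨R, hR, hQ⟩ := hx
    obtain ⟨R', hR', hQ'⟩ := hy
    refine ⟨R + R', ⟨fun i => ?_, fun i k => ?_⟩, hadd _ _ hQ hQ'⟩
    · simp [hR.const, hR'.const, add_mul]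
    · simp [hR.pderiv, hR'.pderiv, add_mul]
  | smul r x _ hx =>
    obtain ⟨R, hR, hQ⟩ := hx
    refine ⟨r • R, ⟨fun i => ?_, fun i k => ?_⟩, hsmul _ _ hQ⟩
    · simp [hR.const, mul_assoc]
    · rw [Derivation.smul_apply, Derivation.map_smul, smul_comm, hR.pderiv]
      simp [smul_mul_assoc r x, MvPolynomial.smul_eq_C_mul, mul_assoc]

end GuinOudom
end

/-! ### Antipodes of connected filtered bialgebras. -/

noncomputable section

section Antipode

open WithConv

variable {A : Type*} [CommRing A] [Algebra ℝ A]

/-- A coalgebra structure from its axioms in the form used by `IsHopf`. -/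
@[reducible] def coalgebraOf {Δ : A →ₗ[ℝ] A ⊗[ℝ] A} {ε : A →ₗ[ℝ] ℝ}
    (h1 : (TensorProduct.assoc ℝ A A A).toLinearMap ∘ₗ Δ.rTensor A ∘ₗ Δ = Δ.lTensor A ∘ₗ Δ)
    (h2 : ε.rTensor A ∘ₗ Δ = TensorProduct.mk ℝ _ _ 1)
    (h3 : ε.lTensor A ∘ₗ Δ = (TensorProduct.mk ℝ _ _).flip 1) : Coalgebra ℝ A where
  comul := Δ
  counit := ε
  coassoc := h1
  rTensor_counit_comp_comul := h2
  lTensor_counit_comp_comul := h3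

/-- The coproduct is compatible with the filtration `F`. -/
def IsFiltered (F : ℕ → Submodule ℝ A) (Δ : A →ₗ[ℝ] A ⊗[ℝ] A) : Prop :=
  ∀ n, ∀ p ∈ F n, Δ p ∈ Submodule.span ℝ
    {z | ∃ k l, k + l ≤ n ∧ ∃ x ∈ F k, ∃ y ∈ F l, z = x ⊗ₜ[ℝ] y}

/-- The operator ηε - id vanishes on F 0, so each convolution factor must consume filtration degree
at least one. On F n there is room for at most n factors. -/
lemma conv_pow_eq_zero [Coalgebra ℝ A] {F : ℕ → Submodule ℝ A}
    (hF0 : ∀ p ∈ F 0, p = algebraMap ℝ A (Coalgebra.counit p))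
    (hΔ : IsFiltered F (Coalgebra.comul (R := ℝ) (A := A))) (m n : ℕ) (hmn : n < m) (p : A)
    (hp : p ∈ F n) : ((1 - toConv LinearMap.id : WithConv (A →ₗ[ℝ] A)) ^ m) p = 0 := by
  induction m generalizing n p with
  | zero => omega
  | succ m ih =>
    rw [pow_succ', LinearMap.convMul_apply]
    have h := hΔ n p hp
    generalize (Coalgebra.comul (R := ℝ) p : A ⊗[ℝ] A) = z at h ⊢
    induction h using Submodule.span_induction with
    | mem z hz =>
      obtain ⟨k, l, hkl, x, hx, y, hy, rfl⟩ := hz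
      rw [TensorProduct.map_tmul, LinearMap.mul'_apply]
      -- A left leg in F 0 is killed by the first factor; otherwise the right leg lies in F l with l
      -- < n, within reach of the induction hypothesis.
      obtain rfl | hk := Nat.eq_zero_or_pos k
      · have : (1 - toConv LinearMap.id : WithConv (A →ₗ[ℝ] A)).ofConv x = 0 :=
          sub_eq_zero.2 (hF0 x hx).symm
        rw [this, zero_mul]
      · have := ih l (by omega) y hy
        rw [show (((1 - toConv LinearMap.id : WithConv (A →ₗ[ℝ] A)) ^ m).ofConv) y = 0 from this,
          mul_zero]
    | zero => simp
    | add x y _ _ hx hy => rw [map_add, map_add, hx, hy, add_zero]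
    | smul r x _ hx => rw [map_smul, map_smul, hx, smul_zero]

/-- A connected filtered bialgebra has an antipode. -/
theorem exists_antipode {Δ : A →ₗ[ℝ] A ⊗[ℝ] A} {ε : A →ₗ[ℝ] ℝ}
    (h1 : (TensorProduct.assoc ℝ A A A).toLinearMap ∘ₗ Δ.rTensor A ∘ₗ Δ = Δ.lTensor A ∘ₗ Δ)
    (h2 : ε.rTensor A ∘ₗ Δ = TensorProduct.mk ℝ _ _ 1)
    (h3 : ε.lTensor A ∘ₗ Δ = (TensorProduct.mk ℝ _ _).flip 1)
    {F : ℕ → Submodule ℝ A} (hmono : Monotone F) (hF : ∀ p, ∃ n, p ∈ F n)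
    (hF0 : ∀ p ∈ F 0, p = algebraMap ℝ A (ε p)) (hΔ : IsFiltered F Δ) :
    ∃ S : A →ₗ[ℝ] A, LinearMap.mul' ℝ A ∘ₗ S.rTensor A ∘ₗ Δ = Algebra.linearMap ℝ A ∘ₗ ε ∧
      LinearMap.mul' ℝ A ∘ₗ S.lTensor A ∘ₗ Δ = Algebra.linearMap ℝ A ∘ₗ ε := by
  let _ := coalgebraOf h1 h2 h3
  set e : WithConv (A →ₗ[ℝ] A) := 1 - toConv LinearMap.id with he
  have hnil := conv_pow_eq_zero hF0 hΔ
  choose d hd using hF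
  -- Since id = 1 - e, its convolution inverse should be the geometric series in e. The partial sums
  -- stabilise on each F n.
  let T : ℕ → WithConv (A →ₗ[ℝ] A) := fun N => ∑ k ∈ Finset.range N, e ^ k
  have hT : ∀ n p, p ∈ F n → ∀ N, n < N → (T N) p = (T (n + 1)) p := by
    intro n p hp N hN
    induction N, hN using Nat.le_induction with
    | base => rfl
    | succ N hN ih =>
      have : T (N + 1) = T N + e ^ N := Finset.sum_range_succ _ _
      rw [this, ← ih]
      exact (congrArg ((T N) p + ·) (hnil N n hN p hp)).trans (add_zero _)
  have hT' : ∀ p N, d p < N → (T (d p + 1)) p = (T N) p := fun p N hN =>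
    (hT _ p (hd p) N hN).symm
  -- The truncation index depends on p in a non-linear way. Linearity is recovered by passing to one
  -- larger index, at which all the partial sums involved agree.
  let S : A →ₗ[ℝ] A :=
    { toFun := fun p => (T (d p + 1)) p
      map_add' := fun p q => by
        rw [hT' (p + q) (d (p + q) + d p + d q + 1) (by omega),
          hT' p (d (p + q) + d p + d q + 1) (by omega),
          hT' q (d (p + q) + d p + d q + 1) (by omega)]
        exact (T _).ofConv.map_add p q
      map_smul' := fun r p => by
        rw [hT' (r • p) (d (r • p) + d p + 1) (by omega),
          hT' p (d (r • p) + d p + 1) (by omega)]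
        exact (T _).ofConv.map_smul r p }
  have hS : ∀ n p, p ∈ F n → S p = (T (n + 1)).ofConv p := by
    intro n p hp
    change (T (d p + 1)) p = (T (n + 1)) p
    rw [hT' p (d p + n + 1) (by omega), hT n p hp _ (by omega)]
  -- All legs of Δ p lie in F n, so a single truncation can replace S on the whole of Δ p.
  have hspan : ∀ n p, p ∈ F n → Δ p ∈ Submodule.span ℝ
      {z | ∃ x ∈ F n, ∃ y ∈ F n, z = x ⊗ₜ[ℝ] y} := fun n p hp => by
    refine Submodule.span_mono ?_ (hΔ n p hp)
    rintro z ⟨k, l, hkl, x, hx, y, hy, rfl⟩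
    exact ⟨x, hmono (by omega) hx, y, hmono (by omega) hy, rfl⟩
  refine ⟨S, LinearMap.ext fun p => ?_, LinearMap.ext fun p => ?_⟩
  · have hl : S.rTensor A (Δ p) = (T (d p + 1)).ofConv.rTensor A (Δ p) := by
      refine LinearMap.eqOn_span ?_ (hspan _ p (hd p))
      rintro z ⟨x, hx, y, hy, rfl⟩
      simp [hS _ x hx]
    have := geom_sum_mul_neg e (d p + 1)
    rw [he, sub_sub_cancel, ← he] at this
    have h' : (T (d p + 1) * toConv LinearMap.id : WithConv (A →ₗ[ℝ] A)) p = (1 - e ^ (d p + 1)) p :=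
      congrArg (fun f : WithConv (A →ₗ[ℝ] A) => f p) this
    have h0 : (1 - e ^ (d p + 1)) p = (1 : WithConv (A →ₗ[ℝ] A)) p - (e ^ (d p + 1)) p := rfl
    rw [h0, hnil _ _ (Nat.lt_succ_self _) p (hd p), sub_zero] at h'
    rw [LinearMap.comp_apply, LinearMap.comp_apply, hl]
    exact h'
  · have hl : S.lTensor A (Δ p) = (T (d p + 1)).ofConv.lTensor A (Δ p) := by
      refine LinearMap.eqOn_span ?_ (hspan _ p (hd p))
      rintro z ⟨x, hx, y, hy, rfl⟩
      simp [hS _ y hy]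
    have := mul_neg_geom_sum e (d p + 1)
    rw [he, sub_sub_cancel, ← he] at this
    have h' : (toConv LinearMap.id * T (d p + 1) : WithConv (A →ₗ[ℝ] A)) p = (1 - e ^ (d p + 1)) p :=
      congrArg (fun f : WithConv (A →ₗ[ℝ] A) => f p) this
    have h0 : (1 - e ^ (d p + 1)) p = (1 : WithConv (A →ₗ[ℝ] A)) p - (e ^ (d p + 1)) p := rfl
    rw [h0, hnil _ _ (Nat.lt_succ_self _) p (hd p), sub_zero] at h'
    rw [LinearMap.comp_apply, LinearMap.comp_apply, hl]
    exact h'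

/-- A morphism of bialgebras between Hopf algebras is compatible with the antipodes. -/
theorem IsHopf.map_antipode {A' : Type*} [CommRing A'] [Algebra ℝ A']
    {Δ : A →ₗ[ℝ] A ⊗[ℝ] A} {ε : A →ₗ[ℝ] ℝ} {S : A →ₗ[ℝ] A} (h : IsHopf Δ ε S)
    {Δ' : A' →ₗ[ℝ] A' ⊗[ℝ] A'} {ε' : A' →ₗ[ℝ] ℝ} {S' : A' →ₗ[ℝ] A'} (h' : IsHopf Δ' ε' S')
    (F : A →ₐ[ℝ] A') (hΔ : ∀ p, Δ' (F p) = TensorProduct.map F.toLinearMap F.toLinearMap (Δ p))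
    (hε : ∀ p, ε' (F p) = ε p) (p : A) : S' (F p) = F (S p) := by
  let _ := coalgebraOf h.coassoc h.rTensor_counit h.lTensor_counit
  -- In the convolution algebra of linear maps A → A', F has the left inverse S' ∘ F and the right
  -- inverse F ∘ S, which must coincide.
  have hl : toConv (S' ∘ₗ F.toLinearMap) * toConv F.toLinearMap = 1 := by
    refine WithConv.ext (LinearMap.ext fun p => ?_)
    have e := LinearMap.congr_fun h'.antipode_left (F p)
    simp only [LinearMap.comp_apply, hΔ, hε] at e
    rw [LinearMap.rTensor, ← LinearMap.comp_apply (TensorProduct.map S' _),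
      ← TensorProduct.map_comp] at e
    exact e
  have hr : toConv F.toLinearMap * toConv (F.toLinearMap ∘ₗ S) = 1 := by
    refine WithConv.ext (LinearMap.ext fun p => ?_)
    have e := congrArg F (LinearMap.congr_fun h.antipode_right p)
    simp only [LinearMap.comp_apply, Algebra.linearMap_apply, AlgHom.commutes] at e
    refine Eq.trans ?_ e
    change LinearMap.mul' ℝ A' (TensorProduct.map F.toLinearMap (F.toLinearMap ∘ₗ S) (Δ p)) = _
    generalize Δ p = z
    induction z using TensorProduct.induction_on with
    | zero => simp
    | tmul x y => simp
    | add x y hx hy => simp only [map_add, hx, hy]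
  have := left_inv_eq_right_inv hl hr
  exact congrArg (fun f : WithConv (A →ₗ[ℝ] A') => f p) this

end Antipode
end

/-! ### Functoriality of the enveloping algebra. -/

noncomputable section

namespace GuinOudom

section Functoriality

attribute [local instance] LieRing.ofAssociativeRing

variable {L L' : Type*} [LeftPreLieRing L] [LeftPreLieAlgebra ℝ L]
  [LeftPreLieRing L'] [LeftPreLieAlgebra ℝ L']

/-- The morphism of enveloping algebras induced by a morphism of pre-Lie algebras. -/
def mapU (ψ : L →ₗ[ℝ] L') (h : ∀ a b, ψ (a * b) = ψ a * ψ b) : U L →ₐ[ℝ] U L' :=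
  UniversalEnvelopingAlgebra.lift ℝ
    { UniversalEnvelopingAlgebra.ι ℝ (L := L') ∘ₗ ψ with
      map_lie' := fun {a b} => by
        have e : ⁅a, b⁆ = a * b - b * a := rfl
        have e' := inj_comm (ψ a) (ψ b)
        simp only [e, map_sub, h, AddHom.toFun_eq_coe, LinearMap.coe_toAddHom,
          LinearMap.comp_apply, LieRing.of_associative_ring_bracket]
        exact ((e'.trans (inj_sub _ _).symm).trans (map_sub _ _ _)).symm }

variable (ψ : L →ₗ[ℝ] L') (h : ∀ a b, ψ (a * b) = ψ a * ψ b)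

@[simp] lemma mapU_inj (b : L) : mapU ψ h (inj b) = inj (ψ b) := by
  rw [mapU, inj, UniversalEnvelopingAlgebra.lift_ι_apply]
  rfl

/-- The recursion that determines ⊙ involves only the product of U and ▷, and both are preserved. -/
lemma mapU_odot (u : U L) (b : L) : mapU ψ h (odot u b) = odot (mapU ψ h u) (ψ b) := by
  induction u using U_induction generalizing b with
  | h1 => simp
  | hadd u v hu hv => simp only [odot_add, map_add, hu, hv]
  | hsmul r u hu => simp only [odot_smul, map_smul, hu]
  | hmul c u hu => simp only [odot_inj_mul, map_sub, map_mul, mapU_inj, hu, h]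

end Functoriality

/-! ### Connected graded pre-Lie algebras and their dual Hopf algebras. -/

section Grading

variable {L : Type*} [LeftPreLieRing L] [LeftPreLieAlgebra ℝ L] {ι : Type*}

/-- The degree `deg` of the basis elements is additive for the pre-Lie product. -/
def IsGraded (a : Module.Basis ι ℝ L) (deg : ι → ℕ) : Prop :=
  ∀ i j k, a.repr (a j * a k) i ≠ 0 → deg i = deg j + deg k

variable {a : Module.Basis ι ℝ L} {deg : ι → ℕ}

/-- The linear map that multiplies basis elements of degree `d` by `2 ^ d`. -/
def scale (a : Module.Basis ι ℝ L) (deg : ι → ℕ) : L →ₗ[ℝ] L :=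
  a.constr ℝ fun i => (2 : ℝ) ^ deg i • a i

lemma scale_basis (i : ι) : scale a deg (a i) = (2 : ℝ) ^ deg i • a i := by
  rw [scale, Module.Basis.constr_basis]

/-- An additive grading amounts to a pre-Lie endomorphism acting by 2^d in degree d. It extends to
U(L) by functoriality, so the grading of the product of U(L) needs no expansion in the Guin–Oudom
basis. -/
lemma IsGraded.scale_mul (hg : IsGraded a deg) (x y : L) :
    scale a deg (x * y) = scale a deg x * scale a deg y := by
  have key : ∀ j k, scale a deg (a j * a k) = scale a deg (a j) * scale a deg (a k) := by
    intro j k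
    rw [scale_basis, scale_basis, smul_mul_assoc, mul_smul_comm, smul_smul, ← pow_add]
    conv_lhs => rw [← a.linearCombination_repr (a j * a k)]
    conv_rhs => rw [← a.linearCombination_repr (a j * a k)]
    rw [Finsupp.linearCombination_apply, Finsupp.sum, map_sum, Finset.smul_sum]
    refine Finset.sum_congr rfl fun i hi => ?_
    rw [map_smul, scale_basis, hg i j k (Finsupp.mem_support_iff.1 hi), smul_comm]
  have : (LinearMap.mul ℝ L).compr₂ (scale a deg) =
      (LinearMap.mul ℝ L).compl₁₂ (scale a deg) (scale a deg) :=
    a.ext fun j => a.ext fun k => key j k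
  exact LinearMap.congr_fun (LinearMap.congr_fun this x) y

lemma mapU_scale_odotProd (hg : IsGraded a deg) (m : Multiset ι) :
    mapU (scale a deg) hg.scale_mul (odotProd (m.map a)) =
      (2 : ℝ) ^ (m.map deg).sum • odotProd (m.map a) := by
  induction m using Multiset.induction_on with
  | empty => simp [odotProd]
  | cons i m ih =>
    rw [Multiset.map_cons, odotProd_cons, mapU_odot, ih, scale_basis, odot_smul, map_smul,
      smul_smul, Multiset.map_cons, Multiset.sum_cons, pow_add, mul_comm]

lemma sum_map_toMultiset (I : ι →₀ ℕ) :
    (I.toMultiset.map deg).sum = Finsupp.weight deg I := by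
  induction I using Finsupp.induction_linear with
  | zero => simp
  | add I J hI hJ => simp [hI, hJ]
  | single i n => simp [Finsupp.weight_single, Multiset.map_nsmul, Multiset.sum_nsmul]

lemma mapU_scale_goBasis (hg : IsGraded a deg) (I : ι →₀ ℕ) :
    mapU (scale a deg) hg.scale_mul (goBasis a I) =
      (2 : ℝ) ^ Finsupp.weight deg I • goBasis a I := by
  rw [goBasis_apply, goElem, map_smul, mapU_scale_odotProd hg, sum_map_toMultiset, smul_comm]

/-- The multiplication of `U(L)` is graded. -/
lemma IsGraded.weight_eq (hg : IsGraded a deg) {I J K : ι →₀ ℕ}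
    (h : (goBasis a).repr (goBasis a J * goBasis a K) I ≠ 0) :
    Finsupp.weight deg I = Finsupp.weight deg J + Finsupp.weight deg K := by
  -- The basis elements A_I are eigenvectors with eigenvalue 2 to the weight of I. Comparing the
  -- coefficient of A_I in A_J A_K before and after scaling gives the equality of weights, powers of
  -- 2 being distinct.
  have key : ∀ x, (goBasis a).repr (mapU (scale a deg) hg.scale_mul x) I =
      (2 : ℝ) ^ Finsupp.weight deg I * (goBasis a).repr x I := by
    have : (goBasis a).coord I ∘ₗ (mapU (scale a deg) hg.scale_mul).toLinearMap =
        (2 : ℝ) ^ Finsupp.weight deg I • (goBasis a).coord I := by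
      refine (goBasis a).ext fun J => ?_
      rw [LinearMap.comp_apply, AlgHom.toLinearMap_apply, mapU_scale_goBasis hg, map_smul,
        LinearMap.smul_apply, Module.Basis.coord_apply, Module.Basis.repr_self]
      by_cases hIJ : I = J
      · rw [hIJ]
      · simp [Finsupp.single_eq_of_ne hIJ]
    exact fun x => LinearMap.congr_fun this x
  have h1 := key (goBasis a J * goBasis a K)
  rw [map_mul, mapU_scale_goBasis hg, mapU_scale_goBasis hg, smul_mul_smul_comm, map_smul,
    Finsupp.smul_apply, smul_eq_mul, ← pow_add] at h1
  have h2 := mul_right_cancel₀ h h1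
  exact (pow_right_injective₀ (by norm_num : (0 : ℝ) < 2) (by norm_num) h2).symm

/-- The grading has finitely many basis elements in each degree and none in degree zero. -/
structure IsConnected (deg : ι → ℕ) : Prop where
  pos : ∀ i, deg i ≠ 0
  finite : ∀ n, {i | deg i ≤ n}.Finite

/-- All degrees are at least one, so a multi-index of weight at most n is supported on indices of
degree at most n and has entries at most n. It therefore lies below the bound B. -/
lemma IsConnected.finite_weight_le (hd : IsConnected deg) (n : ℕ) :
    {I : ι →₀ ℕ | Finsupp.weight deg I ≤ n}.Finite := by
  classical
  let B : ι →₀ ℕ := ∑ i ∈ (hd.finite n).toFinset, Finsupp.single i n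
  refine (Set.finite_Iic B).subset fun I hI i => ?_
  rw [Finsupp.finsetSum_apply]
  by_cases hi : I i = 0
  · rw [hi]; exact Nat.zero_le _
  · have h1 : deg i ≤ n := (Finsupp.le_weight_of_ne_zero' deg hi).trans hI
    have h2 : I i ≤ n := (Finsupp.le_weight deg (hd.pos i) I).trans hI
    refine h2.trans ?_
    rw [Finset.sum_eq_single i]
    · simp
    · intro j _ hj
      simp [hj]
    · intro h; exact absurd ((hd.finite n).mem_toFinset.2 h1) h

/-- This makes the `finsum` in `coprod` a genuine sum and not the default value 0: both factors of a
contributing product have weight at most that of I. -/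
lemma finite_coprod_support (hg : IsGraded a deg) (hd : IsConnected deg) (I : ι →₀ ℕ) :
    {J : (ι →₀ ℕ) × (ι →₀ ℕ) |
      (goBasis a).repr (goBasis a J.1 * goBasis a J.2) I ≠ 0}.Finite := by
  refine ((hd.finite_weight_le (Finsupp.weight deg I)).prod
    (hd.finite_weight_le (Finsupp.weight deg I))).subset fun J hJ => ?_
  have := hg.weight_eq hJ
  exact ⟨(by omega : Finsupp.weight deg J.1 ≤ Finsupp.weight deg I),
    (by omega : Finsupp.weight deg J.2 ≤ Finsupp.weight deg I)⟩

lemma coprod_monomial (I : ι →₀ ℕ) : coprod a (MvPolynomial.monomial I 1) =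
    ∑ᶠ J : (ι →₀ ℕ) × (ι →₀ ℕ), (goBasis a).repr (goBasis a J.1 * goBasis a J.2) I •
        (MvPolynomial.monomial J.1 (1 : ℝ) ⊗ₜ[ℝ] MvPolynomial.monomial J.2 (1 : ℝ)) := by
  have h : MvPolynomial.monomial I (1 : ℝ) = MvPolynomial.basisMonomials ι ℝ I := by
    rw [MvPolynomial.coe_basisMonomials]
  rw [h, coprod, Module.Basis.constr_basis]

lemma coprod_monomial_eq_sum (hg : IsGraded a deg) (hd : IsConnected deg) (I : ι →₀ ℕ) :
    coprod a (MvPolynomial.monomial I 1) = ∑ J ∈ (finite_coprod_support hg hd I).toFinset,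
      (goBasis a).repr (goBasis a J.1 * goBasis a J.2) I •
        (MvPolynomial.monomial J.1 (1 : ℝ) ⊗ₜ[ℝ] MvPolynomial.monomial J.2 (1 : ℝ)) := by
  rw [coprod_monomial]
  refine finsum_eq_sum_of_support_subset _ fun J hJ => ?_
  rw [Set.Finite.coe_toFinset]
  intro h0
  exact hJ (by simp only [h0, zero_smul])

lemma pairing_monomial_one (u : U L) (I : ι →₀ ℕ) :
    pairing a (fun _ => 1) u (MvPolynomial.monomial I 1) = (goBasis a).repr u I := by
  have : (pairing a fun _ => 1).flip (MvPolynomial.monomial I 1) = (goBasis a).coord I := by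
    classical
    refine (goBasis a).ext fun J => ?_
    rw [LinearMap.flip_apply, pairing_basis, Module.Basis.coord_apply, Module.Basis.repr_self]
    by_cases hIJ : J = I
    · simp [hIJ]
    · simp [hIJ, Finsupp.single_eq_of_ne (Ne.symm hIJ)]
  exact LinearMap.congr_fun this u

lemma isDual_coprod (hg : IsGraded a deg) (hd : IsConnected deg) :
    IsDual a (fun _ => 1) (coprod a) := by
  classical
  intro u v p
  induction p using MvPolynomial.induction_on' with
  | add p q hp hq => simp only [map_add, hp, hq]
  | monomial I r =>
    have hr : MvPolynomial.monomial I r = r • MvPolynomial.monomial I (1 : ℝ) := by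
      simp [MvPolynomial.smul_monomial]
    rw [hr, map_smul, map_smul, map_smul, map_smul]
    congr 1
    rw [coprod_monomial_eq_sum hg hd, pairing_monomial_one, map_sum, map_sum]
    simp only [map_smul, slice_tmul, pairing_monomial_one, smul_eq_mul]
    conv_rhs => rw [← (goBasis a).linearCombination_repr u, ← (goBasis a).linearCombination_repr v]
    rw [Finsupp.linearCombination_apply, Finsupp.linearCombination_apply, Finsupp.sum, Finsupp.sum,
      Finset.sum_mul_sum, ← Finset.sum_product', map_sum, Finsupp.finsetSum_apply]
    simp only [smul_mul_smul_comm, map_smul, Finsupp.smul_apply, smul_eq_mul]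
    set c := fun J : (ι →₀ ℕ) × (ι →₀ ℕ) => (goBasis a).repr (goBasis a J.1 * goBasis a J.2) I
    -- One side sums over the support of the coproduct, the other over the supports of u and v. Both
    -- finite sets contain the support of the common summand, so both sums equal the same `finsum`.
    have e : ∀ s : Finset ((ι →₀ ℕ) × (ι →₀ ℕ)), (∀ J,
        ((goBasis a).repr u J.1 * (goBasis a).repr v J.2) * c J ≠ 0 → J ∈ s) →
        ∑ J ∈ s, ((goBasis a).repr u J.1 * (goBasis a).repr v J.2) * c J =
          ∑ᶠ J, ((goBasis a).repr u J.1 * (goBasis a).repr v J.2) * c J := fun s hs =>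
      (finsum_eq_sum_of_support_subset _ fun J hJ => hs J hJ).symm
    rw [e]
    · rw [← e]
      · exact Finset.sum_congr rfl fun J _ => by ring
      · intro J hJ
        exact (Set.Finite.mem_toFinset _).2 (right_ne_zero_of_mul hJ)
    · intro J hJ
      have := left_ne_zero_of_mul hJ
      exact Finset.mem_product.2 ⟨Finsupp.mem_support_iff.2 (left_ne_zero_of_mul this),
        Finsupp.mem_support_iff.2 (right_ne_zero_of_mul this)⟩

/-- The filtration of the polynomial algebra by the degree. -/
def degFiltration (deg : ι → ℕ) (n : ℕ) : Submodule ℝ (MvPolynomial ι ℝ) :=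
  Submodule.span ℝ {p | ∃ I, Finsupp.weight deg I ≤ n ∧ p = MvPolynomial.monomial I 1}

lemma degFiltration_mono : Monotone (degFiltration deg) := fun _ _ h =>
  Submodule.span_mono fun _ ⟨I, hI, e⟩ => ⟨I, hI.trans h, e⟩

lemma exists_mem_degFiltration (p : MvPolynomial ι ℝ) : ∃ n, p ∈ degFiltration deg n := by
  induction p using MvPolynomial.induction_on' with
  | add p q hp hq =>
    obtain ⟨n, hn⟩ := hp
    obtain ⟨m, hm⟩ := hq
    exact ⟨max n m, Submodule.add_mem _ (degFiltration_mono (le_max_left _ _) hn)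
      (degFiltration_mono (le_max_right _ _) hm)⟩
  | monomial I r =>
    refine ⟨Finsupp.weight deg I, ?_⟩
    have hr : MvPolynomial.monomial I r = r • MvPolynomial.monomial I (1 : ℝ) := by
      simp [MvPolynomial.smul_monomial]
    rw [hr]
    exact Submodule.smul_mem _ _ (Submodule.subset_span ⟨I, le_rfl, rfl⟩)

lemma degFiltration_zero {ι : Type} {deg : ι → ℕ} (hd : IsConnected deg) (p : MvPolynomial ι ℝ)
    (hp : p ∈ degFiltration deg 0) : p = algebraMap ℝ _ (polyCounit ι p) := by
  induction hp using Submodule.span_induction with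
  | mem p hp =>
    obtain ⟨I, hI, rfl⟩ := hp
    have : I = 0 := by
      ext i
      by_contra h
      have := Finsupp.le_weight_of_ne_zero' deg h
      have := hd.pos i
      omega
    subst this
    simp [polyCounit]
  | zero => simp
  | add p q _ _ hp hq => rw [map_add, map_add, ← hp, ← hq]
  | smul r p _ hp => rw [map_smul, smul_eq_mul, map_mul, ← hp, Algebra.smul_def]

lemma isFiltered_coprod (hg : IsGraded a deg) (hd : IsConnected deg) :
    IsFiltered (degFiltration deg) (coprod a) := by
  intro n p hp
  induction hp using Submodule.span_induction with
  | mem p hp =>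
    obtain ⟨I, hI, rfl⟩ := hp
    rw [coprod_monomial_eq_sum hg hd]
    refine Submodule.sum_mem _ fun J hJ => Submodule.smul_mem _ _ (Submodule.subset_span ?_)
    have := hg.weight_eq ((Set.Finite.mem_toFinset _).1 hJ)
    exact ⟨_, _, by omega, _, Submodule.subset_span ⟨J.1, le_rfl, rfl⟩, _,
      Submodule.subset_span ⟨J.2, le_rfl, rfl⟩, rfl⟩
  | zero => simp
  | add p q _ _ hp hq => rw [map_add]; exact Submodule.add_mem _ hp hq
  | smul r p _ hp => rw [map_smul]; exact Submodule.smul_mem _ _ hp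

/-- The adjoint of left multiplication by a_j sends X_i to the affine polynomial whose coefficients
are the i-th coordinates of a_j and of the a_j ▷ a_k. The grading forces deg k ≤ deg i, so finitely
many k suffice. -/
lemma exists_isLeftAdjoint (hg : IsGraded a deg) (hd : IsConnected deg) (b : L) :
    ∃ R, IsLeftAdjoint a (fun _ => 1) b R := by
  classical
  -- No condition beyond adjointness is wanted here, so the extra predicate is trivial.
  suffices h : ∃ R, IsLeftAdjoint a (fun _ => 1) b R ∧ True from h.imp fun _ h => h.1
  refine IsLeftAdjoint.exists_of_basis trivial (fun _ _ _ _ => trivial) (fun _ _ _ => trivial)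
    (fun j => ?_) b
  refine ⟨MvPolynomial.mkDerivation ℝ fun i => MvPolynomial.C (a.repr (a j) i) +
    ∑ k ∈ (hd.finite (deg i)).toFinset, a.repr (a j * a k) i • MvPolynomial.X k,
    ⟨fun i => ?_, fun i k => ?_⟩, trivial⟩
  · simp [MvPolynomial.mkDerivation_X]
  · simp only [MvPolynomial.mkDerivation_X, map_add, MvPolynomial.pderiv_C, zero_add, map_sum,
      Derivation.map_smul, MvPolynomial.pderiv_X, one_smul, mul_one]
    by_cases h : a.repr (a j * a k) i = 0
    · rw [Finset.sum_eq_zero]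
      · simp [h]
      · intro l _
        by_cases hl : l = k
        · subst hl; simp [h]
        · simp [hl]
    · rw [Finset.sum_eq_single k]
      · simp [MvPolynomial.smul_eq_C_mul]
      · intro l _ hl
        simp [hl]
      · intro h'
        have hk : deg k ≤ deg i := by have := hg i j k h; omega
        exact absurd ((hd.finite (deg i)).mem_toFinset.2 hk) h'

/-- The coproduct dual to the product of `U(L)`, for a connected graded pre-Lie algebra `L`, is
the coproduct of a Hopf algebra. -/
theorem exists_isHopf_coprod {ι : Type} {a : Module.Basis ι ℝ L} {deg : ι → ℕ}
    (hg : IsGraded a deg) (hd : IsConnected deg) : ∃ S, IsHopf (coprod a) (polyCounit ι) S := by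
  have h := isDual_coprod hg hd
  have hw : ∀ i : ι, (fun _ : ι => (1 : ℝ)) i ≠ 0 := fun _ => one_ne_zero
  have hε : polyCounit ι = pairing a (fun _ => 1) 1 := polyCounit_eq
  obtain ⟨S, hl, hr⟩ := exists_antipode (h.coassoc hw) (hε ▸ h.rTensor_counit hw)
    (hε ▸ h.lTensor_counit hw) degFiltration_mono exists_mem_degFiltration
    (degFiltration_zero hd) (isFiltered_coprod hg hd)
  exact ⟨S,
    { coassoc := h.coassoc hw
      rTensor_counit := hε ▸ h.rTensor_counit hw
      lTensor_counit := hε ▸ h.lTensor_counit hw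
      counit_one := by simp [polyCounit]
      counit_mul := by simp [polyCounit]
      comul_one := h.comul_one hw
      comul_mul := h.comul_mul hw (exists_isLeftAdjoint hg hd)
      antipode_left := hl
      antipode_right := hr }⟩

end Grading

end GuinOudom
end

/-! ### The grading of T_{≥2}. -/

noncomputable section

namespace MultiIndex

open GuinOudom

/-- The degree `|β| - 1` of a populated multi-index. -/
def degPop (β : PopTwo) : ℕ := length β.1 - 1

lemma zBasis_repr_apply (x : TTwo) (β : PopTwo) : zBasis.repr x β = MvPolynomial.coeff β.1 x.1 :=
  rfl

lemma monomial_homogeneous (β : PopTwo) : (MvPolynomial.monomial β.1 (1 : ℝ)).IsWeightedHomogeneous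
    wt (1, (length β.1 : ℤ)) :=
  MvPolynomial.isWeightedHomogeneous_monomial _ _ _ (by rw [weight_wt, β.2.1])

/-- The product ▷ replaces one variable of the right factor by a D-derivative of the left factor,
and D preserves length. Lengths therefore add up to one more than the length of the result, and |β|
- 1 is additive. -/
lemma isGraded_zBasis : IsGraded zBasis degPop := by
  intro i j k h
  rw [zBasis_repr_apply] at h
  have e : (zBasis j * zBasis k : TTwo).1 = shift (zBasis j : MvPolynomial ℕ ℝ) (zBasis k).1 := rfl
  rw [e, zBasis_apply, zBasis_apply] at h
  have h' := shift_homogeneous (monomial_homogeneous j) (monomial_homogeneous k) h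
  rw [weight_wt, Prod.mk.injEq] at h'
  have h1 := j.2.2
  have h2 := k.2.2
  have h3 := h'.2
  simp only [degPop]
  omega

/-- For populated multi-indices the length controls not only the entries β(k) but also the indices k
in the support, which gives finiteness below each length. -/
lemma length_eq_add (β : ℕ →₀ ℕ) (h : bracket β = 1) :
    (length β : ℤ) = 1 + β.sum fun k n => (k : ℤ) * n := by
  rw [← h, bracket, length, Finsupp.sum, Finsupp.sum, Finsupp.sum, ← Finset.sum_add_distrib]
  push_cast
  exact Finset.sum_congr rfl fun k _ => by ring

lemma finite_length_le (n : ℕ) : {β : ℕ →₀ ℕ | bracket β = 1 ∧ length β ≤ n}.Finite := by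
  let B : ℕ →₀ ℕ := ∑ i ∈ Finset.range n, Finsupp.single i n
  refine (Set.finite_Iic B).subset fun β ⟨hβ, hl⟩ k => ?_
  rw [Finsupp.finsetSum_apply]
  by_cases hk : β k = 0
  · rw [hk]; exact Nat.zero_le _
  have hmem := Finsupp.mem_support_iff.2 hk
  have h1 : β k ≤ length β := Finset.single_le_sum (f := fun k => β k)
    (fun _ _ => Nat.zero_le _) hmem
  have h2 : (k : ℤ) * β k ≤ β.sum fun k n => (k : ℤ) * n :=
    Finset.single_le_sum (f := fun k : ℕ => (k : ℤ) * (β k : ℤ)) (fun _ _ => by positivity) hmem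
  have h3 := length_eq_add β hβ
  have h4 : (k : ℤ) ≤ (k : ℤ) * (β k : ℤ) :=
    le_mul_of_one_le_right (by positivity) (by omega)
  have hkn : k < n := by omega
  refine (h1.trans hl).trans (le_of_eq ?_)
  rw [Finset.sum_eq_single k]
  · simp
  · intro j _ hj; simp [hj]
  · intro h; exact absurd (Finset.mem_range.2 hkn) h

lemma isConnected_degPop : IsConnected degPop where
  pos β := by have := β.2.2; simp only [degPop]; omega
  finite n := by
    refine Set.Finite.of_finite_image (f := Subtype.val)
      ((finite_length_le (n + 1)).subset ?_) Subtype.val_injective.injOn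
    rintro _ ⟨β, hβ, rfl⟩
    have : length β.1 - 1 ≤ n := hβ
    exact ⟨β.2.1, by omega⟩

end MultiIndex

end

/-! ### Ψ is a pre-Lie morphism. -/

noncomputable section

namespace RTree

open MultiIndex Polynomial

/-- The weight `∏ k!` of the multi-index `β`, times the monomial `z^β`. -/
def monoSym (β : ℕ →₀ ℕ) : MvPolynomial ℕ ℝ :=
  (β.prod fun k n => (k.factorial : ℝ) ^ n) • MvPolynomial.monomial β 1

lemma monoSym_add (β γ : ℕ →₀ ℕ) : monoSym (β + γ) = monoSym β * monoSym γ := by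
  rw [monoSym, monoSym, monoSym, Finsupp.prod_add_index' (by simp) (fun _ _ _ => pow_add _ _ _),
    smul_mul_smul_comm, MvPolynomial.monomial_mul, one_mul]

lemma monoSym_single (k : ℕ) :
    monoSym (Finsupp.single k 1) = (k.factorial : ℝ) • MvPolynomial.X k := by
  simp [monoSym, MvPolynomial.X]

/-- The linear extension of `τ ↦ σ(β_τ) z^{β_τ}` to all trees. -/
def psiSpan : Span →ₗ[ℝ] MvPolynomial ℕ ℝ := Finsupp.lift _ ℝ RTree fun t => monoSym (fertility t)

/-- The contribution to `psiSpan` of the vertices other than the root, multiplied by the power of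
the indeterminate that counts the branches at the root. -/
def psiRoot : Span →ₗ[ℝ] (MvPolynomial ℕ ℝ)[X] :=
  Finsupp.lift _ ℝ RTree fun t => monomial (arity t) (monoSym (fertilityNonRoot t))

@[simp] lemma psiSpan_single (t : RTree) :
    psiSpan (Finsupp.single t 1) = monoSym (fertility t) := by simp [psiSpan]

@[simp] lemma psiRoot_single (t : RTree) : psiRoot (Finsupp.single t 1) =
    monomial (arity t) (monoSym (fertilityNonRoot t)) := by simp [psiRoot]

/-- Substitution of `v k` for the power `X ^ k`, linearly over the coefficients. -/
def substPow (v : ℕ → MvPolynomial ℕ ℝ) : (MvPolynomial ℕ ℝ)[X] →ₗ[ℝ] MvPolynomial ℕ ℝ :=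
  Polynomial.lsum fun k => LinearMap.mulRight ℝ (v k)

@[simp] lemma substPow_monomial (v : ℕ → MvPolynomial ℕ ℝ) (k : ℕ) (c : MvPolynomial ℕ ℝ) :
    substPow v (monomial k c) = c * v k := by
  simp [substPow, Polynomial.lsum_apply]

/-- Application of a derivation to the coefficients of a polynomial. -/
def coeffMap (E : Derivation ℝ (MvPolynomial ℕ ℝ) (MvPolynomial ℕ ℝ)) :
    (MvPolynomial ℕ ℝ)[X] →ₗ[ℝ] (MvPolynomial ℕ ℝ)[X] :=
  Polynomial.lsum fun k => (monomial k).restrictScalars ℝ ∘ₗ E.toLinearMap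

@[simp] lemma coeffMap_monomial (E : Derivation ℝ (MvPolynomial ℕ ℝ) (MvPolynomial ℕ ℝ)) (k : ℕ)
    (c : MvPolynomial ℕ ℝ) : coeffMap E (monomial k c) = monomial k (E c) := by
  simp [coeffMap, Polynomial.lsum_apply]

lemma coeffMap_X_mul_C_mul (E : Derivation ℝ (MvPolynomial ℕ ℝ) (MvPolynomial ℕ ℝ))
    (f : MvPolynomial ℕ ℝ) (P : (MvPolynomial ℕ ℝ)[X]) :
    coeffMap E (X * C f * P) = X * C (E f) * P + X * C f * coeffMap E P := by
  induction P using Polynomial.induction_on' with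
  | add P Q hP hQ => rw [mul_add, map_add, hP, hQ, map_add]; ring
  | monomial k c =>
    have h : ∀ f c : MvPolynomial ℕ ℝ, X * C f * monomial k c = monomial (k + 1) (f * c) := by
      intro f c
      rw [mul_assoc, C_mul_monomial, X_mul_monomial]
    rw [h, coeffMap_monomial, coeffMap_monomial, h, h, Derivation.leibniz, ← map_add]
    congr 1
    simp only [smul_eq_mul]
    ring

/-- The map `psiSpan` alone is not multiplicative under grafting, which changes the fertility of the
root. Recording the root by a power of X removes this obstruction. -/
lemma psiRoot_graftL (a b : Span) : psiRoot (graftL a b) = X * C (psiSpan a) * psiRoot b := by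
  have : graftL.compr₂ psiRoot = (LinearMap.mul ℝ (MvPolynomial ℕ ℝ)[X]).compl₁₂
      ((LinearMap.mulLeft ℝ X) ∘ₗ ((CAlgHom (R := ℝ) (A := MvPolynomial ℕ ℝ)).toLinearMap ∘ₗ psiSpan))
      psiRoot := by
    refine span_ext fun t => span_ext fun s => ?_
    have e : fertilityNonRoot (graft t s) = fertility t + fertilityNonRoot s := by
      simp [fertilityNonRoot, fertility]
    simp only [LinearMap.compr₂_apply, graftL_single, psiRoot_single, LinearMap.compl₁₂_apply,
      LinearMap.comp_apply, psiSpan_single, LinearMap.mulLeft_apply, LinearMap.mul_apply',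
      AlgHom.toLinearMap_apply, CAlgHom_apply, e, monoSym_add]
    rw [mul_assoc, C_mul_monomial, X_mul_monomial]
    simp [arity]
  exact LinearMap.congr_fun (LinearMap.congr_fun this a) b

lemma psiSpan_eq (a : Span) :
    psiSpan a = substPow (fun k => (k.factorial : ℝ) • MvPolynomial.X k) (psiRoot a) := by
  have : psiSpan = substPow (fun k => (k.factorial : ℝ) • MvPolynomial.X k) ∘ₗ psiRoot := by
    refine span_ext fun t => ?_
    rw [LinearMap.comp_apply, psiSpan_single, psiRoot_single, substPow_monomial, fertility,
      monoSym_add, monoSym_single, mul_comm]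
  exact LinearMap.congr_fun this a

section

variable {Φ : Span →ₗ[ℝ] Span} {E : Derivation ℝ (MvPolynomial ℕ ℝ) (MvPolynomial ℕ ℝ)}

/-- The hypothesis compares the two sides at the root alone. A modification away from the root takes
place at some vertex of one of the branches, so by induction over the branches it becomes E acting
on the coefficients, with X untouched. -/
lemma psiRoot_nonRoot
    (h : ∀ t : RTree, psiSpan (Φ (Finsupp.single t 1)) +
      substPow (fun k => (k.factorial : ℝ) • MvPolynomial.X k)
        (coeffMap E (psiRoot (Finsupp.single t 1))) = E (psiSpan (Finsupp.single t 1))) (a : Span) :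
    psiRoot (nonRoot Φ a) = coeffMap E (psiRoot a) := by
  have : psiRoot ∘ₗ nonRoot Φ = coeffMap E ∘ₗ psiRoot := by
    refine span_ext fun t => ?_
    simp only [LinearMap.comp_apply]
    induction t using ind with
    | hl => simp [fertilityNonRoot, monoSym]
    | hg t s ht hs =>
      have ht' : psiSpan (atVertices Φ (Finsupp.single t 1)) = E (psiSpan (Finsupp.single t 1)) := by
        rw [← h, atVertices, LinearMap.add_apply, map_add, psiSpan_eq (nonRoot _ _), ht]
      rw [← graftL_single, nonRoot_graftL, map_add, psiRoot_graftL, psiRoot_graftL, psiRoot_graftL,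
        coeffMap_X_mul_C_mul, ht', hs]
  exact LinearMap.congr_fun this a

lemma psiSpan_atVertices
    (h : ∀ t : RTree, psiSpan (Φ (Finsupp.single t 1)) +
      substPow (fun k => (k.factorial : ℝ) • MvPolynomial.X k)
        (coeffMap E (psiRoot (Finsupp.single t 1))) = E (psiSpan (Finsupp.single t 1))) (a : Span) :
    psiSpan (atVertices Φ a) = E (psiSpan a) := by
  have : psiSpan ∘ₗ atVertices Φ = E.toLinearMap ∘ₗ psiSpan := by
    refine span_ext fun t => ?_
    rw [LinearMap.comp_apply, atVertices, LinearMap.add_apply, map_add, psiSpan_eq (nonRoot _ _),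
      psiRoot_nonRoot h, h]
    rfl
  exact LinearMap.congr_fun this a

end

/-- Adding a child to a vertex of fertility k: this is why Ψ carries the factor σ(β). -/
lemma D_smul_X (k : ℕ) : D ((k.factorial : ℝ) • MvPolynomial.X k) =
    ((k + 1).factorial : ℝ) • MvPolynomial.X (k + 1) := by
  rw [Derivation.map_smul, D, MvPolynomial.mkDerivation_X, smul_smul, Nat.factorial_succ]
  push_cast
  rw [mul_comm]

lemma psiSpan_graftL_aux (x : Span) (t : RTree) : psiSpan (graftL x (Finsupp.single t 1)) +
    substPow (fun k => (k.factorial : ℝ) • MvPolynomial.X k)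
      (coeffMap (psiSpan x • D) (psiRoot (Finsupp.single t 1))) =
      (psiSpan x • D) (psiSpan (Finsupp.single t 1)) := by
  rw [psiSpan_eq (graftL _ _), psiRoot_graftL, psiSpan_eq (Finsupp.single t 1), psiRoot_single,
    coeffMap_monomial, substPow_monomial, substPow_monomial, mul_assoc, C_mul_monomial,
    X_mul_monomial, substPow_monomial, Derivation.smul_apply, Derivation.smul_apply,
    Derivation.leibniz, D_smul_X]
  simp only [smul_eq_mul]
  ring

/-- Grafting x on each vertex raises one fertility by one and contributes the factor Ψ(x). -/
lemma psiSpan_atVertices_graftL (x a : Span) :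
    psiSpan (atVertices (graftL x) a) = psiSpan x * D (psiSpan a) :=
  psiSpan_atVertices (psiSpan_graftL_aux x) a

lemma psiRoot_nonRoot_graftL (x a : Span) :
    psiRoot (nonRoot (graftL x) a) = coeffMap (psiSpan x • D) (psiRoot a) :=
  psiRoot_nonRoot (psiSpan_graftL_aux x) a

/-- Each of the k root branches of y attaches to some vertex of a, contributing its own image and
one application of D to Ψ(a). The induction is on the number of branches, over linear combinations,
because `nonRoot` of a tree is a combination of trees with the same root arity. -/
lemma psiSpan_simGraft_aux (a : Span) (n : ℕ) {y : Span} (hy : y ∈ aritySpan n) :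
    psiSpan (simGraftL a y) = substPow
      (fun k => (D.toLinearMap ^ k : Module.End ℝ (MvPolynomial ℕ ℝ)) (psiSpan a)) (psiRoot y) := by
  induction n generalizing y with
  | zero =>
    refine aritySpan_induction (k := 0) (f := psiSpan ∘ₗ simGraftL a) (g := substPow _ ∘ₗ psiRoot)
      (fun t ht => ?_) hy
    obtain rfl | ⟨s, r, rfl⟩ := exists_eq_graft t
    · simp [simGraftL_leaf, arity, fertilityNonRoot, monoSym,
        -Polynomial.monomial_zero_left]
    · simp [arity] at ht
  | succ n ih =>
    refine aritySpan_induction (k := n + 1) (f := psiSpan ∘ₗ simGraftL a)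
      (g := substPow _ ∘ₗ psiRoot) (fun t ht => ?_) hy
    obtain rfl | ⟨x, s, rfl⟩ := exists_eq_graft t
    · simp [arity] at ht
    have hs : arity s = n := by simpa [arity] using ht
    -- Grafting x anywhere after the branches of s have been grafted on a puts x either on a vertex
    -- of a or inside a branch of s. Subtracting the second case expresses the simultaneous grafting
    -- of one more branch.
    have h := simGraftL_comm (Finsupp.single x 1) a (Finsupp.single s 1)
    rw [show atVertices (graftL (Finsupp.single x 1)) (Finsupp.single s 1) =
      graftL (Finsupp.single x 1) (Finsupp.single s 1) +
        nonRoot (graftL (Finsupp.single x 1)) (Finsupp.single s 1) from rfl,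
      map_add, ← sub_eq_iff_eq_add] at h
    simp only [LinearMap.comp_apply]
    rw [← graftL_single, ← h, map_sub, psiSpan_atVertices_graftL,
      ih (hs ▸ single_mem_aritySpan s), ih (hs ▸ nonRoot_mem_aritySpan _ s), psiRoot_nonRoot_graftL,
      psiRoot_graftL, psiRoot_single, coeffMap_monomial, substPow_monomial, substPow_monomial,
      mul_assoc, C_mul_monomial, X_mul_monomial, substPow_monomial, Derivation.smul_apply,
      Derivation.leibniz, pow_succ', Module.End.mul_apply, Derivation.coeFn_coe]
    simp only [smul_eq_mul]
    ring

lemma psiSpan_simGraftL (a y : Span) : psiSpan (simGraftL a y) = substPow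
    (fun k => (D.toLinearMap ^ k : Module.End ℝ (MvPolynomial ℕ ℝ)) (psiSpan a)) (psiRoot y) := by
  have : psiSpan ∘ₗ simGraftL a = substPow
      (fun k => (D.toLinearMap ^ k : Module.End ℝ (MvPolynomial ℕ ℝ)) (psiSpan a)) ∘ₗ psiRoot :=
    span_ext fun t => psiSpan_simGraft_aux a _ (single_mem_aritySpan t)
  exact LinearMap.congr_fun this y

/-- The derivation Ψ(a) ▷ sends k! z_k to D^k Ψ(a), which is exactly the effect of replacing a
vertex with k children by a. The factorial cancels the 1/k! of ▷. -/
lemma psiSpan_insert (a b : Span) : psiSpan (insert a b) = shift (psiSpan a) (psiSpan b) := by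
  rw [insert_eq]
  refine psiSpan_atVertices (fun t => ?_) b
  rw [psiSpan_simGraftL, psiSpan_eq (Finsupp.single t 1), psiRoot_single, coeffMap_monomial,
    substPow_monomial, substPow_monomial, substPow_monomial, Derivation.leibniz,
    Derivation.map_smul, shift_X, smul_smul, mul_inv_cancel₀ (by positivity), one_smul]
  simp only [smul_eq_mul]
  ring

lemma psi_coe (a : BTwo) : (psi a : MvPolynomial ℕ ℝ) = psiSpan a := by
  have : TTwo.subtype ∘ₗ psi = psiSpan ∘ₗ BTwo.subtype := by
    refine treeBasis.ext fun t => ?_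
    simp only [LinearMap.comp_apply, Submodule.subtype_apply, psi, Module.Basis.constr_basis,
      Submodule.coe_smul, zBasis_apply, treeBasis_apply, psiSpan_single]
    rfl
  exact LinearMap.congr_fun this a

lemma psi_mul (a b : BTwo) : psi (a * b) = psi a * psi b := by
  refine Subtype.ext ?_
  rw [psi_coe]
  change psiSpan (insert a.1 b.1) = shift (psi a).1 (psi b).1
  rw [psiSpan_insert, psi_coe, psi_coe]

end RTree
end

/-! ### Combinatorics of root subtrees and spanning subforests. -/

noncomputable section

namespace RTree

section Sum

variable {α β M N : Type*} [AddCommMonoid M] [AddCommMonoid N]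

/-- The sum of `f` over a multiset. -/
def msum (m : Multiset α) (f : α → M) : M := (m.map f).sum

@[simp] lemma msum_zero (f : α → M) : msum 0 f = 0 := rfl
@[simp] lemma msum_singleton (x : α) (f : α → M) : msum {x} f = f x := by simp [msum]
@[simp] lemma msum_cons (x : α) (m : Multiset α) (f : α → M) :
    msum (x ::ₘ m) f = f x + msum m f := by simp [msum]
@[simp] lemma msum_union (m n : Multiset α) (f : α → M) :
    msum (m + n) f = msum m f + msum n f := by simp [msum]
@[simp] lemma msum_map (m : Multiset β) (g : β → α) (f : α → M) :
    msum (m.map g) f = msum m fun x => f (g x) := by simp [msum]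
@[simp] lemma msum_bind (m : Multiset β) (g : β → Multiset α) (f : α → M) :
    msum (m.bind g) f = msum m fun x => msum (g x) f := by simp [msum, Multiset.map_bind]

lemma msum_add (m : Multiset α) (f g : α → M) :
    (msum m fun x => f x + g x) = msum m f + msum m g := Multiset.sum_map_add

lemma msum_comm (m : Multiset α) (n : Multiset β) (f : α → β → M) :
    (msum m fun x => msum n fun y => f x y) = msum n fun y => msum m fun x => f x y :=
  Multiset.sum_map_sum_map m n

lemma msum_congr {m : Multiset α} {f g : α → M} (h : ∀ x ∈ m, f x = g x) : msum m f = msum m g := by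
  rw [msum, msum, Multiset.map_congr rfl h]

lemma map_msum {F : Type*} [FunLike F M N] [AddMonoidHomClass F M N] (φ : F) (m : Multiset α)
    (f : α → M) : φ (msum m f) = msum m fun x => φ (f x) := by
  rw [msum, map_multiset_sum, Multiset.map_map]; rfl

lemma msum_eq_zero {m : Multiset α} {f : α → M} (h : ∀ x ∈ m, f x = 0) : msum m f = 0 := by
  rw [msum_congr h]; simp [msum]

end Sum

lemma linearMap_msum_apply {α M N : Type*} [AddCommGroup M] [Module ℝ M] [AddCommGroup N]
    [Module ℝ N] (m : Multiset α) (f : α → M →ₗ[ℝ] N) (x : M) :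
    (msum m f) x = msum m fun y => f y x :=
  map_msum (LinearMap.applyₗ x) m f

lemma mul_msum {α A : Type*} [NonUnitalNonAssocSemiring A] (r : A) (m : Multiset α) (f : α → A) :
    r * msum m f = msum m fun y => r * f y := (Multiset.sum_map_mul_left).symm

lemma smul_msum {α M : Type*} [AddCommGroup M] [Module ℝ M] (r : ℝ) (m : Multiset α) (f : α → M) :
    r • msum m f = msum m fun y => r • f y := Multiset.smul_sum.trans (by rw [Multiset.map_map]; rfl)

lemma msum_smul {α M : Type*} [AddCommGroup M] [Module ℝ M] (m : Multiset α) (f : α → ℝ) (x : M) :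
    msum m f • x = msum m fun y => f y • x :=
  map_msum (LinearMap.toSpanSingleton ℝ M x) m f

/-- The pairs of a branch at the root and of the tree that remains when it is removed. -/
def prune : RTree → Multiset (RTree × RTree) :=
  recur 0 (fun t _ s m => (t, s) ::ₘ m.map fun x => (x.1, graft t x.2))
    fun t _ t' _ s m => by
      simp only [Multiset.map_cons, Multiset.map_map, Function.comp_def, graft_swap t t']
      exact Multiset.cons_swap _ _ _

@[simp] lemma prune_leaf : prune leaf = 0 := rfl
@[simp] lemma prune_graft (t s : RTree) :
    prune (graft t s) = (t, s) ::ₘ (prune s).map fun x => (x.1, graft t x.2) := by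
  simp [prune]

/-- The pairs `(s, t / s)` for the subtrees `s` of `t` that contain the root. -/
def rootSub : RTree → Multiset (RTree × RTree) :=
  recur {(leaf, leaf)} (fun t A _ B =>
      (A.bind fun x => B.map fun y => (graft x.1 y.1, merge x.2 y.2)) +
        B.map fun y => (y.1, graft t y.2))
    fun t A t' A' _ B => by
      have e : (A.bind fun x => A'.bind fun x' => B.map fun y =>
          (graft x.1 (graft x'.1 y.1), merge x.2 (merge x'.2 y.2))) =
          A'.bind fun x' => A.bind fun x => B.map fun y =>
            (graft x'.1 (graft x.1 y.1), merge x'.2 (merge x.2 y.2)) := by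
        rw [Multiset.bind_bind]
        refine Multiset.bind_congr fun x' _ => Multiset.bind_congr fun x _ =>
          Multiset.map_congr rfl fun y _ => ?_
        rw [graft_swap, merge_left_comm]
      simp only [Multiset.map_add, Multiset.map_map, Multiset.bind_add, Multiset.map_bind,
        Function.comp_def, merge_graft_right, graft_swap t t', e]
      abel

@[simp] lemma rootSub_leaf : rootSub leaf = {(leaf, leaf)} := rfl
@[simp] lemma rootSub_graft (t s : RTree) : rootSub (graft t s) =
    ((rootSub t).bind fun x => (rootSub s).map fun y => (graft x.1 y.1, merge x.2 y.2)) +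
      (rootSub s).map fun y => (y.1, graft t y.2) := by
  simp [rootSub]

@[simp] lemma subForests_leaf : subForests leaf = {⟨leaf, 0, leaf⟩} := rfl
@[simp] lemma subForests_graft (t s : RTree) : subForests (graft t s) =
    (subForests t).bind fun f => (subForests s).bind fun g => {f.keep g, f.cut g} := by
  simp [subForests]

section

variable {M : Type*} [AddCommMonoid M]

lemma msum_subForests_graft (t s : RTree) (φ : SubForest → M) :
    msum (subForests (graft t s)) φ = msum (subForests t) fun f => msum (subForests s) fun g =>
      φ (f.keep g) + φ (f.cut g) := by
  simp [msum_add]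

lemma merge_assoc (t s r : RTree) : merge (merge t s) r = merge t (merge s r) := by
  induction t using ind with
  | hl => rfl
  | hg x t _ h => simp [h]

lemma msum_prune_merge (t s : RTree) (φ : RTree × RTree → M) :
    msum (prune (merge t s)) φ = (msum (prune t) fun x => φ (x.1, merge x.2 s)) +
      msum (prune s) fun x => φ (x.1, merge t x.2) := by
  induction t using ind generalizing φ with
  | hl => simp
  | hg x t _ h => simp [h, add_assoc]

/-- Merging the roots takes the disjoint union of the edge sets, so subforests correspond to pairs;
only the two root components are joined. -/
lemma msum_subForests_merge (t s : RTree) (φ : SubForest → M) :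
    msum (subForests (merge t s)) φ = msum (subForests t) fun f => msum (subForests s) fun g =>
      φ ⟨merge f.root g.root, f.others + g.others, merge f.quotient g.quotient⟩ := by
  induction t using ind generalizing φ with
  | hl => simp
  | hg x t _ h =>
    rw [merge_graft, msum_subForests_graft, msum_subForests_graft]
    refine msum_congr fun f _ => ?_
    rw [h]
    refine msum_congr fun g _ => ?_
    rw [← msum_add]
    refine msum_congr fun k _ => ?_
    simp [SubForest.keep, SubForest.cut, add_assoc, merge_assoc]

/-- Coassociativity of the extraction of a subtree at the root and of the removal of a branch. -/
lemma msum_prune_rootSub (t : RTree) (F : RTree → RTree → RTree → M) :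
    (msum (rootSub t) fun x => msum (prune x.1) fun u => F u.1 u.2 x.2) =
      msum (prune t) fun x => msum (rootSub x.1) fun p => msum (rootSub x.2) fun q =>
        F p.1 q.1 (merge p.2 q.2) := by
  induction t using ind generalizing F with
  | hl => simp
  | hg t s _ hs =>
    simp only [rootSub_graft, prune_graft, msum_union, msum_bind, msum_map, msum_cons, msum_add,
      merge_graft_right]
    rw [add_assoc]
    congr 1
    have h1 : ∀ x : RTree × RTree, _ := fun x => hs fun a b c => F a (graft x.1 b) (merge x.2 c)
    simp only [h1]
    rw [hs fun a b c => F a b (graft t c)]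
    congr 1
    rw [msum_comm]
    refine msum_congr fun g _ => ?_
    rw [msum_comm]
    refine msum_congr fun p _ => msum_congr fun x _ => msum_congr fun q _ => ?_
    rw [merge_left_comm]

/-- Coassociativity of the extraction of a subtree at the root and of a spanning subforest. -/
lemma msum_subForests_rootSub (t : RTree) (F : RTree → SubForest → M) :
    (msum (rootSub t) fun x => msum (subForests x.2) fun h => F x.1 h) =
      msum (subForests t) fun f => msum (rootSub f.root) fun y =>
        F y.1 ⟨y.2, f.others, f.quotient⟩ := by
  induction t using ind generalizing F with
  | hl => simp
  | hg t s ht hs =>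
    -- The case in which the new edge belongs to the extracted root subtree.
    have e1 : (msum (rootSub t) fun x => msum (rootSub s) fun y => msum (subForests (merge x.2 y.2))
        fun h => F (graft x.1 y.1) h) =
        msum (subForests t) fun f => msum (subForests s) fun g => msum (rootSub f.root) fun x =>
          msum (rootSub g.root) fun y => F (graft x.1 y.1)
            ⟨merge x.2 y.2, f.others + g.others, merge f.quotient g.quotient⟩ := by
      simp only [msum_subForests_merge]
      have h1 : ∀ x : RTree × RTree, (msum (rootSub s) fun y => msum (subForests x.2) fun f =>
          msum (subForests y.2) fun g => F (graft x.1 y.1) ⟨merge f.root g.root,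
            f.others + g.others, merge f.quotient g.quotient⟩) =
          msum (subForests x.2) fun f => msum (subForests s) fun g => msum (rootSub g.root) fun y =>
            F (graft x.1 y.1) ⟨merge f.root y.2,
            f.others + g.others, merge f.quotient g.quotient⟩ := fun x => by
        rw [msum_comm]
        exact msum_congr fun f _ => hs fun a g => F (graft x.1 a) ⟨merge f.root g.root,
            f.others + g.others, merge f.quotient g.quotient⟩
      simp only [h1]
      rw [ht fun a f => msum (subForests s) fun g => msum (rootSub g.root) fun y =>
            F (graft a y.1) ⟨merge f.root y.2,
            f.others + g.others, merge f.quotient g.quotient⟩]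
      exact msum_congr fun f _ => msum_comm _ _ _
    -- The case in which the extraction leaves the new edge in the quotient, where the subforest may
    -- keep it or cut it.
    have e2 : (msum (rootSub s) fun y => msum (subForests (graft t y.2)) fun h => F y.1 h) =
        msum (subForests t) fun f => msum (subForests s) fun g => msum (rootSub g.root) fun y =>
          F y.1 (f.keep ⟨y.2, g.others, g.quotient⟩) + F y.1 (f.cut ⟨y.2, g.others, g.quotient⟩) := by
      simp only [msum_subForests_graft]
      rw [msum_comm]
      exact msum_congr fun f _ => hs fun a g => F a (f.keep g) + F a (f.cut g)
    simp only [rootSub_graft, msum_union, msum_bind, msum_map]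
    rw [e1, e2, msum_subForests_graft, ← msum_add]
    refine msum_congr fun f _ => ?_
    rw [← msum_add]
    refine msum_congr fun g _ => ?_
    simp only [SubForest.keep, SubForest.cut, rootSub_graft, msum_union, msum_bind, msum_map,
      msum_add, add_assoc]

end

end RTree
end

/-! ### The symmetry-factor form and the adjoint of insertion. -/

noncomputable section

namespace RTree

lemma multisetFactorial_cons (x : RTree) (m : Multiset RTree) [DecidableEq RTree] :
    multisetFactorial (x ::ₘ m) = (m.count x + 1) * multisetFactorial m := by
  rename_i inst
  -- The definition of `multisetFactorial` uses the classical instance; the given one is identified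
  -- with it.
  have hd : inst = fun a b => Classical.propDecidable (a = b) := Subsingleton.elim _ _
  subst hd
  classical
  have h1 : multisetFactorial m = ∏ t ∈ (x ::ₘ m).toFinset, (m.count t).factorial := by
    rw [multisetFactorial]
    refine Finset.prod_subset (fun t ht => ?_) fun t _ ht => ?_
    · rw [Multiset.mem_toFinset] at ht ⊢
      exact Multiset.mem_cons_of_mem ht
    · rw [Multiset.mem_toFinset] at ht
      rw [Multiset.count_eq_zero_of_notMem ht, Nat.factorial_zero]
  have hx : x ∈ (x ::ₘ m).toFinset := by simp
  rw [h1, multisetFactorial, ← Finset.mul_prod_erase _ _ hx, ← Finset.mul_prod_erase _ _ hx,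
    Multiset.count_cons_self, Nat.factorial_succ, mul_assoc]
  congr 2
  refine Finset.prod_congr rfl fun t ht => ?_
  rw [Multiset.count_cons_of_ne (Finset.ne_of_mem_erase ht)]

lemma sym_ne_zero (t : RTree) : sym t ≠ 0 := by
  have h : ∀ m, multisetFactorial m ≠ 0 := fun m =>
    Finset.prod_ne_zero_iff.2 fun _ _ => Nat.factorial_ne_zero _
  induction t using ind with
  | hl => simp [sym_leaf]
  | hg t s ht hs =>
    rw [sym_eq, branches_graft, Multiset.map_cons, Multiset.prod_cons]
    rw [sym_eq s] at hs
    exact mul_ne_zero (h _) (mul_ne_zero ht (right_ne_zero_of_mul hs))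

lemma sym_graft [DecidableEq RTree] (t s : RTree) :
    sym (graft t s) = ((branches s).count t + 1) * (sym t * sym s) := by
  rw [sym_eq, branches_graft, Multiset.map_cons, Multiset.prod_cons, multisetFactorial_cons,
    sym_eq s]
  ring

/-- The tree with given branches at the root. -/
def ofBranches (m : Multiset RTree) : RTree :=
  haveI : LeftCommutative graft := ⟨graft_swap⟩
  m.foldr graft leaf

lemma ofBranches_branches (t : RTree) : ofBranches (branches t) = t := by
  have : LeftCommutative graft := ⟨graft_swap⟩
  induction t using ind with
  | hl => rfl
  | hg x t _ h =>
    have e : ofBranches (x ::ₘ branches t) = graft x (ofBranches (branches t)) :=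
      Multiset.foldr_cons _ _ _ _
    rw [branches_graft, e, h]

lemma branches_injective : Function.Injective branches :=
  Function.LeftInverse.injective ofBranches_branches

/-- A tree is determined by its multiset of branches, and multisets cancel. -/
lemma graft_left_cancel {x t s : RTree} (h : graft x t = graft x s) : t = s :=
  branches_injective ((Multiset.cons_inj_right x).1 (by simpa using congrArg branches h))

lemma graft_of_mem_prune {t : RTree} {x : RTree × RTree} (hx : x ∈ prune t) :
    graft x.1 x.2 = t := by
  induction t using ind generalizing x with
  | hl => simp at hx
  | hg u s _ h =>
    rw [prune_graft, Multiset.mem_cons, Multiset.mem_map] at hx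
    obtain rfl | ⟨y, hy, rfl⟩ := hx
    · rfl
    · rw [graft_swap, h hy]

lemma map_fst_prune (t : RTree) : (prune t).map Prod.fst = branches t := by
  induction t using ind with
  | hl => rfl
  | hg u s _ h => simp [← h, Multiset.map_map]

/-- The bilinear form on the span of trees for which trees are orthogonal with square norm the
symmetry factor. -/
def form : Span →ₗ[ℝ] Span →ₗ[ℝ] ℝ :=
  Finsupp.lift _ ℝ RTree fun t => (sym t : ℝ) • Finsupp.lapply t

lemma form_single_left (t : RTree) (b : Span) : form (Finsupp.single t 1) b = sym t * b t := by
  simp [form]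

lemma form_comm (a b : Span) : form a b = form b a := by
  classical
  have : form = form.flip := by
    refine span_ext fun t => span_ext fun s => ?_
    rw [LinearMap.flip_apply, form_single_left, form_single_left]
    by_cases h : t = s
    · rw [h]
    · rw [Finsupp.single_eq_of_ne h, Finsupp.single_eq_of_ne (Ne.symm h), mul_zero, mul_zero]
  exact LinearMap.congr_fun (LinearMap.congr_fun this a) b

lemma form_single_right (a : Span) (t : RTree) : form a (Finsupp.single t 1) = sym t * a t := by
  rw [form_comm, form_single_left]

lemma form_single_self (t : RTree) : form (Finsupp.single t 1) (Finsupp.single t 1) = sym t := by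
  simp [form_single_left]

lemma form_single_of_ne {t s : RTree} (h : t ≠ s) :
    form (Finsupp.single t 1) (Finsupp.single s 1) = 0 := by
  rw [form_single_left, Finsupp.single_eq_of_ne h, mul_zero]

/-- The adjoint of grafting is the removal of branches. -/
lemma form_graftL (a b : Span) (t : RTree) : form (graftL a b) (Finsupp.single t 1) =
    msum (prune t) fun x => form a (Finsupp.single x.1 1) * form b (Finsupp.single x.2 1) := by
  classical
  have : graftL.compr₂ (form.flip (Finsupp.single t 1)) = msum (prune t) fun x =>
      (LinearMap.mul ℝ ℝ).compl₁₂ (form.flip (Finsupp.single x.1 1))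
        (form.flip (Finsupp.single x.2 1)) := by
    refine span_ext fun u => span_ext fun v => ?_
    rw [linearMap_msum_apply, linearMap_msum_apply]
    simp only [LinearMap.compr₂_apply, graftL_single, LinearMap.flip_apply, LinearMap.compl₁₂_apply,
      LinearMap.mul_apply']
    by_cases h : graft u v = t
    · subst h
      -- By cancellation, removing a branch u from the tree leaves v, so the sum counts the
      -- occurrences of u among the root branches. That multiplicity is precisely the extra factor
      -- in `sym_graft`.
      have e : ∀ x ∈ prune (graft u v), form (Finsupp.single u 1) (Finsupp.single x.1 1) *
          form (Finsupp.single v 1) (Finsupp.single x.2 1) =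
          if u = x.1 then (sym u * sym v : ℝ) else 0 := by
        intro x hx
        have hx := graft_of_mem_prune hx
        split_ifs with h
        · rw [← h] at hx
          rw [← h, graft_left_cancel hx, form_single_self, form_single_self]
        · rw [form_single_of_ne h, zero_mul]
      rw [msum_congr e, form_single_self, sym_graft]
      have e' : (msum (prune (graft u v)) fun x => if u = x.1 then (sym u * sym v : ℝ) else 0) =
          msum (branches (graft u v)) fun y => if u = y then (sym u * sym v : ℝ) else 0 := by
        rw [← map_fst_prune, msum_map]
      rw [e', branches_graft, msum_cons, if_pos rfl]
      have e'' : ∀ (m : Multiset RTree) (r : ℝ),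
          (msum m fun y => if u = y then r else 0) = m.count u * r := by
        intro m r
        induction m using Multiset.induction_on with
        | empty => simp
        | cons y m ih =>
          rw [msum_cons, ih, Multiset.count_cons]
          split_ifs <;> push_cast <;> ring
      rw [e'']
      push_cast
      ring
    · rw [form_single_of_ne h]
      refine (msum_eq_zero fun x hx => ?_).symm
      by_cases h1 : u = x.1
      · by_cases h2 : v = x.2
        · exact absurd (by rw [h1, h2]; exact graft_of_mem_prune hx) h
        · rw [form_single_of_ne h2, mul_zero]
      · rw [form_single_of_ne h1, zero_mul]
  have h := LinearMap.congr_fun (LinearMap.congr_fun this a) b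
  rw [linearMap_msum_apply, linearMap_msum_apply] at h
  exact h

/-- The bilinear extension of `merge`. -/
def mergeL : Span →ₗ[ℝ] Span →ₗ[ℝ] Span :=
  Finsupp.lift _ ℝ RTree fun t => Finsupp.lift _ ℝ RTree fun s => Finsupp.single (merge t s) 1

@[simp] lemma mergeL_single (t s : RTree) : mergeL (Finsupp.single t 1) (Finsupp.single s 1) =
    Finsupp.single (merge t s) 1 := by simp [mergeL]

/-- The linear form on the tensor square given by `form` with `c` and `d`. -/
def form₂ (c d : Span) : Span ⊗[ℝ] Span →ₗ[ℝ] ℝ :=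
  TensorProduct.lift ((LinearMap.mul ℝ ℝ).compl₁₂ (form.flip c) (form.flip d))

@[simp] lemma form₂_tmul (c d x y : Span) : form₂ c d (x ⊗ₜ y) = form x c * form y d := by
  simp [form₂]

lemma form₂_rTensor (t u v : RTree) (z : Span ⊗[ℝ] Span) :
    form₂ (Finsupp.single u 1) (Finsupp.single v 1)
      ((graftL (Finsupp.single t 1)).rTensor Span z) =
    msum (prune u) fun x => form (Finsupp.single t 1) (Finsupp.single x.1 1) *
      form₂ (Finsupp.single x.2 1) (Finsupp.single v 1) z := by
  induction z using TensorProduct.induction_on with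
  | zero => simp [msum]
  | tmul a b =>
    simp only [LinearMap.rTensor_tmul, form₂_tmul, form_graftL]
    rw [mul_comm, mul_msum]
    exact msum_congr fun x _ => by ring
  | add z w hz hw => simp only [map_add, hz, hw, mul_add, msum_add]

lemma form₂_lTensor (t u v : RTree) (z : Span ⊗[ℝ] Span) :
    form₂ (Finsupp.single u 1) (Finsupp.single v 1)
      ((graftL (Finsupp.single t 1)).lTensor Span z) =
    msum (prune v) fun x => form (Finsupp.single t 1) (Finsupp.single x.1 1) *
      form₂ (Finsupp.single u 1) (Finsupp.single x.2 1) z := by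
  induction z using TensorProduct.induction_on with
  | zero => simp [msum]
  | tmul a b =>
    simp only [LinearMap.lTensor_tmul, form₂_tmul, form_graftL]
    rw [mul_msum]
    exact msum_congr fun x _ => by ring
  | add z w hz hw => simp only [map_add, hz, hw, mul_add, msum_add]

lemma split_leaf : split leaf = Finsupp.single leaf 1 ⊗ₜ Finsupp.single leaf 1 := rfl

lemma split_graft (t s : RTree) : split (graft t s) =
    (graftL (Finsupp.single t 1)).rTensor Span (split s) +
      (graftL (Finsupp.single t 1)).lTensor Span (split s) := by
  simp [split]

/-- Distributing branches over two trees is adjoint to joining the roots. In the induction, a branch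
of y goes to either side, matching the fact that a branch removed from a merged tree comes from one
of the two parts. -/
lemma form₂_split_single (y u v : RTree) :
    form₂ (Finsupp.single u 1) (Finsupp.single v 1) (split y) =
      form (Finsupp.single y 1) (Finsupp.single (merge u v) 1) := by
  induction y using ind generalizing u v with
  | hl =>
    rw [split_leaf, form₂_tmul]
    obtain rfl | ⟨x, s, rfl⟩ := exists_eq_graft u
    · simp [form_single_self, sym_leaf]
    · rw [merge_graft, form_single_of_ne (graft_ne_leaf _ _).symm,
        form_single_of_ne (graft_ne_leaf _ _).symm, zero_mul]
  | hg t s _ hs =>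
    rw [split_graft, map_add, form₂_rTensor, form₂_lTensor, ← graftL_single, form_graftL,
      msum_prune_merge]
    simp only [hs]

/-- The adjoint of `split` is `merge`. -/
lemma form₂_split (y : RTree) (c d : Span) :
    form₂ c d (split y) = form (Finsupp.single y 1) (mergeL c d) := by
  -- Packaged as a bilinear form in (c, d), so that the identity on trees extends by linearity.
  have hb : ∃ B : Span →ₗ[ℝ] Span →ₗ[ℝ] ℝ, ∀ c d, B c d = form₂ c d (split y) := by
    refine ⟨LinearMap.mk₂ ℝ (fun c d => form₂ c d (split y)) ?_ ?_ ?_ ?_, fun c d => rfl⟩ <;>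
    · intros
      generalize split y = z
      induction z using TensorProduct.induction_on with
      | zero => simp
      | tmul a b => simp; try ring
      | add z w hz hw => simp only [map_add, hz, hw, smul_add]; try abel
  obtain ⟨B, hB⟩ := hb
  have : B = mergeL.compr₂ (form (Finsupp.single y 1)) := by
    refine span_ext fun u => span_ext fun v => ?_
    rw [hB, form₂_split_single, LinearMap.compr₂_apply, mergeL_single]
  rw [← hB, this, LinearMap.compr₂_apply]

/-- Since `conv` is split, then φ ⊗ ψ, then graft, its adjoint is prune, then φ' ⊗ ψ', then merge.
-/
lemma form_conv {φ φ' ψ ψ' : Span →ₗ[ℝ] Span} (hφ : ∀ a b, form (φ a) b = form a (φ' b))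
    (hψ : ∀ a b, form (ψ a) b = form a (ψ' b)) (y : Span) (t : RTree) :
    form (conv φ ψ y) (Finsupp.single t 1) = form y (msum (prune t) fun x =>
      mergeL (φ' (Finsupp.single x.1 1)) (ψ' (Finsupp.single x.2 1))) := by
  have h : ∀ z, form (TensorProduct.lift graftL (TensorProduct.map φ ψ z)) (Finsupp.single t 1) =
      msum (prune t) fun x =>
        form₂ (φ' (Finsupp.single x.1 1)) (ψ' (Finsupp.single x.2 1)) z := by
    intro z
    induction z using TensorProduct.induction_on with
    | zero => simp [msum]
    | tmul a b => simp only [TensorProduct.map_tmul, TensorProduct.lift.tmul, form_graftL, hφ, hψ,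
        form₂_tmul]
    | add z w hz hw => simp only [map_add, LinearMap.add_apply, hz, hw, msum_add]
  have : form.flip (Finsupp.single t 1) ∘ₗ conv φ ψ = form.flip (msum (prune t) fun x =>
      mergeL (φ' (Finsupp.single x.1 1)) (ψ' (Finsupp.single x.2 1))) := by
    refine span_ext fun y => ?_
    rw [LinearMap.comp_apply, LinearMap.flip_apply, LinearMap.flip_apply, conv,
      LinearMap.comp_apply, LinearMap.comp_apply, h, map_msum]
    simp [form₂_split]
  exact LinearMap.congr_fun this y

/-- The extraction of a subtree that contains the root, paired with `b`. -/
def extractRoot (b : RTree) : Span →ₗ[ℝ] Span :=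
  Finsupp.lift _ ℝ RTree fun t => msum (rootSub t) fun x =>
    form (Finsupp.single b 1) (Finsupp.single x.1 1) • Finsupp.single x.2 1

@[simp] lemma extractRoot_single (b t : RTree) : extractRoot b (Finsupp.single t 1) =
    msum (rootSub t) fun x =>
      form (Finsupp.single b 1) (Finsupp.single x.1 1) • Finsupp.single x.2 1 := by
  simp [extractRoot]

/-- The only root subtree with one vertex is the root itself, and contracting it changes nothing. -/
lemma extractRoot_leaf : extractRoot leaf = LinearMap.id := by
  refine span_ext fun t => ?_
  rw [extractRoot_single, LinearMap.id_apply]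
  induction t using ind with
  | hl => simp [form_single_self, sym_leaf]
  | hg t s _ hs =>
    have h := congrArg (graftL (Finsupp.single t 1)) hs
    rw [map_msum] at h
    simp only [map_smul, graftL_single] at h
    rw [rootSub_graft, msum_union, msum_bind, msum_map, h, msum_eq_zero, zero_add]
    intro x _
    rw [msum_map]
    refine msum_eq_zero fun y _ => ?_
    rw [form_single_of_ne (graft_ne_leaf _ _).symm, zero_smul]

/-- The recursion matches the adjoint of `conv` computed in `form_conv`; it follows from
`msum_prune_rootSub` by moving the removal of a branch from the extracted subtree to t. -/
lemma extractRoot_graft (b c t : RTree) : extractRoot (graft b c) (Finsupp.single t 1) =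
    msum (prune t) fun x =>
      mergeL (extractRoot b (Finsupp.single x.1 1)) (extractRoot c (Finsupp.single x.2 1)) := by
  simp only [extractRoot_single, ← graftL_single, form_graftL]
  simp only [msum_smul]
  rw [msum_prune_rootSub t fun u v y => (form (Finsupp.single b 1) (Finsupp.single u 1) *
    form (Finsupp.single c 1) (Finsupp.single v 1)) • (Finsupp.single y 1 : Span)]
  refine msum_congr fun x _ => ?_
  rw [map_msum mergeL, linearMap_msum_apply]
  refine msum_congr fun p _ => ?_
  rw [map_msum]
  refine msum_congr fun q _ => ?_
  rw [map_smul, map_smul, LinearMap.smul_apply, mergeL_single, smul_smul, mul_comm]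

/-- The extraction of a subtree at the root is adjoint to simultaneous grafting. -/
lemma form_simGraft (b : RTree) (a c : Span) :
    form (simGraft b a) c = form a (extractRoot b c) := by
  induction b using ind generalizing a c with
  | hl => simp [extractRoot_leaf]
  | hg b b' h h' =>
    have : form (simGraft (graft b b') a) = form a ∘ₗ extractRoot (graft b b') := by
      refine span_ext fun t => ?_
      rw [simGraft_graft, form_conv h h', LinearMap.comp_apply, extractRoot_graft]
    exact LinearMap.congr_fun this c

/-- Removal of branches, weighted by `form` with `a`. -/
def pruneL (a : Span) : Span →ₗ[ℝ] Span :=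
  Finsupp.lift _ ℝ RTree fun t => msum (prune t) fun x =>
    form a (Finsupp.single x.1 1) • Finsupp.single x.2 1

lemma form_graftL_eq (a b c : Span) : form (graftL a b) c = form b (pruneL a c) := by
  have : form (graftL a b) = form b ∘ₗ pruneL a := by
    refine span_ext fun t => ?_
    rw [form_graftL]
    simp [pruneL, map_msum, -Finsupp.smul_single]
  exact LinearMap.congr_fun this c

/-- The canonical commutation relation: removal annihilates a branch and grafting creates one. -/
lemma pruneL_graftL (a b c : Span) : pruneL a (graftL b c) = form a b • c + graftL b (pruneL a c) := by
  have : graftL.compr₂ (pruneL a) =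
      LinearMap.lsmul ℝ Span ∘ₗ form a + graftL.compl₂ (pruneL a) := by
    refine span_ext fun t => span_ext fun s => ?_
    simp [pruneL, map_msum, -Finsupp.smul_single]
  exact LinearMap.congr_fun (LinearMap.congr_fun this b) c

section

variable {Φ Φ' : Span →ₗ[ℝ] Span}

/-- The transpose of `nonRoot_comp_graftL`. Adjointness is assumed at x only, since `form_nonRoot`
uses it inside an induction where it is known for a single branch. -/
lemma pruneL_nonRoot {x : Span} (hx : ∀ b, form (atVertices Φ x) b = form x (atVertices Φ' b))
    (b : Span) : pruneL x (nonRoot Φ' b) = pruneL (atVertices Φ x) b + nonRoot Φ' (pruneL x b) := by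
  have : pruneL x ∘ₗ nonRoot Φ' = pruneL (atVertices Φ x) + nonRoot Φ' ∘ₗ pruneL x := by
    refine span_ext fun t => ?_
    induction t using ind with
    | hl => simp [pruneL]
    | hg t s _ hs =>
      simp only [LinearMap.comp_apply, LinearMap.add_apply] at hs ⊢
      rw [← graftL_single]
      simp only [nonRoot_graftL, map_add, pruneL_graftL, hs, hx, map_smul]
      abel
  exact LinearMap.congr_fun this b

/-- If `Φ` and `Φ'` are adjoint, so are `nonRoot Φ` and `nonRoot Φ'`. -/
lemma form_nonRoot (h : ∀ a b, form (Φ a) b = form a (Φ' b)) (a b : Span) :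
    form (nonRoot Φ a) b = form a (nonRoot Φ' b) := by
  have : form ∘ₗ nonRoot Φ = form.compl₂ (nonRoot Φ') := by
    refine span_ext fun t => LinearMap.ext fun b => ?_
    rw [LinearMap.comp_apply, LinearMap.compl₂_apply]
    induction t using ind generalizing b with
    | hl => rw [nonRoot_leaf, form_single_left, nonRoot_apply_leaf]; simp
    | hg t s ht hs =>
      have ht' : ∀ b, form (atVertices Φ (Finsupp.single t 1)) b =
          form (Finsupp.single t 1) (atVertices Φ' b) := fun b => by
        simp only [atVertices, LinearMap.add_apply, map_add, h, ht]
      rw [← graftL_single, nonRoot_graftL, map_add, LinearMap.add_apply, form_graftL_eq,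
        form_graftL_eq, form_graftL_eq, hs, pruneL_nonRoot ht', map_add]
  exact LinearMap.congr_fun (LinearMap.congr_fun this a) b

lemma form_atVertices (h : ∀ a b, form (Φ a) b = form a (Φ' b)) (a b : Span) :
    form (atVertices Φ a) b = form a (atVertices Φ' b) := by
  simp only [atVertices, LinearMap.add_apply, map_add, h, form_nonRoot h]

end

/-- The extraction of a subtree is adjoint to insertion. -/
lemma form_insert (b : RTree) (a c : Span) : form (insert (Finsupp.single b 1) a) c =
    form a (atVertices (extractRoot b) c) := by
  rw [insert_single, form_atVertices (form_simGraft b)]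

end RTree
end

/-! ### Extraction–contraction is dual to the product of U(B_{≥2}). -/

noncomputable section

namespace RTree

open GuinOudom

/-- The linear extension of `var`. -/
def varL : Span →ₗ[ℝ] MvPolynomial TreeTwo ℝ := Finsupp.lift _ ℝ RTree var

@[simp] lemma varL_single (t : RTree) : varL (Finsupp.single t 1) = var t := by simp [varL]

lemma var_leaf : var leaf = 1 := by simp [var]
lemma var_coe (t : TreeTwo) : var t.1 = MvPolynomial.X t := by
  have h : t.1 ≠ leaf := t.2
  rw [var, dif_pos h]

section SubForestSum

variable {M : Type*} [AddCommGroup M] [Module ℝ M]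

/-- The linear extension of the sum over the spanning subforests of a tree of a function that is
linear in the component of the root and in the product of the other components. -/
def subForestSum (F : RTree → Span →ₗ[ℝ] MvPolynomial TreeTwo ℝ →ₗ[ℝ] M) : Span →ₗ[ℝ] M :=
  Finsupp.lift _ ℝ RTree fun t => msum (subForests t) fun f =>
    F f.quotient (Finsupp.single f.root 1) (f.others.map var).prod

variable (F : RTree → Span →ₗ[ℝ] MvPolynomial TreeTwo ℝ →ₗ[ℝ] M)

@[simp] lemma subForestSum_single (t : RTree) : subForestSum F (Finsupp.single t 1) =
    msum (subForests t) fun f =>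
      F f.quotient (Finsupp.single f.root 1) (f.others.map var).prod := by
  simp [subForestSum]

/-- The function that computes `subForestSum F (graftL · s)`. -/
def graftRight (s q : RTree) : Span →ₗ[ℝ] MvPolynomial TreeTwo ℝ →ₗ[ℝ] M :=
  msum (subForests s) fun g =>
    (F (merge q g.quotient)).compl₁₂ (graftL.flip (Finsupp.single g.root 1))
      (LinearMap.mulRight ℝ (g.others.map var).prod) +
    ((LinearMap.mul ℝ _).compl₁₂ varL (LinearMap.mulRight ℝ (g.others.map var).prod)).compr₂
      (F (graft q g.quotient) (Finsupp.single g.root 1))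

/-- The function that computes `subForestSum F (graftL t ·)`. -/
def graftLeft (t q : RTree) : Span →ₗ[ℝ] MvPolynomial TreeTwo ℝ →ₗ[ℝ] M :=
  msum (subForests t) fun f =>
    (F (merge f.quotient q)).compl₁₂ (graftL (Finsupp.single f.root 1))
      (LinearMap.mulLeft ℝ (f.others.map var).prod) +
    (F (graft f.quotient q)).compl₂
      (LinearMap.mulLeft ℝ (var f.root) ∘ₗ LinearMap.mulLeft ℝ (f.others.map var).prod)

lemma graftRight_apply (s q : RTree) (x : Span) (p : MvPolynomial TreeTwo ℝ) :
    graftRight F s q x p = msum (subForests s) fun g =>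
      F (merge q g.quotient) (graftL x (Finsupp.single g.root 1)) (p * (g.others.map var).prod) +
        F (graft q g.quotient) (Finsupp.single g.root 1)
          (varL x * (p * (g.others.map var).prod)) := by
  simp only [graftRight, linearMap_msum_apply]
  rfl

lemma graftLeft_apply (t q : RTree) (y : Span) (p : MvPolynomial TreeTwo ℝ) :
    graftLeft F t q y p = msum (subForests t) fun f =>
      F (merge f.quotient q) (graftL (Finsupp.single f.root 1) y) ((f.others.map var).prod * p) +
        F (graft f.quotient q) y (var f.root * ((f.others.map var).prod * p)) := by
  simp only [graftLeft, linearMap_msum_apply]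
  rfl

lemma subForestSum_graft (t s : RTree) : subForestSum F (Finsupp.single (graft t s) 1) =
    msum (subForests t) fun f => msum (subForests s) fun g =>
      F (merge f.quotient g.quotient) (graftL (Finsupp.single f.root 1) (Finsupp.single g.root 1))
        ((f.others.map var).prod * (g.others.map var).prod) +
      F (graft f.quotient g.quotient) (Finsupp.single g.root 1)
        (var f.root * ((f.others.map var).prod * (g.others.map var).prod)) := by
  rw [subForestSum_single, msum_subForests_graft]
  simp [SubForest.keep, SubForest.cut]

/-- Together with the right-hand version, this absorbs one grafted argument into the function being
summed. The other argument may then be a linear combination, as needed in the induction of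
`subForestSum_nonRoot`. -/
lemma subForestSum_graftL_left (t : RTree) (b : Span) :
    subForestSum F (graftL (Finsupp.single t 1) b) = subForestSum (graftLeft F t) b := by
  have : subForestSum F ∘ₗ graftL (Finsupp.single t 1) = subForestSum (graftLeft F t) := by
    refine span_ext fun s => ?_
    rw [LinearMap.comp_apply, graftL_single, subForestSum_graft, subForestSum_single, msum_comm]
    simp only [graftLeft_apply]
  exact LinearMap.congr_fun this b

lemma subForestSum_graftL_right (a : Span) (s : RTree) :
    subForestSum F (graftL a (Finsupp.single s 1)) = subForestSum (graftRight F s) a := by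
  have : subForestSum F ∘ₗ graftL.flip (Finsupp.single s 1) = subForestSum (graftRight F s) := by
    refine span_ext fun t => ?_
    rw [LinearMap.comp_apply, LinearMap.flip_apply, graftL_single, subForestSum_graft,
      subForestSum_single]
    simp only [graftRight_apply, varL_single]
  exact LinearMap.congr_fun this a

/-- The weighted form of `msum_subForests_rootSub`: extraction at the root acts only on the root
component of the subforest. -/
lemma subForestSum_extractRoot (b t : RTree) :
    subForestSum F (extractRoot b (Finsupp.single t 1)) = msum (subForests t) fun f =>
      F f.quotient (extractRoot b (Finsupp.single f.root 1)) (f.others.map var).prod := by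
  have h := msum_subForests_rootSub t fun x f => form (Finsupp.single b 1) (Finsupp.single x 1) •
      F f.quotient (Finsupp.single f.root 1) (f.others.map var).prod
  rw [extractRoot_single, map_msum]
  simp only [map_smul, subForestSum_single, smul_msum, extractRoot_single, map_msum,
    linearMap_msum_apply, LinearMap.smul_apply]
  exact h

variable {Φ : Span →ₗ[ℝ] Span}
  {R : Derivation ℝ (MvPolynomial TreeTwo ℝ) (MvPolynomial TreeTwo ℝ)}

/-- A modification at a non-root vertex takes place either inside the root component, away from its
root, or in another component, where R produces it by the Leibniz rule. The quotient is unaffected.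
The hypothesis ranges over all F because the induction replaces F by `graftLeft` and `graftRight`.
-/
lemma subForestSum_nonRoot
    (hΦ : ∀ (F : RTree → Span →ₗ[ℝ] MvPolynomial TreeTwo ℝ →ₗ[ℝ] M) t,
      subForestSum F (Φ (Finsupp.single t 1)) = msum (subForests t) fun f =>
        F f.quotient (Φ (Finsupp.single f.root 1)) (f.others.map var).prod)
    (hR : ∀ x, R (varL x) = varL (atVertices Φ x)) (t : RTree) :
    subForestSum F (nonRoot Φ (Finsupp.single t 1)) = msum (subForests t) fun f =>
      F f.quotient (nonRoot Φ (Finsupp.single f.root 1)) (f.others.map var).prod +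
        F f.quotient (Finsupp.single f.root 1) (R (f.others.map var).prod) := by
  induction t using ind generalizing F with
  | hl => simp
  | hg t s ht hs =>
    have ht' : ∀ F : RTree → Span →ₗ[ℝ] MvPolynomial TreeTwo ℝ →ₗ[ℝ] M,
        subForestSum F (atVertices Φ (Finsupp.single t 1)) = msum (subForests t) fun f =>
          F f.quotient (atVertices Φ (Finsupp.single f.root 1)) (f.others.map var).prod +
            F f.quotient (Finsupp.single f.root 1) (R (f.others.map var).prod) := fun F => by
      simp only [atVertices, LinearMap.add_apply, map_add, hΦ, ht, ← msum_add, add_assoc]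
    rw [← graftL_single, nonRoot_graftL, map_add, subForestSum_graftL_left,
      subForestSum_graftL_right, ht', hs, msum_subForests_graft]
    simp only [graftRight_apply, graftLeft_apply, ← msum_add]
    rw [msum_comm (subForests s), ← msum_add]
    refine msum_congr fun f _ => ?_
    rw [← msum_add]
    refine msum_congr fun g _ => ?_
    simp only [SubForest.keep, SubForest.cut, Multiset.map_cons, Multiset.map_add,
      Multiset.prod_cons, Multiset.prod_add, ← graftL_single, nonRoot_graftL, map_add,
      LinearMap.add_apply, Derivation.leibniz, smul_eq_mul, ← hR, varL_single]
    rw [mul_comm _ (R (var f.root)), mul_add (var f.root), map_add,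
      mul_comm (g.others.map var).prod (R _)]
    abel

/-- The extraction of a subtree, at the level of spanning subforests. -/
lemma subForestSum_atVertices_extractRoot (b : RTree)
    (hR : ∀ x, R (varL x) = varL (atVertices (extractRoot b) x)) (t : RTree) :
    subForestSum F (atVertices (extractRoot b) (Finsupp.single t 1)) =
      msum (subForests t) fun f =>
        F f.quotient (atVertices (extractRoot b) (Finsupp.single f.root 1))
          (f.others.map var).prod +
        F f.quotient (Finsupp.single f.root 1) (R (f.others.map var).prod) := by
  rw [atVertices, LinearMap.add_apply, map_add, subForestSum_extractRoot,
    subForestSum_nonRoot F (fun F t => subForestSum_extractRoot F b t) hR, ← msum_add]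
  refine msum_congr fun f _ => ?_
  rw [LinearMap.add_apply, map_add, LinearMap.add_apply, add_assoc]

end SubForestSum

/-- The extraction-contraction coproduct as a linear map on the span of all trees. -/
def coprodSpan : Span →ₗ[ℝ] MvPolynomial TreeTwo ℝ ⊗[ℝ] MvPolynomial TreeTwo ℝ :=
  subForestSum fun q => (LinearMap.mul ℝ _).compr₂
    ((TensorProduct.mk ℝ _ _).flip (var q)) ∘ₗ varL

lemma coprodSpan_single (t : RTree) : coprodSpan (Finsupp.single t 1) = msum (subForests t) fun f =>
    (var f.root * (f.others.map var).prod) ⊗ₜ var f.quotient := by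
  simp [coprodSpan]

/-- The one-vertex tree is included: its only subforest gives 1 ⊗ 1, in agreement with its
identification with 1. -/
lemma coprodEC_var (t : RTree) : coprodEC (var t) = coprodSpan (Finsupp.single t 1) := by
  by_cases h : t = leaf
  · subst h
    rw [var_leaf, map_one, coprodSpan_single]
    simp [var_leaf, Algebra.TensorProduct.one_def]
  · have := var_coe ⟨t, h⟩
    rw [this, coprodEC, MvPolynomial.aeval_X, coprodSpan_single]
    rfl

lemma coprodEC_varL (x : Span) : coprodEC (varL x) = coprodSpan x := by
  have : coprodEC.toLinearMap ∘ₗ varL = coprodSpan := span_ext fun t => by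
    rw [LinearMap.comp_apply, varL_single, AlgHom.toLinearMap_apply, coprodEC_var]
  exact LinearMap.congr_fun this x

lemma rTensor_coprodSpan {R : Derivation ℝ (MvPolynomial TreeTwo ℝ) (MvPolynomial TreeTwo ℝ)}
    (b : RTree) (hR : ∀ x, R (varL x) = varL (atVertices (extractRoot b) x)) (t : RTree) :
    R.toLinearMap.rTensor _ (coprodSpan (Finsupp.single t 1)) =
      coprodSpan (atVertices (extractRoot b) (Finsupp.single t 1)) := by
  rw [coprodSpan, subForestSum_atVertices_extractRoot _ b hR, subForestSum_single, map_msum]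
  refine msum_congr fun f _ => ?_
  simp only [LinearMap.comp_apply, LinearMap.compr₂_apply, LinearMap.mul_apply',
    LinearMap.flip_apply, TensorProduct.mk_apply, LinearMap.rTensor_tmul, Derivation.coeFn_coe,
    Derivation.leibniz, ← hR, varL_single, smul_eq_mul]
  rw [← TensorProduct.add_tmul, add_comm, mul_comm (f.others.map var).prod]

/-- The derivation of the polynomial algebra over trees that extracts the subtree `b`. -/
def extract (b : RTree) : Derivation ℝ (MvPolynomial TreeTwo ℝ) (MvPolynomial TreeTwo ℝ) :=
  MvPolynomial.mkDerivation ℝ fun t => varL (atVertices (extractRoot b) (Finsupp.single t.1 1))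

/-- The condition on b matters at the one-vertex tree: a derivation kills 1, while extracting a
single vertex from a single vertex would give 1. -/
lemma extract_varL {b : RTree} (hb : b ≠ leaf) (x : Span) :
    extract b (varL x) = varL (atVertices (extractRoot b) x) := by
  have : (extract b).toLinearMap ∘ₗ varL = varL ∘ₗ atVertices (extractRoot b) := by
    refine span_ext fun t => ?_
    simp only [LinearMap.comp_apply, varL_single, Derivation.coeFn_coe]
    by_cases h : t = leaf
    · subst h
      simp [var_leaf, atVertices, form_single_of_ne hb]
    · have := var_coe ⟨t, h⟩
      rw [this, extract, MvPolynomial.mkDerivation_X]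
  exact LinearMap.congr_fun this x

lemma constantCoeff_varL (x : Span) : MvPolynomial.constantCoeff (varL x) = x leaf := by
  have : MvPolynomial.lcoeff ℝ 0 ∘ₗ varL = Finsupp.lapply leaf := by
    refine span_ext fun t => ?_
    rw [LinearMap.comp_apply, varL_single, Finsupp.lapply_apply, MvPolynomial.lcoeff_apply]
    by_cases h : t = leaf
    · subst h; simp [var_leaf]
    · rw [var_coe ⟨t, h⟩, Finsupp.single_eq_of_ne (Ne.symm h)]
      exact MvPolynomial.constantCoeff_X (R := ℝ) (⟨t, h⟩ : TreeTwo)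
  exact LinearMap.congr_fun this x

lemma pderiv_varL (x : Span) (k : TreeTwo) :
    MvPolynomial.pderiv k (varL x) = MvPolynomial.C (x k.1) := by
  classical
  have : (MvPolynomial.pderiv (R := ℝ) k).toLinearMap ∘ₗ varL =
      Algebra.linearMap ℝ (MvPolynomial TreeTwo ℝ) ∘ₗ Finsupp.lapply k.1 := by
    refine span_ext fun t => ?_
    rw [LinearMap.comp_apply, varL_single, LinearMap.comp_apply, Finsupp.lapply_apply,
      Derivation.coeFn_coe]
    by_cases h : t = leaf
    · subst h
      have := k.2
      rw [var_leaf, Finsupp.single_eq_of_ne this]; simp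
    · rw [var_coe ⟨t, h⟩]
      by_cases hk : (⟨t, h⟩ : TreeTwo) = k
      · subst hk; simp
      · rw [MvPolynomial.pderiv_X_of_ne hk,
          Finsupp.single_eq_of_ne (fun e => hk (Subtype.ext e.symm))]
        simp
  exact LinearMap.congr_fun this x

lemma treeBasis_repr_apply (x : BTwo) (t : TreeTwo) : treeBasis.repr x t = x.1 t.1 := rfl

lemma insert_leaf (b : RTree) : insert (Finsupp.single b 1) (Finsupp.single leaf 1) =
    Finsupp.single b 1 := by
  rw [insert_single, atVertices, LinearMap.add_apply, nonRoot_leaf, add_zero, ← simGraftL_single,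
    simGraftL_leaf]

/-- Both conditions are instances of `form_insert`. Insertion of b into the one-vertex tree, which
is b, gives the constant terms; insertion into k gives the linear ones. -/
lemma isLeftAdjoint_extract (b : TreeTwo) :
    IsLeftAdjoint treeBasis (fun t => (sym t.1 : ℝ)) (treeBasis b) (extract b.1) where
  const t := by
    rw [extract, MvPolynomial.mkDerivation_X, constantCoeff_varL]
    have h := form_insert b.1 (Finsupp.single leaf 1) (Finsupp.single t.1 1)
    rw [insert_leaf, form_single_right, form_single_left, sym_leaf, Nat.cast_one, one_mul] at h
    rw [← h, treeBasis_repr_apply, treeBasis_apply, mul_comm]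
  pderiv t k := by
    rw [extract, MvPolynomial.mkDerivation_X, pderiv_varL]
    have h := form_insert b.1 (Finsupp.single k.1 1) (Finsupp.single t.1 1)
    rw [form_single_right, form_single_left] at h
    have e : (treeBasis b * treeBasis k : BTwo).1 =
      insert (treeBasis b : Span) (treeBasis k : Span) := rfl
    rw [MvPolynomial.smul_eq_C_mul, ← map_mul, ← h, treeBasis_repr_apply, e, treeBasis_apply,
      treeBasis_apply, mul_comm]

/-- Any kept edge puts a nontrivial tree into the product, whose constant term is then 0. Only the
edgeless subforest survives, with quotient t. -/
lemma msum_counit {M : Type*} [AddCommGroup M] [Module ℝ M] (t : RTree) (φ : RTree → M) :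
    (msum (subForests t) fun f =>
      MvPolynomial.constantCoeff (var f.root * (f.others.map var).prod) • φ f.quotient) = φ t := by
  induction t using ind generalizing φ with
  | hl => simp [var_leaf]
  | hg t s ht hs =>
    rw [msum_subForests_graft]
    have e : ∀ f g : SubForest,
        MvPolynomial.constantCoeff (var (f.keep g).root * ((f.keep g).others.map var).prod) •
          φ (f.keep g).quotient +
        MvPolynomial.constantCoeff (var (f.cut g).root * ((f.cut g).others.map var).prod) •
          φ (f.cut g).quotient =
        MvPolynomial.constantCoeff (var f.root * (f.others.map var).prod) •
          MvPolynomial.constantCoeff (var g.root * (g.others.map var).prod) •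
            φ (graft f.quotient g.quotient) := fun f g => by
      have h0 : MvPolynomial.constantCoeff (var (graft f.root g.root)) = 0 := by
        rw [var_coe ⟨_, graft_ne_leaf _ _⟩, MvPolynomial.constantCoeff_X]
      simp only [SubForest.keep, SubForest.cut, map_mul, h0, zero_mul, zero_smul, zero_add,
        Multiset.map_cons, Multiset.map_add, Multiset.prod_cons, Multiset.prod_add, smul_smul]
      congr 1
      ring
    simp only [e, ← smul_msum]
    rw [← ht fun q => φ (graft q s)]
    exact msum_congr fun f _ => congrArg _ (hs fun q => φ (graft f.quotient q))

/-- The extraction-contraction coproduct is dual to the product of `U(𝓑_{≥2})`. -/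
theorem isDual_coprodEC : IsDual treeBasis (fun t => (sym t.1 : ℝ)) coprodEC.toLinearMap := by
  refine isDual_of_algHom (fun t => ?_) fun b => ?_
  · rw [← var_coe, coprodEC_var, coprodSpan_single, map_msum]
    simp only [slice_tmul, pairing_one]
    exact msum_counit t.1 var
  · refine IsLeftAdjoint.exists_of_basis (fun i => ?_) (fun R R' h h' i => ?_) (fun r R h i => ?_)
      (fun j => ⟨extract j.1, isLeftAdjoint_extract j, fun i => ?_⟩) b
    · simp
    · rw [Derivation.add_apply, map_add, ← h, ← h']
      simp [LinearMap.rTensor_add]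
    · rw [Derivation.smul_apply, map_smul, ← h]
      simp [LinearMap.rTensor_smul]
    · rw [← var_coe, ← varL_single, extract_varL j.2, coprodEC_varL, coprodEC_varL,
        rTensor_coprodSpan j.1 (extract_varL j.2)]

end RTree
end

/-! ### The edge filtration and the rooted tree Hopf algebra. -/

noncomputable section

namespace RTree

open GuinOudom MultiIndex

/-- The number of edges. -/
def edges : RTree → ℕ :=
  recur 0 (fun _ n _ m => n + m + 1) fun _ _ _ _ _ _ => by omega

@[simp] lemma edges_leaf : edges leaf = 0 := rfl
@[simp] lemma edges_graft (t s : RTree) : edges (graft t s) = edges t + edges s + 1 := by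
  simp [edges]

lemma edges_merge (t s : RTree) : edges (merge t s) = edges t + edges s := by
  induction t using ind with
  | hl => simp
  | hg x t _ h => simp [h]; omega

/-- Every edge of t is either kept in a component or survives in the contracted tree, so the
coproduct respects the edge count. -/
lemma edges_eq_of_mem_subForests {t : RTree} {f : SubForest} (hf : f ∈ subForests t) :
    edges f.root + (f.others.map edges).sum + edges f.quotient = edges t := by
  induction t using ind generalizing f with
  | hl =>
    rw [subForests_leaf, Multiset.mem_singleton] at hf
    subst hf
    simp
  | hg t s ht hs =>
    simp only [subForests_graft, Multiset.mem_bind, Multiset.insert_eq_cons, Multiset.mem_cons,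
      Multiset.mem_singleton] at hf
    obtain ⟨g, hg, h, hh, rfl | rfl⟩ := hf <;>
    · have := ht hg
      have := hs hh
      simp only [SubForest.keep, SubForest.cut, edges_graft, edges_merge, Multiset.map_add,
        Multiset.sum_add, Multiset.map_cons, Multiset.sum_cons]
      omega

lemma finite_edges_le (n : ℕ) : {t : RTree | edges t ≤ n}.Finite := by
  induction n with
  | zero =>
    refine (Set.finite_singleton leaf).subset fun t ht => ?_
    obtain rfl | ⟨x, s, rfl⟩ := exists_eq_graft t
    · rfl
    · simp at ht
  | succ n ih =>
    refine ((Set.finite_singleton leaf).union (ih.image2 graft ih)).subset fun t ht => ?_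
    obtain rfl | ⟨x, s, rfl⟩ := exists_eq_graft t
    · exact Or.inl rfl
    · have ht : edges (graft x s) ≤ n + 1 := ht
      rw [edges_graft] at ht
      exact Or.inr ⟨x, (by omega : edges x ≤ n), s, (by omega : edges s ≤ n), rfl⟩

lemma isConnected_edges : IsConnected fun t : TreeTwo => edges t.1 where
  pos t := by
    obtain h | ⟨x, s, h⟩ := exists_eq_graft t.1
    · exact absurd h t.2
    · rw [h, edges_graft]; omega
  finite n := Set.Finite.preimage Subtype.val_injective.injOn (finite_edges_le n)

end RTree

namespace GuinOudom

variable {ι : Type*} {deg : ι → ℕ}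

lemma mul_mem_degFiltration {k l : ℕ} {p q : MvPolynomial ι ℝ} (hp : p ∈ degFiltration deg k)
    (hq : q ∈ degFiltration deg l) : p * q ∈ degFiltration deg (k + l) := by
  induction hp, hq using Submodule.span_induction₂ with
  | mem_mem p q hp hq =>
    obtain ⟨I, hI, rfl⟩ := hp
    obtain ⟨J, hJ, rfl⟩ := hq
    rw [MvPolynomial.monomial_mul, one_mul]
    refine Submodule.subset_span ⟨I + J, ?_, rfl⟩
    rw [map_add]
    omega
  | zero_left => simp
  | zero_right => simp
  | add_left p p' q _ _ _ h h' => rw [add_mul]; exact Submodule.add_mem _ h h'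
  | add_right p q q' _ _ _ h h' => rw [mul_add]; exact Submodule.add_mem _ h h'
  | smul_left r p q _ _ h => rw [smul_mul_assoc]; exact Submodule.smul_mem _ r h
  | smul_right r p q _ _ h => rw [mul_smul_comm]; exact Submodule.smul_mem _ r h

lemma one_mem_degFiltration : (1 : MvPolynomial ι ℝ) ∈ degFiltration deg 0 :=
  Submodule.subset_span ⟨0, by simp, rfl⟩

/-- The filtration of the tensor square of the polynomial algebra by the degree. -/
def tensorFiltration (deg : ι → ℕ) (n : ℕ) :
    Submodule ℝ (MvPolynomial ι ℝ ⊗[ℝ] MvPolynomial ι ℝ) :=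
  Submodule.span ℝ {z | ∃ k l, k + l ≤ n ∧ ∃ x ∈ degFiltration deg k, ∃ y ∈ degFiltration deg l,
    z = x ⊗ₜ[ℝ] y}

lemma tensorFiltration_mono : Monotone (tensorFiltration deg) := fun _ _ h =>
  Submodule.span_mono fun _ ⟨k, l, hkl, e⟩ => ⟨k, l, hkl.trans h, e⟩

lemma mul_mem_tensorFiltration {m n : ℕ} {y z : MvPolynomial ι ℝ ⊗[ℝ] MvPolynomial ι ℝ}
    (hy : y ∈ tensorFiltration deg m) (hz : z ∈ tensorFiltration deg n) :
    y * z ∈ tensorFiltration deg (m + n) := by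
  induction hy, hz using Submodule.span_induction₂ with
  | mem_mem y z hy hz =>
    obtain ⟨k, l, hkl, a, ha, b, hb, rfl⟩ := hy
    obtain ⟨k', l', hkl', a', ha', b', hb', rfl⟩ := hz
    rw [Algebra.TensorProduct.tmul_mul_tmul]
    exact Submodule.subset_span ⟨k + k', l + l', by omega, _, mul_mem_degFiltration ha ha', _,
      mul_mem_degFiltration hb hb', rfl⟩
  | zero_left => simp
  | zero_right => simp
  | add_left p p' q _ _ _ h h' => rw [add_mul]; exact Submodule.add_mem _ h h'
  | add_right p q q' _ _ _ h h' => rw [mul_add]; exact Submodule.add_mem _ h h'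
  | smul_left r p q _ _ h => rw [smul_mul_assoc]; exact Submodule.smul_mem _ r h
  | smul_right r p q _ _ h => rw [mul_smul_comm]; exact Submodule.smul_mem _ r h

/-- A multiplicative coproduct is filtered if it is so on generators. -/
lemma isFiltered_of_algHom {Δ : MvPolynomial ι ℝ →ₐ[ℝ] MvPolynomial ι ℝ ⊗[ℝ] MvPolynomial ι ℝ}
    (h : ∀ i, Δ (MvPolynomial.X i) ∈ tensorFiltration deg (deg i)) :
    IsFiltered (degFiltration deg) Δ.toLinearMap := by
  have h1 : (1 : MvPolynomial ι ℝ ⊗[ℝ] MvPolynomial ι ℝ) ∈ tensorFiltration deg 0 :=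
    Submodule.subset_span ⟨0, 0, le_rfl, 1, one_mem_degFiltration, 1, one_mem_degFiltration, rfl⟩
  have hmon : ∀ I : ι →₀ ℕ, Δ (MvPolynomial.monomial I 1) ∈
      tensorFiltration deg (Finsupp.weight deg I) := by
    intro I
    induction I using Finsupp.induction_linear with
    | zero =>
      have : (MvPolynomial.monomial 0 1 : MvPolynomial ι ℝ) = 1 := rfl
      rw [this, map_one, map_zero]
      exact h1
    | add I J hI hJ =>
      have : MvPolynomial.monomial (I + J) (1 : ℝ) =
          MvPolynomial.monomial I 1 * MvPolynomial.monomial J 1 := by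
        rw [MvPolynomial.monomial_mul, one_mul]
      rw [this, map_mul, map_add]
      exact mul_mem_tensorFiltration hI hJ
    | single i n =>
      rw [← MvPolynomial.X_pow_eq_monomial, map_pow, Finsupp.weight_single]
      induction n with
      | zero => simpa using h1
      | succ n ih =>
        rw [pow_succ, succ_nsmul]
        exact mul_mem_tensorFiltration ih (h i)
  intro n p hp
  change _ ∈ tensorFiltration deg n
  induction hp using Submodule.span_induction with
  | mem p hp =>
    obtain ⟨I, hI, rfl⟩ := hp
    exact tensorFiltration_mono hI (hmon I)
  | zero => rw [map_zero]; exact Submodule.zero_mem _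
  | add p q _ _ hp hq => rw [map_add]; exact Submodule.add_mem _ hp hq
  | smul r p _ hp => rw [map_smul]; exact Submodule.smul_mem _ _ hp

end GuinOudom

namespace RTree

open GuinOudom MultiIndex

lemma var_mem_degFiltration (t : RTree) :
    var t ∈ degFiltration (fun t : TreeTwo => edges t.1) (edges t) := by
  by_cases h : t = leaf
  · subst h
    rw [var_leaf]
    exact one_mem_degFiltration
  · rw [var_coe ⟨t, h⟩]
    refine Submodule.subset_span ⟨Finsupp.single ⟨t, h⟩ 1, ?_, rfl⟩
    simp [Finsupp.weight_single]

lemma prod_var_mem_degFiltration (m : Multiset RTree) : (m.map var).prod ∈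
    degFiltration (fun t : TreeTwo => edges t.1) (m.map edges).sum := by
  induction m using Multiset.induction_on with
  | empty => exact one_mem_degFiltration
  | cons t m ih =>
    simp only [Multiset.map_cons, Multiset.prod_cons, Multiset.sum_cons]
    exact mul_mem_degFiltration (var_mem_degFiltration t) ih

lemma isFiltered_coprodEC :
    IsFiltered (degFiltration fun t : TreeTwo => edges t.1) coprodEC.toLinearMap := by
  refine isFiltered_of_algHom fun t => ?_
  rw [← var_coe, coprodEC_var, coprodSpan_single]
  refine multiset_sum_mem _ fun z hz => ?_
  obtain ⟨f, hf, rfl⟩ := Multiset.mem_map.1 hz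
  exact Submodule.subset_span ⟨_, _, (edges_eq_of_mem_subForests hf).le, _,
    mul_mem_degFiltration (var_mem_degFiltration _) (prod_var_mem_degFiltration _), _,
    var_mem_degFiltration _, rfl⟩

lemma sym_cast_ne_zero (t : TreeTwo) : (sym t.1 : ℝ) ≠ 0 := Nat.cast_ne_zero.2 (sym_ne_zero _)

/-- The rooted tree Hopf algebra. -/
theorem exists_isHopf_coprodEC : ∃ S, IsHopf coprodEC.toLinearMap (polyCounit TreeTwo) S := by
  have h := isDual_coprodEC
  have hw := sym_cast_ne_zero
  have hε : polyCounit TreeTwo = pairing treeBasis (fun t => (sym t.1 : ℝ)) 1 := polyCounit_eq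
  obtain ⟨S, hl, hr⟩ := exists_antipode (h.coassoc hw) (hε ▸ h.rTensor_counit hw)
    (hε ▸ h.lTensor_counit hw) degFiltration_mono exists_mem_degFiltration
    (degFiltration_zero isConnected_edges) isFiltered_coprodEC
  exact ⟨S,
    { coassoc := h.coassoc hw
      rTensor_counit := hε ▸ h.rTensor_counit hw
      lTensor_counit := hε ▸ h.lTensor_counit hw
      counit_one := by simp [polyCounit]
      counit_mul := by simp [polyCounit]
      comul_one := by simp
      comul_mul := by simp
      antipode_left := hl
      antipode_right := hr }⟩

/-! ### The transpose of Ψ. -/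

lemma length_fertilityNonRoot (t : RTree) : length (fertilityNonRoot t) = edges t := by
  induction t using ind with
  | hl => simp [fertilityNonRoot, length]
  | hg t s ht hs =>
    have : fertilityNonRoot (graft t s) =
        Finsupp.single (arity t) 1 + fertilityNonRoot t + fertilityNonRoot s := by
      simp [fertilityNonRoot]
    rw [this, length_add, length_add, length_single, ht, hs, edges_graft]
    ring

/-- The multi-index of a tree with at least one edge. -/
def fertTwo (t : TreeTwo) : PopTwo := ⟨fertility t.1, fertility_mem t⟩

/-- The length of β is the number of vertices, which bounds the number of edges. This makes the sum
defining Ψ† finite. -/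
lemma finite_fertTwo (β : PopTwo) : {t | fertTwo t = β}.Finite := by
  refine (isConnected_edges.finite (length β.1)).subset fun t ht => ?_
  have ht : fertTwo t = β := ht
  subst ht
  change edges t.1 ≤ length (fertility t.1)
  rw [fertility, length_add, length_single, length_fertilityNonRoot]
  omega

/-- The factor `∏ k!` of a multi-index. -/
def symIndex (β : ℕ →₀ ℕ) : ℝ := β.prod fun k n => (k.factorial : ℝ) ^ n

lemma psi_treeBasis (t : TreeTwo) :
    psi (treeBasis t) = symIndex (fertTwo t).1 • zBasis (fertTwo t) := by
  rw [psi, Module.Basis.constr_basis]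
  rfl

/-- The transpose of the morphism induced by `psi` on enveloping algebras. -/
def psiDagger : MvPolynomial PopTwo ℝ →ₐ[ℝ] MvPolynomial TreeTwo ℝ :=
  MvPolynomial.aeval fun β => ∑ t ∈ (finite_fertTwo β).toFinset,
    (symIndex β.1 * (sym t.1 : ℝ)⁻¹) • MvPolynomial.X t

lemma pderiv_psiDagger_X (t : TreeTwo) (β : PopTwo) :
    (sym t.1 : ℝ) • MvPolynomial.pderiv t (psiDagger (MvPolynomial.X β)) =
      symIndex (fertTwo t).1 • psiDagger (MvPolynomial.pderiv (fertTwo t) (MvPolynomial.X β)) := by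
  classical
  rw [psiDagger, MvPolynomial.aeval_X, map_sum]
  by_cases h : fertTwo t = β
  · rw [Finset.sum_eq_single t]
    · subst h
      rw [Derivation.map_smul, MvPolynomial.pderiv_X_self, MvPolynomial.pderiv_X_self, map_one,
        smul_smul, mul_left_comm, mul_inv_cancel₀ (sym_cast_ne_zero t), mul_one]
    · intro s _ hs
      rw [Derivation.map_smul, MvPolynomial.pderiv_X_of_ne hs, smul_zero]
    · intro ht
      exact absurd ((finite_fertTwo β).mem_toFinset.2 h) ht
  · rw [Finset.sum_eq_zero, MvPolynomial.pderiv_X_of_ne (Ne.symm h), map_zero, smul_zero, smul_zero]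
    intro s hs
    have hs : fertTwo s = β := (finite_fertTwo β).mem_toFinset.1 hs
    rw [Derivation.map_smul, MvPolynomial.pderiv_X_of_ne (fun e => h (by rw [← e, hs])), smul_zero]

/-- Transpose of Ψ(u ⊙ τ) = Ψ(u) ⊙ Ψ(τ). The coefficients σ(β)/σ(τ) of Ψ† are those for which it
holds on generators; both sides are derivations along the algebra morphism Ψ†. -/
lemma pderiv_psiDagger (t : TreeTwo) (p : MvPolynomial PopTwo ℝ) :
    (sym t.1 : ℝ) • MvPolynomial.pderiv t (psiDagger p) =
      symIndex (fertTwo t).1 • psiDagger (MvPolynomial.pderiv (fertTwo t) p) := by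
  induction p using MvPolynomial.induction_on with
  | C r => rw [← MvPolynomial.algebraMap_eq, AlgHom.commutes]; simp
  | add p q hp hq => simp only [map_add, smul_add, hp, hq]
  | mul_X p β hp =>
    rw [map_mul, Derivation.leibniz, Derivation.leibniz, smul_add, map_add, smul_add, smul_eq_mul,
      smul_eq_mul, smul_eq_mul, smul_eq_mul, map_mul, map_mul, ← mul_smul_comm, pderiv_psiDagger_X,
      ← mul_smul_comm, hp, mul_smul_comm, mul_smul_comm]

lemma constantCoeff_psiDagger (p : MvPolynomial PopTwo ℝ) :
    MvPolynomial.constantCoeff (psiDagger p) = MvPolynomial.constantCoeff p := by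
  induction p using MvPolynomial.induction_on with
  | C r => rw [← MvPolynomial.algebraMap_eq, AlgHom.commutes]; simp
  | add p q hp hq => simp only [map_add, hp, hq]
  | mul_X p β hp =>
    have : MvPolynomial.constantCoeff (psiDagger (MvPolynomial.X β)) = 0 := by
      rw [psiDagger, MvPolynomial.aeval_X, map_sum]
      refine Finset.sum_eq_zero fun t _ => ?_
      simp
    rw [map_mul, map_mul, map_mul, this, MvPolynomial.constantCoeff_X, mul_zero, mul_zero]

/-- Building u by the right action turns the claim into the intertwining of partial derivatives,
with the constant term as base case. -/
lemma pairing_psiDagger (u : U BTwo) (p : MvPolynomial PopTwo ℝ) :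
    pairing treeBasis (fun t => (sym t.1 : ℝ)) u (psiDagger p) =
      pairing zBasis (fun _ => 1) (mapU psi psi_mul u) p := by
  induction u using odot_induction treeBasis generalizing p with
  | h1 => rw [map_one (mapU psi psi_mul), pairing_one, pairing_one, constantCoeff_psiDagger]
  | hadd u v hu hv => simp only [map_add, LinearMap.add_apply, hu, hv]
  | hsmul r u hu => simp only [map_smul, LinearMap.smul_apply, hu]
  | hodot u t hu =>
    rw [mapU_odot, psi_treeBasis, map_smul, map_smul, LinearMap.smul_apply, pairing_odot,
      pairing_odot, one_mul, ← hu, smul_eq_mul, ← smul_eq_mul, ← map_smul, pderiv_psiDagger,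
      map_smul, smul_eq_mul]

/-- Tested against u ⊗ v, both sides become the pairing of Ψ(uv) = Ψ(u)Ψ(v) with p, since each
coproduct is dual to its product. -/
lemma coprodEC_psiDagger (p : MvPolynomial PopTwo ℝ) : coprodEC (psiDagger p) =
    TensorProduct.map psiDagger.toLinearMap psiDagger.toLinearMap (coprod zBasis p) := by
  have h := isDual_coprod isGraded_zBasis isConnected_degPop
  refine slice_ext (a := treeBasis) sym_cast_ne_zero fun u =>
    pairing_ext (a := treeBasis) sym_cast_ne_zero fun v => ?_
  have e := isDual_coprodEC u v (psiDagger p)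
  rw [AlgHom.toLinearMap_apply] at e
  rw [e, pairing_psiDagger, map_mul, ← h]
  generalize coprod zBasis p = z
  induction z using TensorProduct.induction_on with
  | zero => simp
  | tmul x y => simp [pairing_psiDagger]
  | add x y hx hy => simp only [map_add, hx, hy]

end RTree

end

theorem mainTheorem2 :
    (∀ a b : RTree.BTwo, RTree.psi (a * b) = RTree.psi a * RTree.psi b) ∧
    ∃ (Psi : GuinOudom.U RTree.BTwo →ₐ[ℝ] GuinOudom.U MultiIndex.TTwo)
      (SM : MvPolynomial MultiIndex.PopTwo ℝ →ₗ[ℝ] MvPolynomial MultiIndex.PopTwo ℝ)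
      (ST : MvPolynomial RTree.TreeTwo ℝ →ₗ[ℝ] MvPolynomial RTree.TreeTwo ℝ)
      (PsiDagger : MvPolynomial MultiIndex.PopTwo ℝ →ₐ[ℝ] MvPolynomial RTree.TreeTwo ℝ),
      (∀ b : RTree.BTwo, Psi (GuinOudom.inj b) = GuinOudom.inj (RTree.psi b)) ∧
      IsHopf (GuinOudom.coprod MultiIndex.zBasis) (polyCounit MultiIndex.PopTwo) SM ∧
      IsHopf RTree.coprodEC.toLinearMap (polyCounit RTree.TreeTwo) ST ∧
      (∀ (u : GuinOudom.U RTree.BTwo) (p : MvPolynomial MultiIndex.PopTwo ℝ),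
        GuinOudom.pairing RTree.treeBasis (fun t => (RTree.sym t.1 : ℝ)) u (PsiDagger p) =
          GuinOudom.pairing MultiIndex.zBasis (fun _ => 1) (Psi u) p) ∧
      IsHopfHom (GuinOudom.coprod MultiIndex.zBasis) (polyCounit MultiIndex.PopTwo) SM
        RTree.coprodEC.toLinearMap (polyCounit RTree.TreeTwo) ST PsiDagger := by
  obtain ⟨SM, hSM⟩ := GuinOudom.exists_isHopf_coprod MultiIndex.isGraded_zBasis
    MultiIndex.isConnected_degPop
  obtain ⟨ST, hST⟩ := RTree.exists_isHopf_coprodEC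
  have hΔ := RTree.coprodEC_psiDagger
  have hε : ∀ p, polyCounit RTree.TreeTwo (RTree.psiDagger p) = polyCounit MultiIndex.PopTwo p :=
    fun p => by
      -- The counit is the pairing with the unit for every choice of weight, so weight 1 serves on
      -- both sides.
      rw [GuinOudom.polyCounit_eq (a := RTree.treeBasis) (w := fun _ => 1),
        GuinOudom.polyCounit_eq (a := MultiIndex.zBasis) (w := fun _ => 1), GuinOudom.pairing_one,
        GuinOudom.pairing_one, RTree.constantCoeff_psiDagger]
  exact ⟨RTree.psi_mul, GuinOudom.mapU RTree.psi RTree.psi_mul, SM, ST, RTree.psiDagger,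
    GuinOudom.mapU_inj _ _, hSM, hST, RTree.pairing_psiDagger,
    ⟨hΔ, hε, hSM.map_antipode hST RTree.psiDagger hΔ hε⟩⟩
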